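/- **Theorem (Frequency-domain formula for the reduced complete third cumulant).** Let $\nu>0$, $0<m<1$, and let $h$ be a probability density on $\mathbb{R}$ (with no restriction on its support). Let $N$ be the stationary Poisson branching-cluster process on $\mathbb{R}$ with immigrant rate $\nu$ and offspring displacement intensity $m\,h(x)\,dx$: $N=\sum_j\sum_{x\in C_j}\delta_{U_j+x}$, where $(U_j)$ are the points of a homogeneous Poisson process of rate $\nu$ and, independently of it, the $C_j$ are i.i.d. copies of the rooted branching cluster $C$, i.e. the collection of the positions of all individuals of a family tree whose root sits at $0$ and in which the displacements of the children of each individual relative to it form, independently for different individuals, a Poisson process on $\mathbb{R}$ with intensity measure $m\,h(x)\,dx$. Write $$\widehat h(\omega)=\int_{\mathbb{R}}e^{-i\omega x}h(x)\,dx,\qquad R(\omega)=\frac{1}{1-m\widehat h(\omega)},\qquad \lambda=\frac{\nu}{1-m}.$$ The complete third cumulant measure $\gamma_3$ of $N$ is the locally finite signed measure on $\mathbb{R}^3$ determined by $$\int f_0(t_0)f_1(t_1)f_2(t_2)\,\gamma_3(dt_0,dt_1,dt_2)=\partial_{s_0}\partial_{s_1}\partial_{s_2}\log\mathbb{E}\exp\Big(\sum_{x\in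 N}\sum_{j=0}^2 s_jf_j(x)\Big)\Big|_{s=0}$$ for all bounded compactly supported Borel functions $f_0,f_1,f_2$ on $\mathbb{R}$ (the expectation being finite for $s$ near $0$ and the logarithm three times continuously differentiable near $0$), and its reduced version is the finite signed measure $\gamma_3^{\mathrm{red}}$ on $\mathbb{R}^2$ with $$\int F\,d\gamma_3=\int_{\mathbb{R}}\int_{\mathbb{R}^2}F(t_0,t_0+\tau_1,t_0+\tau_2)\,\gamma_3^{\mathrm{red}}(d\tau_1,d\tau_2)\,dt_0$$ for all bounded compactly supported Borel functions $F$ on $\mathbb{R}^3$. Then $\gamma_3^{\mathrm{red}}$ exists and is unique, and its Fourier–Stieltjes transform $B_{\mathrm{comp}}(\omega_1,\omega_2)=\int e^{-i(\omega_1\tau_1+\omega_2\tau_2)}\,\gamma_3^{\mathrm{red}}(d\tau_1,d\tau_2)$ satisfies, for all $\omega_1,\omega_2\in\mathbb{R}$ and $\omega_3:=-\omega_1-\omega_2$, $$B_{\mathrm{comp}}(\omega_1,\omega_2)=\lambda R(\omega_1)R(\omega_2)R(\omega_3)\{R(-\omega_1)+R(-\omega_2)+R(-\omega_3)-2\}.$$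 Equivalently, $$B_{\mathrm{comp}}(\omega_1,\omega_2)=\lambda\,\frac{1-m^2Q(\omega_1,\omega_2)}{|1-m\widehat h(\omega_1)|^2\,|1-m\widehat h(\omega_2)|^2\,|1-m\widehat h(-\omega_1-\omega_2)|^2},$$ where $$Q(\omega_1,\omega_2)=\widehat h(-\omega_1)\widehat h(-\omega_2)+\widehat h(\omega_1+\omega_2)\{\widehat h(-\omega_1)+\widehat h(-\omega_2)-2m\widehat h(-\omega_1)\widehat h(-\omega_2)\}.$$ The denominator is real and strictly positive, and hence $$\operatorname{Im}B_{\mathrm{comp}}(\omega_1,\omega_2)=-\lambda m^2\,\frac{\operatorname{Im}Q(\omega_1,\omega_2)}{|1-m\widehat h(\omega_1)|^2\,|1-m\widehat h(\omega_2)|^2\,|1-m\widehat h(-\omega_1-\omega_2)|^2}.$$ -/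

import Mathlib

namespace BranchingCluster

open MeasureTheory ProbabilityTheory Topology

/-- The random measure `ξ` is a Poisson point process on `ℝ` with intensity measure `Λ`: the counts
of sets of finite intensity are Poisson, and counts of disjoint sets are independent. -/
structure IsPoissonProcess {Ω : Type*} [MeasurableSpace Ω] (P : Measure Ω) (ξ : Ω → Measure ℝ)
    (Λ : Measure ℝ) : Prop where
  count_law : ∀ A : Set ℝ, MeasurableSet A → Λ A ≠ ⊤ →
    P.map (fun ω => ξ ω A) = (poissonMeasure (Λ A).toNNReal).map (fun k : ℕ => (k : ENNReal))
  count_indep : ∀ (n : ℕ) (A : Fin n → Set ℝ), (∀ i, MeasurableSet (A i)) →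
    Pairwise (fun i j => Disjoint (A i) (A j)) → iIndepFun (fun i ω => ξ ω (A i)) P

/-- The offspring of one individual: the number `K` of children and a sequence whose first `K`
entries are the displacements of the children relative to the parent. -/
abbrev Offspring := ℕ × (ℕ → ℝ)

/-- The offspring displacements as a counting measure. -/
noncomputable def offspringMeasure (o : Offspring) : Measure ℝ :=
  ∑ i ∈ Finset.range o.1, Measure.dirac (o.2 i)

/-- Individuals are labelled by words: `[]` is the root and `i :: w` is the descendant `w` of the
child number `i` of the root. `Alive z v` says that the label `v` occurs in the family tree in which
`z v` is the offspring of the individual `v`. -/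
def Alive : (List ℕ → Offspring) → List ℕ → Prop
  | _, [] => True
  | z, i :: w => i < (z []).1 ∧ Alive (fun v => z (i :: v)) w

/-- The position of the individual `v` when the root sits at `0`: the sum of the displacements along
the ancestral line of `v`. -/
def position : (List ℕ → Offspring) → List ℕ → ℝ
  | _, [] => 0
  | z, i :: w => (z []).2 i + position (fun v => z (i :: v)) w

/-- The rooted branching cluster: the counting measure of the positions of all individuals of the
family tree, the root at `0` included. -/
noncomputable def cluster (z : List ℕ → Offspring) : Measure ℝ :=
  Measure.sum fun v : {v : List ℕ // Alive z v} => Measure.dirac (position z v.1)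

/-- `N` is the stationary Poisson branching-cluster process with immigrant rate `ν` and offspring
displacement intensity `m h(x) dx`: `N` is almost surely the superposition of the clusters with
family trees `Z j`, translated by the points `U j` of a homogeneous Poisson process of rate `ν`;
the offspring `Z j v` of all individuals are i.i.d. Poisson processes with intensity `m h(x) dx`,
independent of the immigrants. -/
def IsPoissonBranchingClusterProcess {Ω : Type*} [MeasurableSpace Ω] (P : Measure Ω)
    (ν m : ℝ) (h : ℝ → ℝ) (N : Ω → Measure ℝ) : Prop :=
  ∃ (U : ℕ → Ω → ℝ) (Z : ℕ → List ℕ → Ω → Offspring),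
    (∀ j, Measurable (U j)) ∧
    (∀ j v, Measurable (Z j v)) ∧
    IsPoissonProcess P (fun ω => Measure.sum fun j : ℕ => Measure.dirac (U j ω))
      (ENNReal.ofReal ν • (volume : Measure ℝ)) ∧
    (∀ j v, IsPoissonProcess P (fun ω => offspringMeasure (Z j v ω))
      ((volume : Measure ℝ).withDensity fun x => ENNReal.ofReal (m * h x))) ∧
    (∀ j v, IdentDistrib (Z j v) (Z 0 []) P P) ∧
    iIndepFun (fun (p : ℕ × List ℕ) ω => Z p.1 p.2 ω) P ∧
    IndepFun (fun ω j => U j ω) (fun ω (p : ℕ × List ℕ) => Z p.1 p.2 ω) P ∧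
    ∀ᵐ ω ∂P, N ω = Measure.sum fun j : ℕ => (cluster fun v => Z j v ω).map (fun x => x + U j ω)

/-- Bounded Borel functions with compact support. -/
structure IsTestFunction {E : Type*} [TopologicalSpace E] [MeasurableSpace E] (f : E → ℝ) :
    Prop where
  measurable : Measurable f
  bounded : ∃ c : ℝ, ∀ x, |f x| ≤ c
  compactSupport : HasCompactSupport f

/-- The complete cumulant generating functional `log E exp (N f)`. -/
noncomputable def completeCGF {Ω : Type*} [MeasurableSpace Ω] (P : Measure Ω) (N : Ω → Measure ℝ)
    (f : ℝ → ℝ) : ℝ :=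
  Real.log (∫ ω, Real.exp (∫ x, f x ∂(N ω)) ∂P)

/-- The difference `γp - γm` of two locally finite measures on `ℝ³` is the third complete cumulant
measure of `N`: for all test functions the generating functional is finite and smooth enough near
the origin, and its mixed third derivative there is the integral of the product. -/
structure IsThirdCompleteCumulant {Ω : Type*} [MeasurableSpace Ω] (P : Measure Ω)
    (N : Ω → Measure ℝ) (γp γm : Measure (ℝ × ℝ × ℝ)) : Prop where
  locallyFinite_pos : IsLocallyFiniteMeasure γp
  locallyFinite_neg : IsLocallyFiniteMeasure γm
  finite_near_zero : ∀ f : Fin 3 → ℝ → ℝ, (∀ j, IsTestFunction (f j)) →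
    ∀ᶠ s : Fin 3 → ℝ in 𝓝 0,
      Integrable (fun ω => Real.exp (∫ x, (∑ j, s j * f j x) ∂(N ω))) P
  contDiffAt : ∀ f : Fin 3 → ℝ → ℝ, (∀ j, IsTestFunction (f j)) →
    ContDiffAt ℝ 3 (fun s : Fin 3 → ℝ => completeCGF P N fun x => ∑ j, s j * f j x) 0
  mixed_deriv : ∀ f : Fin 3 → ℝ → ℝ, (∀ j, IsTestFunction (f j)) →
    (∫ t, f 0 t.1 * f 1 t.2.1 * f 2 t.2.2 ∂γp) - (∫ t, f 0 t.1 * f 1 t.2.1 * f 2 t.2.2 ∂γm) =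
      deriv (fun s₀ => deriv (fun s₁ => deriv (fun s₂ =>
        completeCGF P N fun x => s₀ * f 0 x + s₁ * f 1 x + s₂ * f 2 x) 0) 0) 0

/-- The finite signed measure `γ` on `ℝ²` is the reduced third complete cumulant measure of `N`. -/
def IsReducedThirdCompleteCumulant {Ω : Type*} [MeasurableSpace Ω] (P : Measure Ω)
    (N : Ω → Measure ℝ) (γ : SignedMeasure (ℝ × ℝ)) : Prop :=
  ∃ γp γm : Measure (ℝ × ℝ × ℝ), IsThirdCompleteCumulant P N γp γm ∧
    ∀ F : ℝ × ℝ × ℝ → ℝ, IsTestFunction F →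
      (∫ t, F t ∂γp) - (∫ t, F t ∂γm) =
        ∫ t₀ : ℝ, (∫ᵛ τ, F (t₀, t₀ + τ.1, t₀ + τ.2) ∂<•γ)

/-- The Fourier–Stieltjes transform of a finite signed measure on `ℝ²`. -/
noncomputable def fourierStieltjes (γ : SignedMeasure (ℝ × ℝ)) (ω₁ ω₂ : ℝ) : ℂ :=
  ∫ᵛ τ, Complex.exp (-Complex.I * ((ω₁ * τ.1 + ω₂ * τ.2 : ℝ) : ℂ)) ∂<•γ

/-- The Fourier transform `∫ exp (-i ω x) h(x) dx`. -/
noncomputable def fourierHat (h : ℝ → ℝ) (ω : ℝ) : ℂ :=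
  ∫ x : ℝ, Complex.exp (-Complex.I * ((ω * x : ℝ) : ℂ)) * (h x : ℂ)

/-- `R(ω) = 1 / (1 - m ĥ(ω))`. -/
noncomputable def R (m : ℝ) (h : ℝ → ℝ) (ω : ℝ) : ℂ :=
  1 / (1 - (m : ℂ) * fourierHat h ω)

/-- The numerator term `Q(ω₁, ω₂)`. -/
noncomputable def Q (m : ℝ) (h : ℝ → ℝ) (ω₁ ω₂ : ℝ) : ℂ :=
  fourierHat h (-ω₁) * fourierHat h (-ω₂) +
    fourierHat h (ω₁ + ω₂) * (fourierHat h (-ω₁) + fourierHat h (-ω₂) -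
      2 * (m : ℂ) * fourierHat h (-ω₁) * fourierHat h (-ω₂))

/-- The real denominator `|1 - m ĥ(ω₁)|² |1 - m ĥ(ω₂)|² |1 - m ĥ(-ω₁ - ω₂)|²`. -/
noncomputable def denom (m : ℝ) (h : ℝ → ℝ) (ω₁ ω₂ : ℝ) : ℝ :=
  ‖1 - (m : ℂ) * fourierHat h ω₁‖ ^ 2 * ‖1 - (m : ℂ) * fourierHat h ω₂‖ ^ 2 *
    ‖1 - (m : ℂ) * fourierHat h (-ω₁ - ω₂)‖ ^ 2

end BranchingCluster

open MeasureTheory BranchingCluster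

/-! Write `C(f)` for the sum of `f` over a cluster and `C_u(f)` for the sum over the cluster
translated by `u`. Given the immigrants, the clusters are independent, and the exponential formula
for the Poisson process of immigrants gives `log E exp N(f) = ν ∫ (E exp C_u(f) - 1) du`. The
logarithm has disappeared, so the mixed third derivative at the origin is `ν ∫ E[C_u(f₀) C_u(f₁)
C_u(f₂)] du`. Hence the third cumulant measure is `ν` times the third moment measure of one cluster,
spread along the diagonal by Lebesgue measure. Its reduction is the positive measure obtained by
pushing `ν E[C ⊗ C ⊗ C]` forward to the differences with the first point, and its transform is `ν
E[Ĉ(ω₁) Ĉ(ω₂) Ĉ(ω₃)]` with `ω₁ + ω₂ + ω₃ = 0` (`exists_completeCGF_eq`, `unreduce_map_diff`,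
`fourierStieltjes_reducedMeasure`).

The moments of `Ĉ` follow from the branching property `Ĉ(ω) = 1 + ∑ᵢ exp(-iωxᵢ) Ĉᵢ(ω)`, where the
`xᵢ` form a Poisson process and the `Ĉᵢ` are independent copies. The sums over the children are
compound Poisson, so their joint cumulants are moments of `Ĉ` multiplied by values of `m ĥ`. With `R
= 1 + R m ĥ` this yields first moments `R(ω)`, second moments `R(ω) R(ω') R(ω + ω')`, and for the
third moment `t` the linear equation `t = R₁ R₂ R₃ (1 + ∑ⱼ R(-ωⱼ) m ĥ(-ωⱼ)) + m t`, because the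
frequencies sum to zero and `ĥ(0) = 1`. Replacing `R m ĥ` by `R - 1` turns the bracket into `∑ⱼ
R(-ωⱼ) - 2`, and `ν / (1 - m) = λ` (`third_moment`, `integral_clusterHat_mul_mul`).

The analytic input is an exponential moment of the total progeny, which holds because the tree is
subcritical (`exists_exp_moment_cluster`). It gives the third moments, the convergence of the
Laplace functional and the differentiability under the integral. Uniqueness holds because products
of indicators of bounded sets determine a translation-invariant measure, which in turn determines
its reduction (`unreduce_ext`). -/

namespace BranchingCluster

open ProbabilityTheory Filter Topology
open scoped NNReal ENNReal

/-! ### Moments and exponential moments of the Poisson distribution. -/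

section PoissonMeasure

theorem integrable_exp_mul_poissonMeasure (r : ℝ≥0) (c : ℝ) :
    Integrable (fun n : ℕ => Real.exp (c * n)) (poissonMeasure r) := by
  rw [integrable_poissonMeasure_iff]
  have h := (Real.summable_pow_div_factorial (r * Real.exp c)).mul_left (Real.exp (-r))
  refine h.congr fun n => ?_
  rw [Real.norm_eq_abs, Real.abs_exp, mul_pow, ← Real.exp_nat_mul, mul_comm c]
  ring

theorem integral_exp_mul_poissonMeasure (r : ℝ≥0) (c : ℝ) :
    ∫ n : ℕ, Real.exp (c * n) ∂(poissonMeasure r) = Real.exp (r * (Real.exp c - 1)) := by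
  rw [integral_poissonMeasure]
  have h := (NormedSpace.expSeries_div_hasSum_exp (r * Real.exp c : ℝ)).mul_left (Real.exp (-r))
  rw [← Real.exp_eq_exp_ℝ, ← Real.exp_add] at h
  rw [show (r : ℝ) * (Real.exp c - 1) = -r + r * Real.exp c by ring, ← h.tsum_eq]
  refine tsum_congr fun n => ?_
  rw [mul_pow, ← Real.exp_nat_mul, mul_comm c, smul_eq_mul]
  ring

theorem integrable_pow_poissonMeasure (r : ℝ≥0) (k : ℕ) :
    Integrable (fun n : ℕ => (n : ℝ) ^ k) (poissonMeasure r) := by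
  refine ((integrable_exp_mul_poissonMeasure r 1).const_mul (k.factorial : ℝ)).mono'
    (by fun_prop) (ae_of_all _ fun n => ?_)
  have := Real.pow_div_factorial_le_exp (n : ℝ) (by positivity) k
  rw [div_le_iff₀ (by positivity)] at this
  rw [Real.norm_of_nonneg (by positivity), one_mul]
  linarith

/-- The Stein–Chen identity for monomials. -/
theorem integral_pow_succ_poissonMeasure (r : ℝ≥0) (k : ℕ) :
    ∫ n : ℕ, (n : ℝ) ^ (k + 1) ∂(poissonMeasure r) =
      r * ∫ n : ℕ, ((n : ℝ) + 1) ^ k ∂(poissonMeasure r) := by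
  have h := hasSum_integral_poissonMeasure (integrable_pow_poissonMeasure r (k + 1))
  rw [integral_poissonMeasure r (fun n : ℕ => ((n : ℝ) + 1) ^ k), ← h.tsum_eq,
    h.summable.tsum_eq_zero_add, ← tsum_mul_left]
  simp only [CharP.cast_eq_zero, smul_eq_mul, ne_eq, Nat.add_eq_zero_iff, one_ne_zero, and_false,
    not_false_eq_true, zero_pow, mul_zero, zero_add]
  refine tsum_congr fun n => ?_
  rw [Nat.factorial_succ]
  push_cast
  field_simp
  ring

theorem integral_id_poissonMeasure (r : ℝ≥0) : ∫ n : ℕ, (n : ℝ) ∂(poissonMeasure r) = r := by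
  simpa using integral_pow_succ_poissonMeasure r 0

theorem integral_sq_poissonMeasure (r : ℝ≥0) :
    ∫ n : ℕ, (n : ℝ) ^ 2 ∂(poissonMeasure r) = r ^ 2 + r := by
  have h1 : Integrable (fun n : ℕ => (n : ℝ)) (poissonMeasure r) := by
    simpa using integrable_pow_poissonMeasure r 1
  rw [integral_pow_succ_poissonMeasure]
  simp only [pow_one]
  rw [integral_add h1 (integrable_const _), integral_id_poissonMeasure]
  simp
  ring

theorem integral_cube_poissonMeasure (r : ℝ≥0) :
    ∫ n : ℕ, (n : ℝ) ^ 3 ∂(poissonMeasure r) = r ^ 3 + 3 * r ^ 2 + r := by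
  have h1 : Integrable (fun n : ℕ => (n : ℝ)) (poissonMeasure r) := by
    simpa using integrable_pow_poissonMeasure r 1
  have h2 := integrable_pow_poissonMeasure r 2
  rw [integral_pow_succ_poissonMeasure]
  have : ∀ n : ℕ, ((n : ℝ) + 1) ^ 2 = (n : ℝ) ^ 2 + (2 * (n : ℝ) + 1) := fun n => by ring
  simp only [this]
  rw [integral_add h2 (g := fun n : ℕ => 2 * (n : ℝ) + 1) ((h1.const_mul 2).add (integrable_const _)),
    integral_add (h1.const_mul 2) (integrable_const _), integral_const_mul,
    integral_id_poissonMeasure, integral_sq_poissonMeasure]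
  simp
  ring

end PoissonMeasure

/-! ### Counts of a Poisson process and its mean measure. -/

namespace IsPoissonProcess

variable {Ω : Type*} [MeasurableSpace Ω] {P : Measure Ω}
  {ξ : Ω → Measure ℝ} {Λ : Measure ℝ}

theorem map_real (hξ : IsPoissonProcess P ξ Λ) (hm : Measurable ξ) {A : Set ℝ}
    (hA : MeasurableSet A) (hΛ : Λ A ≠ ⊤) :
    P.map (fun ω => (ξ ω).real A) =
      (poissonMeasure (Λ A).toNNReal).map ((↑) : ℕ → ℝ) := by
  have h := congrArg (Measure.map ENNReal.toReal) (hξ.count_law A hA hΛ)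
  have hmeas : Measurable fun ω => ξ ω A := (Measure.measurable_coe hA).comp hm
  rw [Measure.map_map (by fun_prop) hmeas,
    Measure.map_map (by fun_prop) (by fun_prop)] at h
  have hc : (Nat.cast : ℕ → ℝ) = ENNReal.toReal ∘ fun k : ℕ => (k : ℝ≥0∞) := by
    ext n
    simp
  rw [hc]
  exact h

theorem measurable_real (hm : Measurable ξ) {A : Set ℝ} (hA : MeasurableSet A) :
    Measurable fun ω => (ξ ω).real A :=
  ((Measure.measurable_coe hA).comp hm).ennreal_toReal

theorem integral_comp_real (hξ : IsPoissonProcess P ξ Λ) (hm : Measurable ξ) {A : Set ℝ}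
    (hA : MeasurableSet A) (hΛ : Λ A ≠ ⊤) {f : ℝ → ℝ} (hf : Measurable f) :
    ∫ ω, f ((ξ ω).real A) ∂P = ∫ n : ℕ, f n ∂(poissonMeasure (Λ A).toNNReal) := by
  rw [← integral_map (f := f) (measurable_real hm hA).aemeasurable hf.aestronglyMeasurable,
    hξ.map_real hm hA hΛ, integral_map (by fun_prop) hf.aestronglyMeasurable]

theorem integrable_comp_real (hξ : IsPoissonProcess P ξ Λ) (hm : Measurable ξ) {A : Set ℝ}
    (hA : MeasurableSet A) (hΛ : Λ A ≠ ⊤) {f : ℝ → ℝ} (hf : Measurable f)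
    (hi : Integrable (fun n : ℕ => f n) (poissonMeasure (Λ A).toNNReal)) :
    Integrable (fun ω => f ((ξ ω).real A)) P := by
  have : Integrable f (P.map fun ω => (ξ ω).real A) := by
    rw [hξ.map_real hm hA hΛ]
    exact (integrable_map_measure hf.aestronglyMeasurable (by fun_prop)).2 hi
  exact this.comp_measurable (measurable_real hm hA)

theorem ae_count_lt_top (hξ : IsPoissonProcess P ξ Λ) (hm : Measurable ξ) {A : Set ℝ}
    (hA : MeasurableSet A) (hΛ : Λ A ≠ ⊤) : ∀ᵐ ω ∂P, ξ ω A < ⊤ := by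
  have hmeas : Measurable fun ω => ξ ω A := (Measure.measurable_coe hA).comp hm
  have h : ∀ᵐ x ∂(P.map fun ω => ξ ω A), x < ⊤ := by
    rw [hξ.count_law A hA hΛ, ae_map_iff (by fun_prop) measurableSet_Iio]
    exact ae_of_all _ fun n => ENNReal.natCast_lt_top n
  exact (ae_map_iff hmeas.aemeasurable measurableSet_Iio).1 h

theorem integrable_real_pow (hξ : IsPoissonProcess P ξ Λ) (hm : Measurable ξ) {A : Set ℝ}
    (hA : MeasurableSet A) (hΛ : Λ A ≠ ⊤) (k : ℕ) :
    Integrable (fun ω => (ξ ω).real A ^ k) P :=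
  hξ.integrable_comp_real hm hA hΛ (f := fun x => x ^ k) (by fun_prop)
    (integrable_pow_poissonMeasure _ k)

theorem integral_real (hξ : IsPoissonProcess P ξ Λ) (hm : Measurable ξ) {A : Set ℝ}
    (hA : MeasurableSet A) (hΛ : Λ A ≠ ⊤) : ∫ ω, (ξ ω).real A ∂P = Λ.real A :=
  (hξ.integral_comp_real hm hA hΛ (f := fun x => x) (by fun_prop)).trans
    (integral_id_poissonMeasure _)

theorem integral_real_sq (hξ : IsPoissonProcess P ξ Λ) (hm : Measurable ξ) {A : Set ℝ}
    (hA : MeasurableSet A) (hΛ : Λ A ≠ ⊤) :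
    ∫ ω, (ξ ω).real A ^ 2 ∂P = Λ.real A ^ 2 + Λ.real A :=
  (hξ.integral_comp_real hm hA hΛ (f := fun x => x ^ 2) (by fun_prop)).trans
    (integral_sq_poissonMeasure _)

theorem integral_real_cube (hξ : IsPoissonProcess P ξ Λ) (hm : Measurable ξ) {A : Set ℝ}
    (hA : MeasurableSet A) (hΛ : Λ A ≠ ⊤) :
    ∫ ω, (ξ ω).real A ^ 3 ∂P = Λ.real A ^ 3 + 3 * Λ.real A ^ 2 + Λ.real A :=
  (hξ.integral_comp_real hm hA hΛ (f := fun x => x ^ 3) (by fun_prop)).trans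
    (integral_cube_poissonMeasure _)

theorem integrable_exp_mul_real (hξ : IsPoissonProcess P ξ Λ) (hm : Measurable ξ) {A : Set ℝ}
    (hA : MeasurableSet A) (hΛ : Λ A ≠ ⊤) (c : ℝ) :
    Integrable (fun ω => Real.exp (c * (ξ ω).real A)) P :=
  hξ.integrable_comp_real hm hA hΛ (f := fun x => Real.exp (c * x)) (by fun_prop)
    (integrable_exp_mul_poissonMeasure _ c)

theorem integral_exp_mul_real (hξ : IsPoissonProcess P ξ Λ) (hm : Measurable ξ) {A : Set ℝ}
    (hA : MeasurableSet A) (hΛ : Λ A ≠ ⊤) (c : ℝ) :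
    ∫ ω, Real.exp (c * (ξ ω).real A) ∂P = Real.exp (Λ.real A * (Real.exp c - 1)) :=
  (hξ.integral_comp_real hm hA hΛ (f := fun x => Real.exp (c * x)) (by fun_prop)).trans
    (integral_exp_mul_poissonMeasure _ c)

/-- `count_indep` speaks of families over `Fin n`, whereas the fibres of a simple function are
indexed by its range. -/
theorem iIndepFun_real (hξ : IsPoissonProcess P ξ Λ) {ι : Type*} [Fintype ι]
    {A : ι → Set ℝ} (hA : ∀ i, MeasurableSet (A i))
    (hd : Pairwise fun i j => Disjoint (A i) (A j)) :
    iIndepFun (fun i ω => (ξ ω).real (A i)) P := by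
  let e := Fintype.equivFin ι
  have h := hξ.count_indep (Fintype.card ι) (fun k => A (e.symm k)) (fun k => hA _)
    (fun i j hij => hd (e.symm.injective.ne hij))
  have h' := (h.precomp e.injective).comp (fun _ => ENNReal.toReal) (fun _ => by fun_prop)
  convert h' using 3
  simp [Measure.real]

/-- The mean measure of a Poisson process is its intensity. -/
theorem lintegral_lintegral (hξ : IsPoissonProcess P ξ Λ) (hm : Measurable ξ)
    [IsLocallyFiniteMeasure Λ] {g : ℝ → ℝ≥0∞} (hg : Measurable g) :
    ∫⁻ ω, ∫⁻ x, g x ∂(ξ ω) ∂P = ∫⁻ x, g x ∂Λ := by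
  have key : P.bind ξ = Λ := by
    have hfin : ∀ A, MeasurableSet A → Λ A ≠ ⊤ → P.bind ξ A = Λ A := by
      intro A hA hΛ
      rw [Measure.bind_apply hA hm.aemeasurable]
      have h1 := hξ.integral_real hm hA hΛ
      have h2 := hξ.ae_count_lt_top hm hA hΛ
      have hi : Integrable (fun ω => (ξ ω).real A) P := by
        simpa using hξ.integrable_real_pow hm hA hΛ 1
      have h3 := ofReal_integral_eq_lintegral_ofReal hi (ae_of_all _ fun ω => measureReal_nonneg)
      rw [h1, ofReal_measureReal hΛ] at h3
      rw [h3]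
      refine lintegral_congr_ae ?_
      filter_upwards [h2] with ω hω
      rw [ofReal_measureReal hω.ne]
    -- Counts are controlled only on sets of finite intensity, so the two measures are compared
    -- inside each `[-n, n]`.
    refine Measure.ext_of_iUnion_eq_univ (ι := ℕ) (s := fun n => Set.Icc (-n : ℝ) n) ?_ ?_
    · refine Set.eq_univ_of_forall fun x => ?_
      obtain ⟨n, hn⟩ := exists_nat_ge |x|
      exact Set.mem_iUnion.2 ⟨n, abs_le.1 hn⟩
    · intro n
      ext A hA
      rw [Measure.restrict_apply hA, Measure.restrict_apply hA]
      refine hfin _ (hA.inter measurableSet_Icc) (measure_lt_top_of_subset Set.inter_subset_right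
        isCompact_Icc.measure_lt_top.ne).ne
  rw [← Measure.lintegral_bind hm.aemeasurable (by rw [key]; exact hg.aemeasurable), key]

/-- Restriction to a bounded window reduces a locally finite intensity to a finite one. -/
theorem restrict (hξ : IsPoissonProcess P ξ Λ) {B : Set ℝ} (hB : MeasurableSet B) :
    IsPoissonProcess P (fun ω => (ξ ω).restrict B) (Λ.restrict B) where
  count_law A hA hΛ := by
    simp only [Measure.restrict_apply hA] at hΛ ⊢
    exact hξ.count_law _ (hA.inter hB) hΛ
  count_indep n A hA hd := by
    have := hξ.count_indep n (fun i => A i ∩ B) (fun i => (hA i).inter hB)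
      (fun i j hij => (hd hij).mono Set.inter_subset_left Set.inter_subset_left)
    simpa only [Measure.restrict_apply (hA _)] using this

end IsPoissonProcess

/-! ### The exponential formula for Poisson processes. -/

/-- An integral against a random measure becomes a finite linear combination of counts of the
disjoint fibres. The values of `s` lie in an arbitrary type, so several integrands can share one
partition. -/
theorem integral_comp_simpleFunc {α β E : Type*} [MeasurableSpace α] [NormedAddCommGroup E]
    [NormedSpace ℝ E] [CompleteSpace E] (μ : Measure α) [IsFiniteMeasure μ] (s : SimpleFunc α β)
    (F : β → E) : ∫ x, F (s x) ∂μ = ∑ y : s.range, μ.real (s ⁻¹' {y.1}) • F y := by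
  have h : ∀ x, F (s x) = ∑ y ∈ s.range, (s ⁻¹' {y}).indicator (fun _ => F y) x := by
    intro x
    rw [Finset.sum_eq_single (s x)]
    · simp
    · intro y _ hy
      rw [Set.indicator_of_notMem]
      simpa using hy.symm
    · intro hx
      exact absurd (s.mem_range_self x) hx
  simp only [h]
  rw [integral_finsetSum _ fun y _ =>
    (integrable_const _).indicator (s.measurableSet_preimage _), ← Finset.sum_coe_sort]
  refine Finset.sum_congr rfl fun y _ => ?_
  rw [integral_indicator_const _ (s.measurableSet_preimage _)]

namespace IsPoissonProcess

variable {Ω : Type*} [MeasurableSpace Ω] {P : Measure Ω} {ξ : Ω → Measure ℝ} {Λ : Measure ℝ}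

/-- The positive and negative parts have Lebesgue integrals that depend measurably on the measure.
Their difference is the Bochner integral only where `g` is integrable, hence measurability almost
everywhere. -/
theorem aemeasurable_integral (hm : Measurable ξ) {g : ℝ → ℝ} (hg : Measurable g)
    (hi : ∀ᵐ ω ∂P, Integrable g (ξ ω)) : AEMeasurable (fun ω => ∫ x, g x ∂(ξ ω)) P := by
  have h1 : Measurable fun ω => (∫⁻ x, ENNReal.ofReal (g x) ∂(ξ ω)).toReal :=
    ((Measure.measurable_lintegral (by fun_prop)).comp hm).ennreal_toReal
  have h2 : Measurable fun ω => (∫⁻ x, ENNReal.ofReal (-g x) ∂(ξ ω)).toReal :=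
    ((Measure.measurable_lintegral (by fun_prop)).comp hm).ennreal_toReal
  refine ⟨_, h1.sub h2, ?_⟩
  filter_upwards [hi] with ω hω
  exact integral_eq_lintegral_pos_part_sub_lintegral_neg_part hω

theorem measurable_restrict_comp (hm : Measurable ξ) {B : Set ℝ} (hB : MeasurableSet B) :
    Measurable fun ω => (ξ ω).restrict B := by
  refine Measure.measurable_of_measurable_coe _ fun A hA => ?_
  simp only [Measure.restrict_apply hA]
  exact (Measure.measurable_coe (hA.inter hB)).comp hm

theorem aestronglyMeasurable_integral_complex (hm : Measurable ξ) {g : ℝ → ℂ} (hg : Measurable g)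
    (hi : ∀ᵐ ω ∂P, Integrable g (ξ ω)) :
    AEStronglyMeasurable (fun ω => ∫ x, g x ∂(ξ ω)) P := by
  have h1 := aemeasurable_integral hm (Complex.measurable_re.comp hg)
    (hi.mono fun ω hω => hω.re)
  have h2 := aemeasurable_integral hm (Complex.measurable_im.comp hg)
    (hi.mono fun ω hω => hω.im)
  have h3 : AEMeasurable (fun ω => ((∫ x, (g x).re ∂(ξ ω) : ℝ) : ℂ) +
      ((∫ x, (g x).im ∂(ξ ω) : ℝ) : ℂ) * Complex.I) P := by
    exact ((Complex.measurable_ofReal.comp_aemeasurable h1).add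
      ((Complex.measurable_ofReal.comp_aemeasurable h2).mul_const _))
  refine (h3.congr ?_).aestronglyMeasurable
  filter_upwards [hi] with ω hω
  exact integral_re_add_im hω

section FiniteIntensity

variable [IsFiniteMeasure Λ]

theorem ae_isFiniteMeasure (hξ : IsPoissonProcess P ξ Λ) (hm : Measurable ξ) :
    ∀ᵐ ω ∂P, IsFiniteMeasure (ξ ω) :=
  (hξ.ae_count_lt_top hm .univ (measure_ne_top _ _)).mono fun _ h => ⟨h⟩

/-- The exponent is a sum of multiples of independent Poisson counts, so the expectation factors
into Poisson moment generating functions. -/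
theorem integral_exp_simpleFunc (hξ : IsPoissonProcess P ξ Λ) (hm : Measurable ξ)
    (s : SimpleFunc ℝ ℝ) :
    ∫ ω, Real.exp (∫ x, s x ∂(ξ ω)) ∂P = Real.exp (∫ x, (Real.exp (s x) - 1) ∂Λ) := by
  have hA : ∀ y : s.range, MeasurableSet (s ⁻¹' {y.1}) := fun y => s.measurableSet_preimage _
  have hind := hξ.iIndepFun_real hA (fun y y' hyy' => by
    refine Set.disjoint_left.2 fun x hx hx' => hyy' (Subtype.ext ?_)
    exact (show s x = y.1 from hx).symm.trans hx')
  have h1 : ∫ ω, Real.exp (∫ x, s x ∂(ξ ω)) ∂P =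
      ∫ ω, ∏ y : s.range, Real.exp (y.1 * (ξ ω).real (s ⁻¹' {y.1})) ∂P := by
    refine integral_congr_ae ?_
    filter_upwards [hξ.ae_isFiniteMeasure hm] with ω hω
    rw [← Real.exp_sum, integral_comp_simpleFunc (ξ ω) s (fun y => y)]
    simp [mul_comm]
  rw [h1, hind.integral_fun_prod_comp (f := fun y x => Real.exp (y.1 * x))
    (fun y => (measurable_real hm (hA y)).aemeasurable) (fun y => by fun_prop),
    integral_comp_simpleFunc Λ s (fun y => Real.exp y - 1), Real.exp_sum]
  refine Finset.prod_congr rfl fun y _ => ?_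
  rw [hξ.integral_exp_mul_real hm (hA y) (measure_ne_top _ _), smul_eq_mul]

theorem norm_integral_le_mul_real {E : Type*} [NormedAddCommGroup E] [NormedSpace ℝ E]
    (μ : Measure ℝ) [IsFiniteMeasure μ] {g : ℝ → E} {c : ℝ} (hc : ∀ x, ‖g x‖ ≤ c) :
    ‖∫ x, g x ∂μ‖ ≤ c * μ.real Set.univ :=
  norm_integral_le_of_norm_le_const (ae_of_all _ hc)

/-- The exponential formula for a Poisson process of finite intensity and a bounded function. -/
theorem integrable_exp_of_bounded (hξ : IsPoissonProcess P ξ Λ) (hm : Measurable ξ)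
    {g : ℝ → ℝ} (hg : Measurable g) {c : ℝ} (hc : ∀ x, ‖g x‖ ≤ c) :
    Integrable (fun ω => Real.exp (∫ x, g x ∂(ξ ω))) P := by
  refine (hξ.integrable_exp_mul_real hm .univ (measure_ne_top _ _) c).mono' ?_ ?_
  · refine (Real.measurable_exp.comp_aemeasurable (aemeasurable_integral hm hg
      ?_)).aestronglyMeasurable
    filter_upwards [hξ.ae_isFiniteMeasure hm] with ω hω
    exact .of_bound hg.aestronglyMeasurable c (ae_of_all _ hc)
  · filter_upwards [hξ.ae_isFiniteMeasure hm] with ω hω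
    rw [Real.norm_of_nonneg (Real.exp_nonneg _)]
    exact Real.exp_le_exp.2 ((le_abs_self _).trans (norm_integral_le_mul_real _ hc))

/-- Simple functions bounded by `c` converge to `g`, and `exp (c ξ(ℝ))` dominates all the
exponentials. -/
theorem integral_exp_of_bounded (hξ : IsPoissonProcess P ξ Λ) (hm : Measurable ξ)
    {g : ℝ → ℝ} (hg : Measurable g) {c : ℝ} (hc0 : 0 ≤ c) (hc : ∀ x, ‖g x‖ ≤ c) :
    ∫ ω, Real.exp (∫ x, g x ∂(ξ ω)) ∂P = Real.exp (∫ x, (Real.exp (g x) - 1) ∂Λ) := by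
  have hs := hg.stronglyMeasurable
  let s := hs.approxBounded c
  have hsb : ∀ n x, ‖s n x‖ ≤ c := fun n x => hs.norm_approxBounded_le hc0 n x
  have hst : ∀ x, Tendsto (fun n => s n x) atTop (𝓝 (g x)) := fun x =>
    hs.tendsto_approxBounded_of_norm_le (hc x)
  have hlim : ∀ᵐ ω ∂P, Tendsto (fun n => Real.exp (∫ x, s n x ∂(ξ ω))) atTop
      (𝓝 (Real.exp (∫ x, g x ∂(ξ ω)))) := by
    filter_upwards [hξ.ae_isFiniteMeasure hm] with ω hω
    refine (Real.continuous_exp.tendsto _).comp ?_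
    exact tendsto_integral_of_dominated_convergence (fun _ => c)
      (fun n => (s n).measurable.aestronglyMeasurable) (integrable_const _)
      (fun n => ae_of_all _ (hsb n)) (ae_of_all _ hst)
  have hL : Tendsto (fun n => ∫ ω, Real.exp (∫ x, s n x ∂(ξ ω)) ∂P) atTop
      (𝓝 (∫ ω, Real.exp (∫ x, g x ∂(ξ ω)) ∂P)) := by
    refine tendsto_integral_of_dominated_convergence _
      (fun n => (hξ.integrable_exp_of_bounded hm (s n).measurable (hsb n)).1)
      (hξ.integrable_exp_mul_real hm .univ (measure_ne_top _ _) c)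
      (fun n => ?_) hlim
    filter_upwards [hξ.ae_isFiniteMeasure hm] with ω hω
    rw [Real.norm_of_nonneg (Real.exp_nonneg _)]
    exact Real.exp_le_exp.2 ((le_abs_self _).trans (norm_integral_le_mul_real _ (hsb n)))
  have hR : Tendsto (fun n => Real.exp (∫ x, (Real.exp (s n x) - 1) ∂Λ)) atTop
      (𝓝 (Real.exp (∫ x, (Real.exp (g x) - 1) ∂Λ))) := by
    refine (Real.continuous_exp.tendsto _).comp ?_
    refine tendsto_integral_of_dominated_convergence (fun _ => Real.exp c + 1)
      (fun n => ((Real.measurable_exp.comp (s n).measurable).sub_const _).aestronglyMeasurable)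
      (integrable_const _) (fun n => ae_of_all _ fun x => ?_) (ae_of_all _ fun x => ?_)
    · refine (norm_sub_le _ _).trans ?_
      rw [Real.norm_of_nonneg (Real.exp_nonneg _), norm_one]
      gcongr
      exact (le_abs_self _).trans (hsb n x)
    · exact ((Real.continuous_exp.tendsto _).comp (hst x)).sub_const _
  refine tendsto_nhds_unique hL (hR.congr fun n => ?_)
  rw [hξ.integral_exp_simpleFunc hm]

end FiniteIntensity

section LocallyFiniteIntensity

variable [IsLocallyFiniteMeasure Λ]

theorem ae_integrable (hξ : IsPoissonProcess P ξ Λ) (hm : Measurable ξ) {g : ℝ → ℝ}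
    (hg : Measurable g) (hi : Integrable g Λ) : ∀ᵐ ω ∂P, Integrable g (ξ ω) := by
  have h := hξ.lintegral_lintegral hm (g := fun x => ‖g x‖ₑ) (by fun_prop)
  have h2 := ae_lt_top ((Measure.measurable_lintegral (by fun_prop)).comp hm)
    (h.trans_lt hi.2).ne
  filter_upwards [h2] with ω hω
  exact ⟨hg.aestronglyMeasurable, hω⟩

/-- Rests on `|exp y - 1| ≤ exp c * |y|` for `|y| ≤ c`. -/
theorem integrable_exp_sub_one {α : Type*} [MeasurableSpace α] {μ : Measure α} {g : α → ℝ} {c : ℝ}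
    (hc : ∀ x, ‖g x‖ ≤ c) (hi : Integrable g μ) :
    Integrable (fun x => Real.exp (g x) - 1) μ := by
  refine (hi.norm.const_mul (Real.exp c)).mono'
    ((Real.continuous_exp.comp_aestronglyMeasurable hi.1).sub aestronglyMeasurable_const)
    (ae_of_all _ fun x => ?_)
  have h1 : g x ≤ c := (le_abs_self _).trans (hc x)
  have h0 : 0 ≤ c := (norm_nonneg _).trans (hc x)
  have h2 := Real.add_one_le_exp (g x)
  have h3 : Real.exp (g x) - 1 ≤ Real.exp (g x) * g x := by
    have := Real.add_one_le_exp (-g x)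
    have h4 : Real.exp (g x) * Real.exp (-g x) = 1 := by rw [← Real.exp_add]; simp
    nlinarith [Real.exp_pos (g x)]
  have h5 : 1 ≤ Real.exp c := Real.one_le_exp h0
  have h6 : Real.exp (g x) ≤ Real.exp c := Real.exp_le_exp.2 h1
  have h7 := le_abs_self (g x)
  have h8 := neg_abs_le (g x)
  have h9 := abs_nonneg (g x)
  simp only [Real.norm_eq_abs]
  rw [abs_le]
  constructor
  · nlinarith
  · refine h3.trans ((mul_le_mul_of_nonneg_left h7 (Real.exp_nonneg _)).trans ?_)
    gcongr

theorem monotone_Icc_neg : Monotone fun n : ℕ => Set.Icc (-n : ℝ) n := fun a b hab => by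
  have : (a : ℝ) ≤ b := by exact_mod_cast hab
  exact Set.Icc_subset_Icc (by linarith) this

theorem iUnion_Icc_neg : ⋃ n : ℕ, Set.Icc (-n : ℝ) n = Set.univ := by
  refine Set.eq_univ_of_forall fun x => ?_
  obtain ⟨n, hn⟩ := exists_nat_ge |x|
  exact Set.mem_iUnion.2 ⟨n, abs_le.1 hn⟩

theorem tendsto_integral_Icc_neg {μ : Measure ℝ} {g : ℝ → ℝ} (hi : Integrable g μ) :
    Tendsto (fun n : ℕ => ∫ x in Set.Icc (-n : ℝ) n, g x ∂μ) atTop (𝓝 (∫ x, g x ∂μ)) := by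
  have := tendsto_setIntegral_of_monotone (μ := μ) (f := g) (fun n : ℕ => measurableSet_Icc)
    monotone_Icc_neg (by rw [iUnion_Icc_neg]; exact hi.integrableOn)
  rwa [iUnion_Icc_neg, setIntegral_univ] at this

/-- Fatou along the windows `[-n, n]`: each window obeys the formula for finite intensity, and its
exponent is at most the full one since `exp ‖g‖ - 1 ≥ 0`. The result serves as the dominating
function when the windows are removed. -/
theorem integrable_exp_abs (hξ : IsPoissonProcess P ξ Λ) (hm : Measurable ξ)
    {g : ℝ → ℝ} (hg : Measurable g) {c : ℝ} (hc : ∀ x, ‖g x‖ ≤ c) (hi : Integrable g Λ) :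
    Integrable (fun ω => Real.exp (∫ x, ‖g x‖ ∂(ξ ω))) P := by
  have hc0 : 0 ≤ c := (norm_nonneg _).trans (hc 0)
  have hc' : ∀ x, ‖‖g x‖‖ ≤ c := fun x => by rw [norm_norm]; exact hc x
  have hae := hξ.ae_integrable hm hg.norm hi.norm
  refine ⟨(Real.measurable_exp.comp_aemeasurable (aemeasurable_integral hm hg.norm
    hae)).aestronglyMeasurable, ?_⟩
  rw [hasFiniteIntegral_iff_ofReal (ae_of_all _ fun _ => Real.exp_nonneg _)]
  have hfat : ∫⁻ ω, ENNReal.ofReal (Real.exp (∫ x, ‖g x‖ ∂(ξ ω))) ∂P ≤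
      ENNReal.ofReal (Real.exp (∫ x, (Real.exp ‖g x‖ - 1) ∂Λ)) := by
    refine le_trans (lintegral_mono_ae ?_) ((lintegral_liminf_le' (u := atTop) (f := fun (n : ℕ) ω =>
      ENNReal.ofReal (Real.exp (∫ x in Set.Icc (-n : ℝ) n, ‖g x‖ ∂(ξ ω)))) ?_).trans ?_)
    · filter_upwards [hae] with ω hω
      refine le_of_eq (Tendsto.liminf_eq ?_).symm
      exact ENNReal.tendsto_ofReal ((Real.continuous_exp.tendsto _).comp
        (tendsto_integral_Icc_neg hω))
    · intro n
      refine (Real.measurable_exp.comp_aemeasurable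
        (aemeasurable_integral (measurable_restrict_comp hm measurableSet_Icc)
          hg.norm (hae.mono fun ω hω => hω.restrict))).ennreal_ofReal
    · refine liminf_le_of_le (by isBoundedDefault) fun b hb => ?_
      obtain ⟨n, hn⟩ := hb.exists
      refine hn.trans ?_
      have hΛ : IsFiniteMeasure (Λ.restrict (Set.Icc (-n : ℝ) n)) :=
        ⟨by simpa using isCompact_Icc.measure_lt_top⟩
      have hr := hξ.restrict (B := Set.Icc (-n : ℝ) n) measurableSet_Icc
      have hm' : Measurable fun ω => (ξ ω).restrict (Set.Icc (-n : ℝ) n) :=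
        measurable_restrict_comp hm measurableSet_Icc
      rw [← ofReal_integral_eq_lintegral_ofReal (hr.integrable_exp_of_bounded hm' hg.norm hc')
        (ae_of_all _ fun _ => Real.exp_nonneg _), hr.integral_exp_of_bounded hm' hg.norm hc0 hc']
      refine ENNReal.ofReal_le_ofReal (Real.exp_le_exp.2 (setIntegral_le_integral
        (integrable_exp_sub_one hc' hi.norm) (ae_of_all _ fun x => ?_)))
      exact sub_nonneg.2 (Real.one_le_exp (norm_nonneg _))
  exact hfat.trans_lt ENNReal.ofReal_lt_top

/-- The exponential formula for a Poisson process of locally finite intensity. -/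
theorem integral_exp (hξ : IsPoissonProcess P ξ Λ) (hm : Measurable ξ)
    {g : ℝ → ℝ} (hg : Measurable g) {c : ℝ} (hc : ∀ x, ‖g x‖ ≤ c) (hi : Integrable g Λ) :
    ∫ ω, Real.exp (∫ x, g x ∂(ξ ω)) ∂P = Real.exp (∫ x, (Real.exp (g x) - 1) ∂Λ) := by
  have hc0 : 0 ≤ c := (norm_nonneg _).trans (hc 0)
  have hae := hξ.ae_integrable hm hg hi
  have hL : Tendsto (fun n : ℕ => ∫ ω, Real.exp (∫ x in Set.Icc (-n : ℝ) n, g x ∂(ξ ω)) ∂P) atTop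
      (𝓝 (∫ ω, Real.exp (∫ x, g x ∂(ξ ω)) ∂P)) := by
    refine tendsto_integral_of_dominated_convergence _ (fun n => ?_)
      (hξ.integrable_exp_abs hm hg hc hi) (fun n => ?_) ?_
    · exact (Real.measurable_exp.comp_aemeasurable
        (aemeasurable_integral (measurable_restrict_comp hm measurableSet_Icc)
          hg (hae.mono fun ω hω => hω.restrict))).aestronglyMeasurable
    · filter_upwards [hae] with ω hω
      rw [Real.norm_of_nonneg (Real.exp_nonneg _)]
      refine Real.exp_le_exp.2 ((Real.le_norm_self _).trans
        ((norm_integral_le_integral_norm _).trans ?_))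
      exact setIntegral_le_integral hω.norm (ae_of_all _ fun _ => norm_nonneg _)
    · filter_upwards [hae] with ω hω
      exact (Real.continuous_exp.tendsto _).comp (tendsto_integral_Icc_neg hω)
  have hR : Tendsto (fun n : ℕ => Real.exp (∫ x in Set.Icc (-n : ℝ) n, (Real.exp (g x) - 1) ∂Λ))
      atTop (𝓝 (Real.exp (∫ x, (Real.exp (g x) - 1) ∂Λ))) :=
    (Real.continuous_exp.tendsto _).comp
      (tendsto_integral_Icc_neg (integrable_exp_sub_one hc hi))
  refine tendsto_nhds_unique hL (hR.congr fun n => ?_)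
  have hΛ : IsFiniteMeasure (Λ.restrict (Set.Icc (-n : ℝ) n)) :=
    ⟨by simpa using isCompact_Icc.measure_lt_top⟩
  rw [(hξ.restrict (B := Set.Icc (-n : ℝ) n) measurableSet_Icc).integral_exp_of_bounded
    (measurable_restrict_comp hm measurableSet_Icc) hg hc0 hc]

end LocallyFiniteIntensity

end IsPoissonProcess

/-! ### Product moments up to order three of integrals against a finite Poisson process. -/

namespace IsPoissonProcess

variable {Ω : Type*} [MeasurableSpace Ω] {P : Measure Ω} {ξ : Ω → Measure ℝ} {Λ : Measure ℝ}
  [IsFiniteMeasure Λ]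

section Counts

variable {ι : Type*} [Fintype ι] [DecidableEq ι] {A : ι → Set ℝ}

theorem integral_real_mul (hξ : IsPoissonProcess P ξ Λ) (hm : Measurable ξ)
    (hA : ∀ i, MeasurableSet (A i)) (hd : Pairwise fun i j => Disjoint (A i) (A j)) (i j : ι) :
    ∫ ω, (ξ ω).real (A i) * (ξ ω).real (A j) ∂P =
      Λ.real (A i) * Λ.real (A j) + if i = j then Λ.real (A i) else 0 := by
  have hind := hξ.iIndepFun_real hA hd
  have hmeas : ∀ i, Measurable fun ω => (ξ ω).real (A i) := fun i => measurable_real hm (hA i)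
  have h1 := fun i => hξ.integral_real hm (hA i) (measure_ne_top _ _)
  split_ifs with hij
  · subst hij
    simp only [← sq]
    exact hξ.integral_real_sq hm (hA i) (measure_ne_top _ _)
  · rw [(hind.indepFun hij).integral_fun_mul_eq_mul_integral (hmeas i).aestronglyMeasurable
      (hmeas j).aestronglyMeasurable, h1, h1, add_zero]

/-- The five terms correspond to the partitions of three indices. If one index differs from the two
others, its count is independent of theirs; what remains is the third moment of a single Poisson
count. -/
theorem integral_real_mul_mul (hξ : IsPoissonProcess P ξ Λ) (hm : Measurable ξ)
    (hA : ∀ i, MeasurableSet (A i)) (hd : Pairwise fun i j => Disjoint (A i) (A j)) (i j k : ι) :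
    ∫ ω, (ξ ω).real (A i) * (ξ ω).real (A j) * (ξ ω).real (A k) ∂P =
      Λ.real (A i) * Λ.real (A j) * Λ.real (A k) +
        (if i = j then Λ.real (A i) * Λ.real (A k) else 0) +
        (if i = k then Λ.real (A i) * Λ.real (A j) else 0) +
        (if j = k then Λ.real (A i) * Λ.real (A j) else 0) +
        if i = j then if j = k then Λ.real (A i) else 0 else 0 := by
  have hind := hξ.iIndepFun_real hA hd
  have hmeas : ∀ i, Measurable fun ω => (ξ ω).real (A i) := fun i => measurable_real hm (hA i)
  have h1 := fun i => hξ.integral_real hm (hA i) (measure_ne_top _ _)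
  have h2 := hξ.integral_real_mul hm hA hd
  have split : ∀ i j k : ι, i ≠ k → j ≠ k →
      ∫ ω, (ξ ω).real (A i) * (ξ ω).real (A j) * (ξ ω).real (A k) ∂P =
        (Λ.real (A i) * Λ.real (A j) + if i = j then Λ.real (A i) else 0) * Λ.real (A k) := by
    intro i j k hik hjk
    rw [← h2, ← h1 k]
    exact (hind.indepFun_mul_left hmeas i j k hik hjk).integral_fun_mul_eq_mul_integral
      ((hmeas i).mul (hmeas j)).aestronglyMeasurable (hmeas k).aestronglyMeasurable
  by_cases hik : i = k
  · subst hik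
    by_cases hij : i = j
    · subst hij
      have := hξ.integral_real_cube hm (hA i) (measure_ne_top _ _)
      simp only [← sq, ← pow_succ, if_true]
      rw [this]
      ring
    · have := split i i j hij hij
      simp only [mul_right_comm _ _ ((ξ _).real (A i))] at this ⊢
      simp only [if_true, hij, Ne.symm hij, if_false] at this ⊢
      rw [this]
      ring
  · by_cases hjk : j = k
    · subst hjk
      have := split j j i (Ne.symm hik) (Ne.symm hik)
      simp only [mul_comm _ ((ξ _).real (A i)), ← mul_assoc] at this ⊢
      simp only [if_true, hik, if_false] at this ⊢
      rw [this]
      ring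
    · rw [split i j k hik hjk]
      split_ifs <;> ring

end Counts

section SimpleFunctions

theorem integrable_ofReal_mul_const {r : Ω → ℝ} (hr : Integrable r P) (c : ℂ) :
    Integrable (fun ω => (r ω : ℂ) * c) P :=
  (hr.ofReal (𝕜 := ℂ)).mul_const c

theorem integral_ofReal_mul_const (r : Ω → ℝ) (c : ℂ) :
    ∫ ω, (r ω : ℂ) * c ∂P = ((∫ ω, r ω ∂P : ℝ) : ℂ) * c := by
  rw [integral_mul_const, integral_complex_ofReal]

variable {β : Type*} (s : SimpleFunc ℝ β)

theorem measurableSet_fiber (y : s.range) : MeasurableSet (s ⁻¹' {y.1}) :=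
  s.measurableSet_preimage _

theorem pairwise_disjoint_fiber :
    Pairwise fun y y' : s.range => Disjoint (s ⁻¹' {y.1}) (s ⁻¹' {y'.1}) := by
  refine fun y y' hyy' => Set.disjoint_left.2 fun x hx hx' => hyy' (Subtype.ext ?_)
  exact (show s x = y.1 from hx).symm.trans hx'

theorem integrable_real_mul_mul (hξ : IsPoissonProcess P ξ Λ) (hm : Measurable ξ) {A B C : Set ℝ}
    (hA : MeasurableSet A) (hB : MeasurableSet B) (hC : MeasurableSet C) :
    Integrable (fun ω => (ξ ω).real A * (ξ ω).real B * (ξ ω).real C) P := by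
  refine (hξ.integrable_real_pow hm .univ (measure_ne_top _ _) 3).mono'
    (((measurable_real hm hA).mul (measurable_real hm hB)).mul
      (measurable_real hm hC)).aestronglyMeasurable ?_
  filter_upwards [hξ.ae_isFiniteMeasure hm] with ω hω
  rw [Real.norm_of_nonneg (by positivity)]
  calc _ ≤ (ξ ω).real Set.univ * (ξ ω).real Set.univ * (ξ ω).real Set.univ := by
        gcongr <;> first | exact measure_ne_top _ _ | exact Set.subset_univ _
    _ = _ := by ring

theorem integrable_real_mul (hξ : IsPoissonProcess P ξ Λ) (hm : Measurable ξ) {A B : Set ℝ}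
    (hA : MeasurableSet A) (hB : MeasurableSet B) :
    Integrable (fun ω => (ξ ω).real A * (ξ ω).real B) P := by
  refine (hξ.integrable_real_pow hm .univ (measure_ne_top _ _) 2).mono'
    ((measurable_real hm hA).mul (measurable_real hm hB)).aestronglyMeasurable ?_
  filter_upwards [hξ.ae_isFiniteMeasure hm] with ω hω
  rw [Real.norm_of_nonneg (by positivity)]
  calc _ ≤ (ξ ω).real Set.univ * (ξ ω).real Set.univ := by
        gcongr <;> first | exact measure_ne_top _ _ | exact Set.subset_univ _
    _ = _ := by ring

theorem integral_simpleFunc (hξ : IsPoissonProcess P ξ Λ) (hm : Measurable ξ) (F : β → ℂ) :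
    ∫ ω, (∫ x, F (s x) ∂(ξ ω)) ∂P = ∫ x, F (s x) ∂Λ := by
  rw [integral_comp_simpleFunc Λ]
  have h1 : ∫ ω, (∫ x, F (s x) ∂(ξ ω)) ∂P =
      ∫ ω, ∑ y : s.range, (((ξ ω).real (s ⁻¹' {y.1}) : ℝ) : ℂ) * F y ∂P := by
    refine integral_congr_ae ?_
    filter_upwards [hξ.ae_isFiniteMeasure hm] with ω hω
    rw [integral_comp_simpleFunc (ξ ω)]
    simp
  have hi : ∀ y : s.range, Integrable (fun ω => (ξ ω).real (s ⁻¹' {y.1})) P := fun y => by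
    simpa using hξ.integrable_real_pow hm (measurableSet_fiber s y) (measure_ne_top _ _) 1
  rw [h1, integral_finsetSum _ fun y _ => integrable_ofReal_mul_const (hi y) _]
  refine Finset.sum_congr rfl fun y _ => ?_
  rw [integral_ofReal_mul_const, hξ.integral_real hm (measurableSet_fiber s y) (measure_ne_top _ _)]
  simp

theorem integral_simpleFunc_mul (hξ : IsPoissonProcess P ξ Λ) (hm : Measurable ξ)
    (F G : β → ℂ) :
    ∫ ω, (∫ x, F (s x) ∂(ξ ω)) * (∫ x, G (s x) ∂(ξ ω)) ∂P =
      (∫ x, F (s x) ∂Λ) * (∫ x, G (s x) ∂Λ) + ∫ x, F (s x) * G (s x) ∂Λ := by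
  classical
  rw [integral_comp_simpleFunc Λ s F, integral_comp_simpleFunc Λ s G,
    integral_comp_simpleFunc Λ s (fun y => F y * G y)]
  have h1 : ∫ ω, (∫ x, F (s x) ∂(ξ ω)) * (∫ x, G (s x) ∂(ξ ω)) ∂P =
      ∫ ω, ∑ y : s.range, ∑ y' : s.range,
        (((ξ ω).real (s ⁻¹' {y.1}) * (ξ ω).real (s ⁻¹' {y'.1}) : ℝ) : ℂ) * (F y * G y') ∂P := by
    refine integral_congr_ae ?_
    filter_upwards [hξ.ae_isFiniteMeasure hm] with ω hω
    rw [integral_comp_simpleFunc (ξ ω), integral_comp_simpleFunc (ξ ω), Finset.sum_mul_sum]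
    refine Finset.sum_congr rfl fun y _ => Finset.sum_congr rfl fun y' _ => ?_
    simp only [Complex.real_smul]
    push_cast
    ring
  have hi := fun y y' : s.range => integrable_ofReal_mul_const
    (hξ.integrable_real_mul hm (measurableSet_fiber s y) (measurableSet_fiber s y')) (F y * G y')
  rw [h1, integral_finsetSum _ fun y _ => integrable_finsetSum _ fun y' _ => hi y y']
  simp only [Complex.real_smul, Finset.sum_mul_sum]
  rw [← Finset.sum_add_distrib]
  refine Finset.sum_congr rfl fun y _ => ?_
  rw [integral_finsetSum _ fun y' _ => hi y y']
  have h3 : ((Λ.real (s ⁻¹' {y.1}) : ℝ) : ℂ) * (F y * G y) =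
      ∑ y' : s.range, if y = y' then ((Λ.real (s ⁻¹' {y.1}) : ℝ) : ℂ) * (F y * G y') else 0 := by
    simp
  rw [h3, ← Finset.sum_add_distrib]
  refine Finset.sum_congr rfl fun y' _ => ?_
  rw [integral_ofReal_mul_const, hξ.integral_real_mul hm (measurableSet_fiber s) (pairwise_disjoint_fiber s)]
  split_ifs <;> push_cast <;> ring

/-- Each coincidence condition collapses the triple sum to a product of single sums, one for each
block of the corresponding partition. -/
theorem sum_sum_sum_coincidence {ι : Type*} [Fintype ι] [DecidableEq ι] (l F G H : ι → ℂ) :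
    ∑ i, ∑ j, ∑ k, ((l i * F i) * (l j * G j) * (l k * H k) +
      (if i = j then (l i * (F i * G j)) * (l k * H k) else 0) +
      (if i = k then (l i * (F i * H k)) * (l j * G j) else 0) +
      (if j = k then (l j * (G j * H k)) * (l i * F i) else 0) +
      (if i = j then if j = k then l i * (F i * G j * H k) else 0 else 0)) =
    (∑ i, l i * F i) * (∑ i, l i * G i) * (∑ i, l i * H i) +
      (∑ i, l i * (F i * G i)) * (∑ i, l i * H i) + (∑ i, l i * (F i * H i)) * (∑ i, l i * G i) +
      (∑ i, l i * (G i * H i)) * (∑ i, l i * F i) + ∑ i, l i * (F i * G i * H i) := by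
  simp only [Finset.sum_add_distrib, Finset.sum_ite_eq, Finset.mem_univ, if_true,
    Finset.sum_ite_irrel, Finset.sum_const_zero]
  congr 1
  congr 1
  · congr 1
    · congr 1
      · rw [Finset.sum_mul_sum, Finset.sum_mul]
        refine Finset.sum_congr rfl fun i _ => ?_
        rw [Finset.sum_mul_sum]
      · rw [Finset.sum_mul_sum]
    · rw [Finset.sum_mul_sum]
  · rw [Finset.sum_mul_sum, Finset.sum_comm]

theorem integral_ofReal_count_mul (hξ : IsPoissonProcess P ξ Λ) (hm : Measurable ξ)
    [DecidableEq s.range] (F G H : β → ℂ) (y y' y'' : s.range) :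
    ∫ ω, (((ξ ω).real (s ⁻¹' {y.1}) * (ξ ω).real (s ⁻¹' {y'.1}) *
        (ξ ω).real (s ⁻¹' {y''.1}) : ℝ) : ℂ) * (F y * G y' * H y'') ∂P =
      ((Λ.real (s ⁻¹' {y.1}) : ℂ) * F y) * ((Λ.real (s ⁻¹' {y'.1}) : ℂ) * G y') *
        ((Λ.real (s ⁻¹' {y''.1}) : ℂ) * H y'') +
      (if y = y' then ((Λ.real (s ⁻¹' {y.1}) : ℂ) * (F y * G y')) *
        ((Λ.real (s ⁻¹' {y''.1}) : ℂ) * H y'') else 0) +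
      (if y = y'' then ((Λ.real (s ⁻¹' {y.1}) : ℂ) * (F y * H y'')) *
        ((Λ.real (s ⁻¹' {y'.1}) : ℂ) * G y') else 0) +
      (if y' = y'' then ((Λ.real (s ⁻¹' {y'.1}) : ℂ) * (G y' * H y'')) *
        ((Λ.real (s ⁻¹' {y.1}) : ℂ) * F y) else 0) +
      (if y = y' then if y' = y'' then
        (Λ.real (s ⁻¹' {y.1}) : ℂ) * (F y * G y' * H y'') else 0 else 0) := by
  rw [integral_ofReal_mul_const,
    hξ.integral_real_mul_mul hm (measurableSet_fiber s) (pairwise_disjoint_fiber s)]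
  split_ifs <;> push_cast <;> ring

theorem integral_simpleFunc_mul_mul (hξ : IsPoissonProcess P ξ Λ) (hm : Measurable ξ)
    (F G H : β → ℂ) :
    ∫ ω, (∫ x, F (s x) ∂(ξ ω)) * (∫ x, G (s x) ∂(ξ ω)) * (∫ x, H (s x) ∂(ξ ω)) ∂P =
      (∫ x, F (s x) ∂Λ) * (∫ x, G (s x) ∂Λ) * (∫ x, H (s x) ∂Λ) +
      (∫ x, F (s x) * G (s x) ∂Λ) * (∫ x, H (s x) ∂Λ) +
      (∫ x, F (s x) * H (s x) ∂Λ) * (∫ x, G (s x) ∂Λ) +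
      (∫ x, G (s x) * H (s x) ∂Λ) * (∫ x, F (s x) ∂Λ) +
      ∫ x, F (s x) * G (s x) * H (s x) ∂Λ := by
  classical
  rw [integral_comp_simpleFunc Λ s F, integral_comp_simpleFunc Λ s G,
    integral_comp_simpleFunc Λ s H,
    integral_comp_simpleFunc Λ s (fun y => F y * G y),
    integral_comp_simpleFunc Λ s (fun y => F y * H y),
    integral_comp_simpleFunc Λ s (fun y => G y * H y),
    integral_comp_simpleFunc Λ s (fun y => F y * G y * H y)]
  simp only [Complex.real_smul]
  have h1 : ∫ ω, (∫ x, F (s x) ∂(ξ ω)) * (∫ x, G (s x) ∂(ξ ω)) * (∫ x, H (s x) ∂(ξ ω)) ∂P =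
      ∫ ω, ∑ y : s.range, ∑ y' : s.range, ∑ y'' : s.range,
        (((ξ ω).real (s ⁻¹' {y.1}) * (ξ ω).real (s ⁻¹' {y'.1}) *
          (ξ ω).real (s ⁻¹' {y''.1}) : ℝ) : ℂ) * (F y * G y' * H y'') ∂P := by
    refine integral_congr_ae ?_
    filter_upwards [hξ.ae_isFiniteMeasure hm] with ω hω
    rw [integral_comp_simpleFunc (ξ ω), integral_comp_simpleFunc (ξ ω),
      integral_comp_simpleFunc (ξ ω), Finset.sum_mul_sum, Finset.sum_mul]
    refine Finset.sum_congr rfl fun y _ => ?_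
    rw [Finset.sum_mul_sum]
    refine Finset.sum_congr rfl fun y' _ => Finset.sum_congr rfl fun y'' _ => ?_
    simp only [Complex.real_smul]
    push_cast
    ring
  have hi := fun y y' y'' : s.range =>
    integrable_ofReal_mul_const (hξ.integrable_real_mul_mul hm (measurableSet_fiber s y)
      (measurableSet_fiber s y') (measurableSet_fiber s y'')) (F y * G y' * H y'')
  rw [h1, ← sum_sum_sum_coincidence (fun y : s.range => (Λ.real (s ⁻¹' {y.1}) : ℂ))
    (fun y => F y) (fun y => G y) (fun y => H y), integral_finsetSum _ fun y _ =>
      integrable_finsetSum _ fun y' _ => integrable_finsetSum _ fun y'' _ => hi y y' y'']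
  refine Finset.sum_congr rfl fun y _ => ?_
  rw [integral_finsetSum _ fun y' _ => integrable_finsetSum _ fun y'' _ => hi y y' y'']
  refine Finset.sum_congr rfl fun y' _ => ?_
  rw [integral_finsetSum _ fun y'' _ => hi y y' y'']
  exact Finset.sum_congr rfl fun y'' _ => hξ.integral_ofReal_count_mul s hm F G H y y' y''

end SimpleFunctions

section BoundedFunctions

theorem tendsto_integral_approxBounded (μ : Measure ℝ) [IsFiniteMeasure μ] {f : ℝ → ℂ}
    {f' : ℕ → ℝ → ℂ} (hf' : ∀ n, Measurable (f' n)) {c : ℝ} (hb : ∀ n x, ‖f' n x‖ ≤ c)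
    (ht : ∀ x, Tendsto (fun n => f' n x) atTop (𝓝 (f x))) :
    Tendsto (fun n => ∫ x, f' n x ∂μ) atTop (𝓝 (∫ x, f x ∂μ)) :=
  tendsto_integral_of_dominated_convergence (fun _ => c)
    (fun n => (hf' n).aestronglyMeasurable) (integrable_const _)
    (fun n => ae_of_all _ (hb n)) (ae_of_all _ ht)

theorem exists_simpleFunc_approx {f : ℝ → ℂ} (hf : Measurable f) (hb : ∀ x, ‖f x‖ ≤ 1) :
    ∃ s : ℕ → SimpleFunc ℝ ℂ, (∀ n x, ‖s n x‖ ≤ 1) ∧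
      ∀ x, Tendsto (fun n => s n x) atTop (𝓝 (f x)) :=
  ⟨hf.stronglyMeasurable.approxBounded 1,
    fun n x => hf.stronglyMeasurable.norm_approxBounded_le zero_le_one n x,
    fun x => hf.stronglyMeasurable.tendsto_approxBounded_of_norm_le (hb x)⟩

theorem ae_integrable_of_bounded (hξ : IsPoissonProcess P ξ Λ) (hm : Measurable ξ) {f : ℝ → ℂ}
    (hf : Measurable f) (hb : ∀ x, ‖f x‖ ≤ 1) : ∀ᵐ ω ∂P, Integrable f (ξ ω) := by
  filter_upwards [hξ.ae_isFiniteMeasure hm] with ω hω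
  exact .of_bound hf.aestronglyMeasurable 1 (ae_of_all _ hb)

theorem aestronglyMeasurable_integral_of_bounded (hξ : IsPoissonProcess P ξ Λ) (hm : Measurable ξ)
    {f : ℝ → ℂ} (hf : Measurable f) (hb : ∀ x, ‖f x‖ ≤ 1) :
    AEStronglyMeasurable (fun ω => ∫ x, f x ∂(ξ ω)) P :=
  aestronglyMeasurable_integral_complex hm hf (hξ.ae_integrable_of_bounded hm hf hb)

variable {f g h : ℝ → ℂ}

theorem integral_integral (hξ : IsPoissonProcess P ξ Λ) (hm : Measurable ξ)
    (hf : Measurable f) (hfb : ∀ x, ‖f x‖ ≤ 1) :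
    ∫ ω, (∫ x, f x ∂(ξ ω)) ∂P = ∫ x, f x ∂Λ := by
  obtain ⟨s, hsb, hst⟩ := exists_simpleFunc_approx hf hfb
  have hR := tendsto_integral_approxBounded Λ (fun n => (s n).measurable) hsb hst
  refine tendsto_nhds_unique (tendsto_integral_of_dominated_convergence
    (fun ω => (ξ ω).real Set.univ) (fun n => hξ.aestronglyMeasurable_integral_of_bounded hm
      (s n).measurable (hsb n)) ?_ (fun n => ?_) ?_)
    (hR.congr fun n => (hξ.integral_simpleFunc (s n) hm fun y => y).symm)
  · simpa using hξ.integrable_real_pow hm .univ (measure_ne_top _ _) 1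
  · filter_upwards [hξ.ae_isFiniteMeasure hm] with ω hω
    simpa using norm_integral_le_mul_real (ξ ω) (hsb n)
  · filter_upwards [hξ.ae_isFiniteMeasure hm] with ω hω
    exact tendsto_integral_approxBounded (ξ ω) (fun n => (s n).measurable) hsb hst

theorem norm_mul_le_one {a b : ℂ} (ha : ‖a‖ ≤ 1) (hb : ‖b‖ ≤ 1) : ‖a * b‖ ≤ 1 := by
  rw [norm_mul]
  exact mul_le_one₀ ha (norm_nonneg _) hb

theorem integral_integral_mul (hξ : IsPoissonProcess P ξ Λ) (hm : Measurable ξ)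
    (hf : Measurable f) (hfb : ∀ x, ‖f x‖ ≤ 1) (hg : Measurable g) (hgb : ∀ x, ‖g x‖ ≤ 1) :
    ∫ ω, (∫ x, f x ∂(ξ ω)) * (∫ x, g x ∂(ξ ω)) ∂P =
      (∫ x, f x ∂Λ) * (∫ x, g x ∂Λ) + ∫ x, f x * g x ∂Λ := by
  obtain ⟨s, hsb, hst⟩ := exists_simpleFunc_approx hf hfb
  obtain ⟨t, htb, htt⟩ := exists_simpleFunc_approx hg hgb
  have T : ∀ (μ : Measure ℝ) [IsFiniteMeasure μ],
      Tendsto (fun n => (∫ x, s n x ∂μ) * (∫ x, t n x ∂μ)) atTop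
        (𝓝 ((∫ x, f x ∂μ) * (∫ x, g x ∂μ))) := fun μ _ =>
    (tendsto_integral_approxBounded μ (fun n => (s n).measurable) hsb hst).mul
      (tendsto_integral_approxBounded μ (fun n => (t n).measurable) htb htt)
  have hR := (T Λ).add (tendsto_integral_approxBounded Λ
    (fun n => (s n).measurable.mul (t n).measurable)
    (fun n x => norm_mul_le_one (hsb n x) (htb n x)) fun x => (hst x).mul (htt x))
  refine tendsto_nhds_unique (tendsto_integral_of_dominated_convergence
    (fun ω => (ξ ω).real Set.univ ^ 2) (fun n =>
      (hξ.aestronglyMeasurable_integral_of_bounded hm (s n).measurable (hsb n)).mul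
      (hξ.aestronglyMeasurable_integral_of_bounded hm (t n).measurable (htb n)))
      (hξ.integrable_real_pow hm .univ (measure_ne_top _ _) 2) (fun n => ?_) ?_)
    (hR.congr fun n => (hξ.integral_simpleFunc_mul ((s n).pair (t n)) hm
      (fun y => y.1) (fun y => y.2)).symm)
  · filter_upwards [hξ.ae_isFiniteMeasure hm] with ω hω
    rw [Pi.mul_apply, norm_mul, sq]
    gcongr
    · simpa using norm_integral_le_mul_real (ξ ω) (hsb n)
    · simpa using norm_integral_le_mul_real (ξ ω) (htb n)
  · filter_upwards [hξ.ae_isFiniteMeasure hm] with ω hω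
    exact T (ξ ω)

/-- Simple approximations of the three integrands are paired into one simple function, so that they
share a partition. As the integrands are bounded by one, `ξ(ℝ)³` dominates the products. -/
theorem integral_integral_mul_mul (hξ : IsPoissonProcess P ξ Λ) (hm : Measurable ξ)
    (hf : Measurable f) (hfb : ∀ x, ‖f x‖ ≤ 1) (hg : Measurable g) (hgb : ∀ x, ‖g x‖ ≤ 1)
    (hh : Measurable h) (hhb : ∀ x, ‖h x‖ ≤ 1) :
    ∫ ω, (∫ x, f x ∂(ξ ω)) * (∫ x, g x ∂(ξ ω)) * (∫ x, h x ∂(ξ ω)) ∂P =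
      (∫ x, f x ∂Λ) * (∫ x, g x ∂Λ) * (∫ x, h x ∂Λ) +
      (∫ x, f x * g x ∂Λ) * (∫ x, h x ∂Λ) + (∫ x, f x * h x ∂Λ) * (∫ x, g x ∂Λ) +
      (∫ x, g x * h x ∂Λ) * (∫ x, f x ∂Λ) + ∫ x, f x * g x * h x ∂Λ := by
  obtain ⟨s, hsb, hst⟩ := exists_simpleFunc_approx hf hfb
  obtain ⟨t, htb, htt⟩ := exists_simpleFunc_approx hg hgb
  obtain ⟨u, hub, hut⟩ := exists_simpleFunc_approx hh hhb
  have T : ∀ (μ : Measure ℝ) [IsFiniteMeasure μ],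
      Tendsto (fun n => (∫ x, s n x ∂μ) * (∫ x, t n x ∂μ) * (∫ x, u n x ∂μ)) atTop
        (𝓝 ((∫ x, f x ∂μ) * (∫ x, g x ∂μ) * (∫ x, h x ∂μ))) := fun μ _ =>
    ((tendsto_integral_approxBounded μ (fun n => (s n).measurable) hsb hst).mul
      (tendsto_integral_approxBounded μ (fun n => (t n).measurable) htb htt)).mul
      (tendsto_integral_approxBounded μ (fun n => (u n).measurable) hub hut)
  have hs := tendsto_integral_approxBounded Λ (fun n => (s n).measurable) hsb hst
  have ht := tendsto_integral_approxBounded Λ (fun n => (t n).measurable) htb htt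
  have hu := tendsto_integral_approxBounded Λ (fun n => (u n).measurable) hub hut
  have hst' := tendsto_integral_approxBounded Λ
    (fun n => (s n).measurable.mul (t n).measurable)
    (fun n x => norm_mul_le_one (hsb n x) (htb n x)) fun x => (hst x).mul (htt x)
  have hsu := tendsto_integral_approxBounded Λ
    (fun n => (s n).measurable.mul (u n).measurable)
    (fun n x => norm_mul_le_one (hsb n x) (hub n x)) fun x => (hst x).mul (hut x)
  have htu := tendsto_integral_approxBounded Λ
    (fun n => (t n).measurable.mul (u n).measurable)
    (fun n x => norm_mul_le_one (htb n x) (hub n x)) fun x => (htt x).mul (hut x)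
  have hstu := tendsto_integral_approxBounded Λ
    (fun n => ((s n).measurable.mul (t n).measurable).mul (u n).measurable)
    (fun n x => norm_mul_le_one (norm_mul_le_one (hsb n x) (htb n x)) (hub n x))
    fun x => ((hst x).mul (htt x)).mul (hut x)
  have hR := ((((T Λ).add (hst'.mul hu)).add (hsu.mul ht)).add (htu.mul hs)).add hstu
  refine tendsto_nhds_unique (tendsto_integral_of_dominated_convergence
    (fun ω => (ξ ω).real Set.univ ^ 3) (fun n =>
      ((hξ.aestronglyMeasurable_integral_of_bounded hm (s n).measurable (hsb n)).mul
      (hξ.aestronglyMeasurable_integral_of_bounded hm (t n).measurable (htb n))).mul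
      (hξ.aestronglyMeasurable_integral_of_bounded hm (u n).measurable (hub n)))
      (hξ.integrable_real_pow hm .univ (measure_ne_top _ _) 3) (fun n => ?_) ?_)
    (hR.congr fun n => (hξ.integral_simpleFunc_mul_mul ((s n).pair ((t n).pair (u n))) hm
      (fun y => y.1) (fun y => y.2.1) (fun y => y.2.2)).symm)
  · filter_upwards [hξ.ae_isFiniteMeasure hm] with ω hω
    rw [Pi.mul_apply, Pi.mul_apply, norm_mul, norm_mul, pow_succ, sq]
    gcongr
    · simpa using norm_integral_le_mul_real (ξ ω) (hsb n)
    · simpa using norm_integral_le_mul_real (ξ ω) (htb n)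
    · simpa using norm_integral_le_mul_real (ξ ω) (hub n)
  · filter_upwards [hξ.ae_isFiniteMeasure hm] with ω hω
    exact T (ξ ω)

end BoundedFunctions
end IsPoissonProcess

/-! ### Family trees: measurability, branching property, generation sizes. -/

/-- The number of terms is part of the argument, but it takes countably many values, so it can be
held fixed. -/
theorem measurable_sum_range {α M : Type*} [MeasurableSpace α] [MeasurableSpace M]
    [AddCommMonoid M] [MeasurableAdd₂ M] {f : ℕ → α → M} (hf : ∀ i, Measurable (f i)) :
    Measurable fun p : ℕ × α => ∑ i ∈ Finset.range p.1, f i p.2 :=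
  measurable_from_prod_countable_right fun k =>
    Finset.measurable_fun_sum (Finset.range k) fun i _ => hf i

theorem measurable_prod_range {α M : Type*} [MeasurableSpace α] [MeasurableSpace M]
    [CommMonoid M] [MeasurableMul₂ M] {f : ℕ → α → M} (hf : ∀ i, Measurable (f i)) :
    Measurable fun p : ℕ × α => ∏ i ∈ Finset.range p.1, f i p.2 :=
  measurable_from_prod_countable_right fun k =>
    Finset.measurable_fun_prod (Finset.range k) fun i _ => hf i

/-- Family trees: the offspring of every potential individual. -/
abbrev FamilyTree := List ℕ → Offspring

/-- The family tree of the child number `i` of the root. -/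
def child (z : FamilyTree) (i : ℕ) : FamilyTree := fun v => z (i :: v)

theorem measurable_child (i : ℕ) : Measurable fun z : FamilyTree => child z i :=
  measurable_pi_lambda _ fun _ => measurable_pi_apply _

theorem measurableSet_alive (v : List ℕ) : MeasurableSet {z : FamilyTree | Alive z v} := by
  induction v with
  | nil => simp [Alive]
  | cons i w ih =>
    have h1 : Measurable fun z : FamilyTree => (z []).1 := (measurable_pi_apply []).fst
    exact (measurableSet_lt measurable_const h1).inter (measurable_child i ih)

theorem measurable_position (v : List ℕ) : Measurable fun z : FamilyTree => position z v := by
  induction v with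
  | nil => exact measurable_const
  | cons i w ih =>
    have h1 : Measurable fun z : FamilyTree => (z []).2 i :=
      (measurable_pi_apply i).comp (measurable_pi_apply []).snd
    exact h1.add (ih.comp (measurable_child i))

open Classical in
/-- The rooted branching cluster as an s-finite kernel. -/
noncomputable def clusterKernel : Kernel FamilyTree ℝ :=
  Kernel.sum fun v : List ℕ => Kernel.piecewise (measurableSet_alive v)
    (Kernel.deterministic (fun z => position z v) (measurable_position v)) 0

noncomputable instance : IsSFiniteKernel clusterKernel := by
  unfold clusterKernel
  infer_instance

open Classical in
theorem cluster_apply (z : FamilyTree) {A : Set ℝ} (hA : MeasurableSet A) :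
    cluster z A = ∑' v : List ℕ, if Alive z v then Measure.dirac (position z v) A else 0 := by
  rw [cluster, Measure.sum_apply _ hA]
  exact tsum_subtype {v | Alive z v} fun v => Measure.dirac (position z v) A

theorem clusterKernel_apply (z : FamilyTree) : clusterKernel z = cluster z := by
  classical
  ext A hA
  rw [cluster_apply z hA, clusterKernel, Kernel.sum_apply' _ _ hA]
  refine tsum_congr fun v => ?_
  rw [Kernel.piecewise_apply']
  simp only [Set.mem_ofPred_eq, Kernel.deterministic_apply, _root_.zero_apply, Measure.coe_zero,
    Pi.zero_apply]

theorem measurable_cluster : Measurable cluster := by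
  have : cluster = fun z => clusterKernel z := funext fun z => (clusterKernel_apply z).symm
  rw [this]
  exact clusterKernel.measurable

/-- A word is empty or has a first letter; on labels this is the decomposition of a tree into its
root and the subtrees of the children. -/
theorem tsum_list {α : Type*} (f : List α → ℝ≥0∞) :
    ∑' v, f v = f [] + ∑' i, ∑' w, f (i :: w) := by
  classical
  rw [ENNReal.tsum_eq_add_tsum_ite [], ← ENNReal.tsum_prod]
  congr 1
  have hinj : Function.Injective fun p : α × List α => p.1 :: p.2 := by
    rintro ⟨a, v⟩ ⟨b, w⟩ h
    simpa using h
  rw [← hinj.tsum_eq]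
  · simp
  · intro v hv
    cases v with
    | nil => simp at hv
    | cons a w => exact ⟨(a, w), rfl⟩

theorem tsum_ite_lt (n : ℕ) (f : ℕ → ℝ≥0∞) :
    ∑' i, (if i < n then f i else 0) = ∑ i ∈ Finset.range n, f i := by
  rw [tsum_eq_sum (s := Finset.range n)]
  · exact Finset.sum_congr rfl fun i hi => if_pos (Finset.mem_range.1 hi)
  · intro i hi
    exact if_neg fun h => hi (Finset.mem_range.2 h)

/-- The branching property: the cluster consists of the root and of the translated clusters of its
children. -/
theorem cluster_eq (z : FamilyTree) :
    cluster z = Measure.dirac 0 +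
      ∑ i ∈ Finset.range (z []).1, (cluster (child z i)).map (fun x => (z []).2 i + x) := by
  classical
  ext A hA
  rw [cluster_apply z hA, tsum_list, Measure.add_apply, Measure.finsetSum_apply]
  congr 1
  · simp [Alive, position]
  · rw [← tsum_ite_lt]
    refine tsum_congr fun i => ?_
    split_ifs with hi
    · have hmeas : Measurable fun x : ℝ => (z []).2 i + x := measurable_const_add _
      rw [Measure.map_apply hmeas hA, cluster_apply _ (hmeas hA)]
      refine tsum_congr fun w => ?_
      have hiff : Alive z (i :: w) ↔ Alive (child z i) w := and_iff_right hi
      rw [if_congr hiff rfl rfl, Measure.dirac_apply' _ hA, Measure.dirac_apply' _ (hmeas hA)]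
      rfl
    · refine ENNReal.tsum_eq_zero.2 fun w => if_neg fun h => hi h.1

/-- The number of individuals in the generations up to `n`. -/
def genCount : ℕ → FamilyTree → ℕ
  | 0, _ => 1
  | n + 1, z => 1 + ∑ i ∈ Finset.range (z []).1, genCount n (child z i)

-- Identifies the recursive quantity `genCount` with an actual count of labels, which makes
-- monotonicity in `n` and the passage to the whole cluster immediate.
open Classical in
theorem tsum_alive_length_le (n : ℕ) (z : FamilyTree) :
    ∑' v : List ℕ, (if Alive z v ∧ v.length ≤ n then (1 : ℝ≥0∞) else 0) = genCount n z := by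
  induction n generalizing z with
  | zero =>
    rw [tsum_eq_single []]
    · simp [Alive, genCount]
    · intro v hv
      exact if_neg fun h => hv (List.length_eq_zero_iff.1 (Nat.le_zero.1 h.2))
  | succ n ih =>
    rw [tsum_list, genCount]
    push_cast
    congr 1
    · simp [Alive]
    · rw [← tsum_ite_lt]
      refine tsum_congr fun i => ?_
      split_ifs with hi
      · rw [← ih (child z i)]
        refine tsum_congr fun w => ?_
        have hiff : (Alive z (i :: w) ∧ (i :: w).length ≤ n + 1) ↔
            (Alive (child z i) w ∧ w.length ≤ n) :=
          and_congr (and_iff_right hi) (by simp)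
        rw [if_congr hiff rfl rfl]
      · exact ENNReal.tsum_eq_zero.2 fun w => if_neg fun h => hi h.1.1

theorem monotone_genCount (z : FamilyTree) : Monotone fun n => genCount n z := by
  classical
  intro a b hab
  have : (genCount a z : ℝ≥0∞) ≤ genCount b z := by
    rw [← tsum_alive_length_le, ← tsum_alive_length_le]
    refine ENNReal.tsum_le_tsum fun v => ?_
    split_ifs with h1 h2
    · exact le_rfl
    · exact absurd ⟨h1.1, h1.2.trans hab⟩ h2
    · exact zero_le
    · exact le_rfl
  exact_mod_cast this

/-- A sum of nonnegative terms is the supremum of its finite partial sums, and finitely many words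
have bounded length. -/
theorem cluster_univ_eq_iSup (z : FamilyTree) :
    cluster z Set.univ = ⨆ n, (genCount n z : ℝ≥0∞) := by
  classical
  rw [cluster_apply z .univ]
  simp only [measure_univ]
  apply le_antisymm
  · rw [ENNReal.tsum_eq_iSup_sum]
    refine iSup_le fun S => ?_
    obtain ⟨n, hn⟩ : ∃ n, ∀ v ∈ S, v.length ≤ n :=
      ⟨S.sup List.length, fun v hv => Finset.le_sup (f := List.length) hv⟩
    refine le_trans ?_ (le_iSup _ n)
    rw [← tsum_alive_length_le]
    refine le_trans (Finset.sum_le_sum fun v hv => ?_) (ENNReal.sum_le_tsum S)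
    rw [if_congr (and_iff_left (hn v hv)) rfl rfl]
  · refine iSup_le fun n => ?_
    rw [← tsum_alive_length_le]
    refine ENNReal.tsum_le_tsum fun v => ?_
    split_ifs with h1 h2
    · exact le_rfl
    · exact absurd h1.1 h2
    · exact zero_le
    · exact le_rfl

theorem measurable_genCount (n : ℕ) : Measurable (genCount n) := by
  induction n with
  | zero => exact measurable_const
  | succ n ih =>
    have h1 : Measurable fun z : FamilyTree => (z []).1 := (measurable_pi_apply []).fst
    have h2 : Measurable fun p : ℕ × FamilyTree => ∑ i ∈ Finset.range p.1, genCount n (child p.2 i) :=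
      measurable_sum_range fun i => ih.comp (measurable_child i)
    exact measurable_const.add (h2.comp (h1.prodMk measurable_id))

theorem measurable_offspringMeasure : Measurable offspringMeasure := by
  refine Measure.measurable_of_measurable_coe _ fun A hA => ?_
  simp only [offspringMeasure, Measure.finsetSum_apply]
  have : Measurable fun p : ℕ × (ℕ → ℝ) => ∑ i ∈ Finset.range p.1, Measure.dirac (p.2 i) A :=
    measurable_sum_range (f := fun i (x : ℕ → ℝ) => Measure.dirac (x i) A) fun i =>
      (Measure.measurable_coe hA).comp (Measure.measurable_dirac.comp (measurable_pi_apply i))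
  exact this

theorem offspringMeasure_univ (o : Offspring) : offspringMeasure o Set.univ = o.1 := by
  simp [offspringMeasure]

/-- The number of children is the total mass of `offspringMeasure`, a Poisson variable; this is its
moment generating function at `log y`. -/
theorem lintegral_pow_numChildren {μ : Measure Offspring} {Λ : Measure ℝ} [IsFiniteMeasure Λ]
    (hμ : IsPoissonProcess μ offspringMeasure Λ) {y : ℝ}
    (hy : 0 < y) :
    ∫⁻ o : Offspring, ENNReal.ofReal y ^ o.1 ∂μ =
      ENNReal.ofReal (Real.exp (Λ.real Set.univ * (y - 1))) := by
  have h1 := hμ.integral_exp_mul_real measurable_offspringMeasure .univ (measure_ne_top _ _)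
    (Real.log y)
  have h2 := hμ.integrable_exp_mul_real measurable_offspringMeasure .univ (measure_ne_top _ _)
    (Real.log y)
  rw [Real.exp_log hy] at h1
  rw [← h1, ofReal_integral_eq_lintegral_ofReal h2 (ae_of_all _ fun _ => Real.exp_nonneg _)]
  refine lintegral_congr fun o => ?_
  rw [Measure.real, offspringMeasure_univ, ENNReal.toReal_natCast, mul_comm, Real.exp_nat_mul,
    Real.exp_log hy, ENNReal.ofReal_pow hy.le]

/-! ### The law of the tree and the exponential moment of the total progeny. -/

section Law

variable (μ : Measure Offspring) [IsProbabilityMeasure μ]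

/-- The law of a family tree with i.i.d. offspring of law `μ`. -/
noncomputable def treeLaw : Measure FamilyTree := Measure.infinitePi fun _ => μ

instance : IsProbabilityMeasure (treeLaw μ) := by
  unfold treeLaw
  infer_instance

/-- The law of an i.i.d. sequence of family trees. -/
noncomputable def forestLaw : Measure (ℕ → FamilyTree) := Measure.infinitePi fun _ => treeLaw μ

instance : IsProbabilityMeasure (forestLaw μ) := by
  unfold forestLaw
  infer_instance

/-- The root label and the labels `i :: v` are disjoint sets of coordinates, hence independent. The
map `(i, v) ↦ i :: v` is injective, so the second block is again i.i.d., and currying groups it into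
a sequence of trees. -/
theorem treeLaw_map : (treeLaw μ).map (fun z => (z [], child z)) = μ.prod (forestLaw μ) := by
  let c : ℕ × List ℕ → List ℕ := fun p => p.1 :: p.2
  have hinj : Function.Injective c := by
    rintro ⟨a, v⟩ ⟨b, w⟩ h
    simpa [c] using h
  have hm2 : Measurable fun (z : FamilyTree) (p : ℕ × List ℕ) => z (c p) :=
    measurable_pi_lambda _ fun _ => measurable_pi_apply _
  have hind : IndepFun (fun z : FamilyTree => z []) (fun z (p : ℕ × List ℕ) => z (c p))
      (treeLaw μ) := by
    have h := iIndepFun_infinitePi (P := fun _ : List ℕ => μ) (X := fun _ o => o)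
      (fun _ => measurable_id)
    have h2 := indep_iSup_of_disjoint (S := {[]}) (T := Set.range c)
      (fun v => (measurable_pi_apply v).comap_le) h
      (Set.disjoint_singleton_left.2 (by rintro ⟨p, hp⟩; simp [c] at hp))
    refine indep_of_indep_of_le_left (indep_of_indep_of_le_right h2 ?_) ?_
    · rw [MeasurableSpace.pi, MeasurableSpace.comap_iSup]
      refine iSup_le fun p => ?_
      rw [MeasurableSpace.comap_comp]
      exact le_iSup₂ (f := fun (v : List ℕ) (_ : v ∈ Set.range c) =>
        MeasurableSpace.comap (fun z : FamilyTree => z v) inferInstance) (c p) ⟨p, rfl⟩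
    · exact le_iSup₂ (f := fun (v : List ℕ) (_ : v ∈ ({[]} : Set (List ℕ))) =>
        MeasurableSpace.comap (fun z : FamilyTree => z v) inferInstance) [] rfl
  have h3 := hind.map_prod_eq_prod_map_map (measurable_pi_apply []).aemeasurable hm2.aemeasurable
  have h4 : (treeLaw μ).map (fun z : FamilyTree => z []) = μ := Measure.infinitePi_map_eval _ []
  have h5 : (treeLaw μ).map (fun z (p : ℕ × List ℕ) => z (c p)) =
      Measure.infinitePi fun _ => μ := Measure.map_infinitePi_infinitePi_of_inj hinj
  have h6 : forestLaw μ = (Measure.infinitePi fun _ : ℕ × List ℕ => μ).map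
      (MeasurableEquiv.curry ℕ (List ℕ) Offspring) :=
    (Measure.infinitePi_map_curry fun _ _ => μ).symm
  have h7 := congrArg (Measure.map (Prod.map id (MeasurableEquiv.curry ℕ (List ℕ) Offspring))) h3
  rw [h4, h5, Measure.map_map (by fun_prop) (by fun_prop), ← Measure.map_prod_map _ _ (by fun_prop)
    (by fun_prop), Measure.map_id, ← h6] at h7
  exact h7

variable {μ}

theorem measurable_root_child : Measurable fun z : FamilyTree => (z [], child z) :=
  (measurable_pi_apply []).prodMk (measurable_pi_lambda _ measurable_child)

theorem lintegral_forest_prod (F : Finset ℕ) {φ : ℕ → FamilyTree → ℝ≥0∞}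
    (hφ : ∀ i, Measurable (φ i)) :
    ∫⁻ w, ∏ i ∈ F, φ i (w i) ∂(forestLaw μ) = ∏ i ∈ F, ∫⁻ z, φ i z ∂(treeLaw μ) := by
  have hind : iIndepFun (fun i (w : ℕ → FamilyTree) => φ i (w i)) (forestLaw μ) :=
    iIndepFun_infinitePi (P := fun _ : ℕ => treeLaw μ) hφ
  rw [lintegral_prod_eq_prod_lintegral_of_indepFun F (fun i (w : ℕ → FamilyTree) => φ i (w i)) hind
    (fun i => (hφ i).comp (measurable_pi_apply i))]
  refine Finset.prod_congr rfl fun i _ => ?_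
  have h : (forestLaw μ).map (fun w => w i) = treeLaw μ := Measure.infinitePi_map_eval _ i
  rw [← lintegral_map (hφ i) (measurable_pi_apply i), h]

variable {Λ : Measure ℝ} [IsFiniteMeasure Λ]

/-- Conditioning on the root, the moment for `n + 1` generations is `r` times the generating
function of the number of children, evaluated at the moment for `n` generations. A supersolution `y`
of this fixed-point equation bounds all of them by induction. -/
theorem lintegral_pow_genCount_le (hμ : IsPoissonProcess μ offspringMeasure Λ) {r y : ℝ}
    (hr : 1 ≤ r) (hry : r * Real.exp (Λ.real Set.univ * (y - 1)) ≤ y) (hy : 1 ≤ y) (n : ℕ) :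
    ∫⁻ z, ENNReal.ofReal r ^ genCount n z ∂(treeLaw μ) ≤ ENNReal.ofReal y := by
  have hmeas : ∀ n, Measurable fun z => ENNReal.ofReal r ^ genCount n z := fun n =>
    (measurable_from_top (f := fun k : ℕ => ENNReal.ofReal r ^ k)).comp (measurable_genCount n)
  have hmeas' : ∀ n i, Measurable fun w : ℕ → FamilyTree => ENNReal.ofReal r ^ genCount n (w i) :=
    fun n i => (hmeas n).comp (measurable_pi_apply i)
  induction n with
  | zero =>
    simp only [genCount, pow_one, lintegral_const, measure_univ, mul_one]
    refine ENNReal.ofReal_le_ofReal (le_trans ?_ hry)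
    refine le_mul_of_one_le_right (by linarith) (Real.one_le_exp ?_)
    exact mul_nonneg measureReal_nonneg (by linarith)
  | succ n ih =>
    have hH : Measurable fun p : Offspring × (ℕ → FamilyTree) =>
        ENNReal.ofReal r * ∏ i ∈ Finset.range p.1.1, ENNReal.ofReal r ^ genCount n (p.2 i) := by
      have : Measurable fun p : ℕ × (ℕ → FamilyTree) =>
          ENNReal.ofReal r * ∏ i ∈ Finset.range p.1, ENNReal.ofReal r ^ genCount n (p.2 i) :=
        measurable_const.mul (measurable_prod_range fun i => hmeas' n i)
      exact this.comp (measurable_fst.fst.prodMk measurable_snd)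
    calc ∫⁻ z, ENNReal.ofReal r ^ genCount (n + 1) z ∂(treeLaw μ)
        = ∫⁻ p, ENNReal.ofReal r * ∏ i ∈ Finset.range p.1.1, ENNReal.ofReal r ^ genCount n (p.2 i)
            ∂(μ.prod (forestLaw μ)) := by
          rw [← treeLaw_map, lintegral_map hH measurable_root_child]
          refine lintegral_congr fun z => ?_
          rw [genCount, pow_add, pow_one, Finset.prod_pow_eq_pow_sum]
      _ = ∫⁻ o, ∫⁻ w, ENNReal.ofReal r * ∏ i ∈ Finset.range o.1,
            ENNReal.ofReal r ^ genCount n (w i) ∂(forestLaw μ) ∂μ := by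
          rw [lintegral_prod _ hH.aemeasurable]
      _ ≤ ∫⁻ o : Offspring, ENNReal.ofReal r * ENNReal.ofReal y ^ o.1 ∂μ := by
          refine lintegral_mono fun o => ?_
          rw [lintegral_const_mul _ (Finset.measurable_fun_prod _ fun i _ =>
            hmeas' n i),
            lintegral_forest_prod (φ := fun _ z => ENNReal.ofReal r ^ genCount n z) _
              (fun _ => hmeas n), Finset.prod_const, Finset.card_range]
          gcongr
      _ ≤ ENNReal.ofReal y := by
          rw [lintegral_const_mul' _ _ ENNReal.ofReal_ne_top,
            lintegral_pow_numChildren hμ (by linarith), ← ENNReal.ofReal_mul (by linarith)]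
          exact ENNReal.ofReal_le_ofReal hry

/-- The total progeny of a subcritical Poisson branching tree has an exponential moment. -/
theorem exists_exp_moment_cluster (hμ : IsPoissonProcess μ offspringMeasure Λ)
    (hΛ0 : 0 < Λ.real Set.univ) (hΛ : Λ.real Set.univ < 1) :
    ∃ θ : ℝ, 0 < θ ∧ (∀ᵐ z ∂(treeLaw μ), IsFiniteMeasure (cluster z)) ∧
      Integrable (fun z => Real.exp (θ * (cluster z).real Set.univ)) (treeLaw μ) := by
  set m := Λ.real Set.univ with hm
  -- Any point strictly between `1` and `1 / m` works. The number `θ` below then makes `exp θ * exp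
  -- (m (y - 1)) = y`, and it is positive because `log y ≥ (y - 1) / y > m (y - 1)`.
  set y : ℝ := (1 + 1 / m) / 2 with hy
  have hm1 : 1 < 1 / m := by rw [lt_div_iff₀ hΛ0]; linarith
  have hy1 : 1 < y := by rw [hy]; linarith
  have hym : y < 1 / m := by rw [hy]; linarith
  set θ : ℝ := Real.log y - m * (y - 1) with hθ
  have hθ0 : 0 < θ := by
    have h1 := Real.one_sub_inv_le_log_of_pos (x := y) (by linarith)
    have h2 : m * (y - 1) < 1 - y⁻¹ := by
      have h3 : m * y < 1 := by rwa [lt_div_iff₀ hΛ0, mul_comm] at hym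
      have h4 : 1 - y⁻¹ = (y - 1) / y := by field_simp
      rw [h4, lt_div_iff₀ (by linarith)]
      nlinarith
    linarith
  have hr : 1 ≤ Real.exp θ := Real.one_le_exp hθ0.le
  have hry : Real.exp θ * Real.exp (m * (y - 1)) ≤ y := by
    rw [← Real.exp_add, hθ, sub_add_cancel, Real.exp_log (by linarith)]
  have hpow : ∀ k : ℕ, ENNReal.ofReal (Real.exp θ) ^ k = ENNReal.ofReal (Real.exp (θ * k)) := by
    intro k
    rw [← ENNReal.ofReal_pow (Real.exp_nonneg _), ← Real.exp_nat_mul, mul_comm]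
  have hmeas : ∀ n, Measurable fun z => ENNReal.ofReal (Real.exp θ) ^ genCount n z := fun n =>
    (measurable_from_top (f := fun k : ℕ => ENNReal.ofReal (Real.exp θ) ^ k)).comp
      (measurable_genCount n)
  have hsup : ∫⁻ z, ⨆ n, ENNReal.ofReal (Real.exp θ) ^ genCount n z ∂(treeLaw μ) ≤
      ENNReal.ofReal y := by
    rw [lintegral_iSup hmeas]
    · exact iSup_le fun n => lintegral_pow_genCount_le hμ hr hry hy1.le n
    · intro a b hab z
      exact pow_le_pow_right₀ (by simpa using hr) (monotone_genCount z hab)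
  have hfin : ∀ᵐ z ∂(treeLaw μ), IsFiniteMeasure (cluster z) := by
    filter_upwards [ae_lt_top (Measurable.iSup hmeas) (hsup.trans_lt ENNReal.ofReal_lt_top).ne]
      with z hz
    refine ⟨?_⟩
    -- From `θ k ≤ exp (θ k)`: a finite supremum of the exponentials forces a finite cluster.
    have hle : ENNReal.ofReal θ * cluster z Set.univ ≤
        ⨆ n, ENNReal.ofReal (Real.exp θ) ^ genCount n z := by
      rw [cluster_univ_eq_iSup, ENNReal.mul_iSup]
      refine iSup_mono fun n => ?_
      rw [hpow, ← ENNReal.ofReal_natCast, ← ENNReal.ofReal_mul hθ0.le]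
      exact ENNReal.ofReal_le_ofReal (by linarith [Real.add_one_le_exp (θ * genCount n z)])
    by_contra htop
    rw [not_lt, top_le_iff] at htop
    rw [htop, ENNReal.mul_top (by simpa using hθ0)] at hle
    exact absurd hz (not_lt.2 hle)
  refine ⟨θ, hθ0, hfin, ?_, ?_⟩
  · exact (Real.measurable_exp.comp (((Measure.measurable_coe .univ).comp
      measurable_cluster).ennreal_toReal.const_mul θ)).aestronglyMeasurable
  · rw [hasFiniteIntegral_iff_ofReal (ae_of_all _ fun _ => Real.exp_nonneg _)]
    refine lt_of_le_of_lt (lintegral_mono_ae ?_) (hsup.trans_lt ENNReal.ofReal_lt_top)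
    filter_upwards [hfin] with z hz
    have ht : Tendsto (fun n => (genCount n z : ℝ≥0∞)) atTop (𝓝 (cluster z Set.univ)) := by
      rw [cluster_univ_eq_iSup]
      exact tendsto_atTop_iSup fun a b hab => by exact_mod_cast monotone_genCount z hab
    have ht2 := (ENNReal.tendsto_toReal (measure_ne_top (cluster z) Set.univ)).comp ht
    have ht3 := ENNReal.tendsto_ofReal ((Real.continuous_exp.tendsto _).comp (ht2.const_mul θ))
    refine le_of_tendsto ht3 (Eventually.of_forall fun n => ?_)
    refine le_trans (le_of_eq ?_) (le_iSup _ n)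
    rw [hpow]
    simp

end Law

/-! ### Product moments of sums over an i.i.d. forest. -/

section Integrability

variable {α : Type*} [MeasurableSpace α] {ρ : Measure α}

/-- From `a b c ≤ a³ + b³ + c³` for nonnegative reals. -/
theorem integrable_mul_mul_of_memLp {X Y Z : α → ℂ} (hX : MemLp X 3 ρ) (hY : MemLp Y 3 ρ)
    (hZ : MemLp Z 3 ρ) : Integrable (fun a => X a * Y a * Z a) ρ := by
  have h3 : ∀ {X : α → ℂ}, MemLp X 3 ρ → Integrable (fun a => ‖X a‖ ^ 3) ρ := fun {X} hX =>
    MemLp.integrable_norm_pow (p := 3) (by exact_mod_cast hX) (by norm_num)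
  refine (((h3 hX).add (h3 hY)).add (h3 hZ)).mono' ((hX.1.mul hY.1).mul hZ.1)
    (ae_of_all _ fun a => ?_)
  simp only [norm_mul, Pi.add_apply]
  have key : ∀ a b c : ℝ, 0 ≤ a → 0 ≤ b → 0 ≤ c → a * b * c ≤ a ^ 3 + b ^ 3 + c ^ 3 := by
    intro a b c ha hb hc
    nlinarith [mul_nonneg ha (sq_nonneg (b - c)), mul_nonneg hb (sq_nonneg (a - c)),
      mul_nonneg hc (sq_nonneg (a - b)), pow_nonneg ha 3, pow_nonneg hb 3, pow_nonneg hc 3,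
      mul_nonneg (add_nonneg ha hb) (sq_nonneg (a - b)),
      mul_nonneg (add_nonneg ha hc) (sq_nonneg (a - c)),
      mul_nonneg (add_nonneg hb hc) (sq_nonneg (b - c)), mul_nonneg (mul_nonneg ha hb) hc]
  exact key _ _ _ (norm_nonneg _) (norm_nonneg _) (norm_nonneg _)

theorem integrable_mul_of_memLp [IsFiniteMeasure ρ] {X Y : α → ℂ} (hX : MemLp X 3 ρ)
    (hY : MemLp Y 3 ρ) : Integrable (fun a => X a * Y a) ρ := by
  simpa using integrable_mul_mul_of_memLp hX hY (memLp_const 1)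

theorem integrable_of_memLp [IsFiniteMeasure ρ] {X : α → ℂ} (hX : MemLp X 3 ρ) :
    Integrable X ρ := by
  simpa using integrable_mul_of_memLp hX (memLp_const 1)

end Integrability

theorem sum_mul_sum_coincidence {ι : Type*} [DecidableEq ι] (s : Finset ι) (F G : ι → ℂ)
    (a b : ℂ) :
    ∑ i ∈ s, ∑ j ∈ s, F i * G j * (a + if i = j then b else 0) =
      a * ((∑ i ∈ s, F i) * ∑ i ∈ s, G i) + b * ∑ i ∈ s, F i * G i := by
  simp only [mul_add, Finset.sum_add_distrib, mul_ite, mul_zero, Finset.sum_ite_eq]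
  congr 1
  · rw [Finset.sum_mul_sum, Finset.mul_sum]
    refine Finset.sum_congr rfl fun i _ => ?_
    rw [Finset.mul_sum]
    exact Finset.sum_congr rfl fun j _ => mul_comm _ _
  · rw [Finset.mul_sum]
    refine Finset.sum_congr rfl fun i hi => ?_
    rw [if_pos hi, mul_comm]

/-- The coefficients will be products of joint cumulants of one tree functional, one for each
partition of the three factors. -/
theorem sum_mul_sum_mul_sum_coincidence {ι : Type*} [DecidableEq ι] (s : Finset ι)
    (F G H : ι → ℂ) (a b c d e : ℂ) :
    ∑ i ∈ s, ∑ j ∈ s, ∑ k ∈ s, F i * G j * H k * (a + (if i = j then b else 0) +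
      (if i = k then c else 0) + (if j = k then d else 0) +
      (if i = j then if j = k then e else 0 else 0)) =
      a * ((∑ i ∈ s, F i) * (∑ i ∈ s, G i) * ∑ i ∈ s, H i) +
      b * ((∑ i ∈ s, F i * G i) * ∑ i ∈ s, H i) + c * ((∑ i ∈ s, F i * H i) * ∑ i ∈ s, G i) +
      d * ((∑ i ∈ s, G i * H i) * ∑ i ∈ s, F i) + e * ∑ i ∈ s, F i * G i * H i := by
  have hk : ∀ i ∈ s, ∀ j ∈ s, ∑ k ∈ s, F i * G j * H k * (a + (if i = j then b else 0) +
      (if i = k then c else 0) + (if j = k then d else 0) +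
      (if i = j then if j = k then e else 0 else 0)) =
      F i * G j * (∑ k ∈ s, H k) * a + (if i = j then F i * G j * (∑ k ∈ s, H k) * b else 0) +
      F i * H i * G j * c + G j * H j * F i * d +
      (if i = j then F i * G j * H j * e else 0) := by
    intro i hi j hj
    simp only [mul_add, Finset.sum_add_distrib, mul_ite, mul_zero, Finset.sum_ite_eq, hi, hj,
      if_true, Finset.sum_ite_irrel, Finset.sum_const_zero, ← Finset.sum_mul, ← Finset.mul_sum]
    ring_nf
  have hj : ∀ i ∈ s, ∑ j ∈ s, (F i * G j * (∑ k ∈ s, H k) * a +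
      (if i = j then F i * G j * (∑ k ∈ s, H k) * b else 0) +
      F i * H i * G j * c + G j * H j * F i * d + (if i = j then F i * G j * H j * e else 0)) =
      F i * ((∑ j ∈ s, G j) * (∑ k ∈ s, H k) * a) + F i * G i * ((∑ k ∈ s, H k) * b) +
      F i * H i * ((∑ j ∈ s, G j) * c) + F i * ((∑ j ∈ s, G j * H j) * d) +
      F i * G i * H i * e := by
    intro i hi
    simp only [Finset.sum_add_distrib, Finset.sum_ite_eq, hi, if_true, ← Finset.sum_mul,
      ← Finset.mul_sum]
    ring
  rw [Finset.sum_congr rfl fun i hi => (Finset.sum_congr rfl fun j hj => hk i hi j hj).trans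
    (hj i hi)]
  simp only [Finset.sum_add_distrib, ← Finset.sum_mul]
  ring

section Forest

variable {μ : Measure Offspring} [IsProbabilityMeasure μ]

theorem measurePreserving_forest_eval (i : ℕ) :
    MeasurePreserving (fun w : ℕ → FamilyTree => w i) (forestLaw μ) (treeLaw μ) :=
  measurePreserving_eval_infinitePi (fun _ : ℕ => treeLaw μ) i

theorem integral_forest_eval (i : ℕ) {Y : FamilyTree → ℂ} (hY : Measurable Y) :
    ∫ w, Y (w i) ∂(forestLaw μ) = ∫ z, Y z ∂(treeLaw μ) := by
  have h := (measurePreserving_forest_eval (μ := μ) i)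
  rw [← h.map_eq, integral_map h.measurable.aemeasurable hY.aestronglyMeasurable]

theorem iIndepFun_forest : iIndepFun (fun i (w : ℕ → FamilyTree) => w i) (forestLaw μ) :=
  iIndepFun_infinitePi (P := fun _ : ℕ => treeLaw μ) (X := fun _ z => z) fun _ => measurable_id

variable {Y₁ Y₂ Y₃ : FamilyTree → ℂ}

theorem integral_forest_mul (h₁ : Measurable Y₁) (h₂ : Measurable Y₂) (i j : ℕ) :
    ∫ w, Y₁ (w i) * Y₂ (w j) ∂(forestLaw μ) =
      (∫ z, Y₁ z ∂(treeLaw μ)) * (∫ z, Y₂ z ∂(treeLaw μ)) +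
      if i = j then ∫ z, Y₁ z * Y₂ z ∂(treeLaw μ) -
        (∫ z, Y₁ z ∂(treeLaw μ)) * (∫ z, Y₂ z ∂(treeLaw μ)) else 0 := by
  split_ifs with hij
  · subst hij
    rw [integral_forest_eval i (Y := fun z => Y₁ z * Y₂ z) (h₁.mul h₂)]
    ring
  · have h := ((iIndepFun_forest (μ := μ).indepFun hij).comp h₁ h₂).integral_fun_mul_eq_mul_integral
      (h₁.comp (measurable_pi_apply i)).aestronglyMeasurable
      (h₂.comp (measurable_pi_apply j)).aestronglyMeasurable
    simp only [Function.comp_apply] at h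
    rw [h, integral_forest_eval i h₁, integral_forest_eval j h₂, add_zero]

/-- This is the moment-cumulant formula: cumulants mixing different trees vanish by independence.
The last coefficient, which equals `t - b₁₂ r₃ - b₁₃ r₂ - b₂₃ r₁ + 2 r₁ r₂ r₃`, is the joint third
cumulant on one tree. -/
theorem integral_forest_mul_mul (h₁ : Measurable Y₁) (h₂ : Measurable Y₂) (h₃ : Measurable Y₃)
    {r₁ r₂ r₃ b₁₂ b₁₃ b₂₃ t : ℂ} (hr₁ : ∫ z, Y₁ z ∂(treeLaw μ) = r₁)
    (hr₂ : ∫ z, Y₂ z ∂(treeLaw μ) = r₂) (hr₃ : ∫ z, Y₃ z ∂(treeLaw μ) = r₃)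
    (hb₁₂ : ∫ z, Y₁ z * Y₂ z ∂(treeLaw μ) = b₁₂) (hb₁₃ : ∫ z, Y₁ z * Y₃ z ∂(treeLaw μ) = b₁₃)
    (hb₂₃ : ∫ z, Y₂ z * Y₃ z ∂(treeLaw μ) = b₂₃)
    (ht : ∫ z, Y₁ z * Y₂ z * Y₃ z ∂(treeLaw μ) = t) (i j k : ℕ) :
    ∫ w, Y₁ (w i) * Y₂ (w j) * Y₃ (w k) ∂(forestLaw μ) =
      r₁ * r₂ * r₃ + (if i = j then (b₁₂ - r₁ * r₂) * r₃ else 0) +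
      (if i = k then (b₁₃ - r₁ * r₃) * r₂ else 0) + (if j = k then (b₂₃ - r₂ * r₃) * r₁ else 0) +
      if i = j then if j = k then t - (b₁₂ - r₁ * r₂) * r₃ - (b₁₃ - r₁ * r₃) * r₂ -
        (b₂₃ - r₂ * r₃) * r₁ - r₁ * r₂ * r₃ else 0 else 0 := by
  have split : ∀ {X Y Z : FamilyTree → ℂ}, Measurable X → Measurable Y → Measurable Z →
      ∀ i j k : ℕ, i ≠ k → j ≠ k → ∫ w, X (w i) * Y (w j) * Z (w k) ∂(forestLaw μ) =
        (∫ w, X (w i) * Y (w j) ∂(forestLaw μ)) * ∫ z, Z z ∂(treeLaw μ) := by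
    intro X Y Z hX hY hZ i j k hik hjk
    have hXY : Measurable fun p : FamilyTree × FamilyTree => X p.1 * Y p.2 :=
      (hX.comp measurable_fst).mul (hY.comp measurable_snd)
    have hind := (iIndepFun_forest (μ := μ)).indepFun_prodMk (fun i => measurable_pi_apply i)
      i j k hik hjk
    rw [← integral_forest_eval k hZ]
    exact (hind.comp hXY hZ).integral_fun_mul_eq_mul_integral
      (hXY.comp ((measurable_pi_apply i).prodMk (measurable_pi_apply j))).aestronglyMeasurable
      (hZ.comp (measurable_pi_apply k)).aestronglyMeasurable
  by_cases hik : i = k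
  · subst hik
    by_cases hij : i = j
    · subst hij
      rw [integral_forest_eval i (Y := fun z => Y₁ z * Y₂ z * Y₃ z) ((h₁.mul h₂).mul h₃), ht]
      simp only [if_true]
      ring
    · have hs := split h₁ h₃ h₂ i i j hij hij
      simp only [mul_right_comm _ (Y₃ _)] at hs
      rw [hs, integral_forest_mul h₁ h₃, hr₁, hr₂, hr₃, hb₁₃]
      simp only [if_true, hij, Ne.symm hij, if_false]
      ring
  · by_cases hjk : j = k
    · subst hjk
      have hs := split h₂ h₃ h₁ j j i (Ne.symm hik) (Ne.symm hik)
      simp only [mul_comm _ (Y₁ _), ← mul_assoc] at hs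
      rw [hs, integral_forest_mul h₂ h₃, hr₁, hr₂, hr₃, hb₂₃]
      simp only [if_true, hik, if_false]
      ring
    · rw [split h₁ h₂ h₃ i j k hik hjk, integral_forest_mul h₁ h₂, hr₁, hr₂, hr₃, hb₁₂]
      simp only [hik, hjk, if_false]
      split_ifs <;> ring

theorem memLp_forest_eval (hL : MemLp Y₁ 3 (treeLaw μ)) (i : ℕ) :
    MemLp (fun w : ℕ → FamilyTree => Y₁ (w i)) 3 (forestLaw μ) :=
  hL.comp_measurePreserving (measurePreserving_forest_eval i)

theorem memLp_forest_sum (hL : MemLp Y₁ 3 (treeLaw μ)) (n : ℕ) (a : ℕ → ℂ) :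
    MemLp (fun w : ℕ → FamilyTree => ∑ i ∈ Finset.range n, a i * Y₁ (w i)) 3 (forestLaw μ) :=
  memLp_finsetSum _ fun i _ => (memLp_forest_eval hL i).const_mul (a i)

theorem integral_forest_sum (hL₁ : MemLp Y₁ 3 (treeLaw μ)) (h₁ : Measurable Y₁) (n : ℕ) (a : ℕ → ℂ) :
    ∫ w, ∑ i ∈ Finset.range n, a i * Y₁ (w i) ∂(forestLaw μ) =
      (∫ z, Y₁ z ∂(treeLaw μ)) * ∑ i ∈ Finset.range n, a i := by
  rw [integral_finsetSum _ fun i _ =>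
    (integrable_of_memLp (memLp_forest_eval hL₁ i)).const_mul (a i), Finset.mul_sum]
  refine Finset.sum_congr rfl fun i _ => ?_
  rw [integral_const_mul, integral_forest_eval i h₁, mul_comm]

theorem integral_forest_sum_mul (hL₁ : MemLp Y₁ 3 (treeLaw μ))
    (hL₂ : MemLp Y₂ 3 (treeLaw μ)) (h₁ : Measurable Y₁) (h₂ : Measurable Y₂) (n : ℕ) (a b : ℕ → ℂ)
    {r₁ r₂ b₁₂ : ℂ} (hr₁ : ∫ z, Y₁ z ∂(treeLaw μ) = r₁)
    (hr₂ : ∫ z, Y₂ z ∂(treeLaw μ) = r₂) (hb₁₂ : ∫ z, Y₁ z * Y₂ z ∂(treeLaw μ) = b₁₂) :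
    ∫ w, (∑ i ∈ Finset.range n, a i * Y₁ (w i)) * (∑ i ∈ Finset.range n, b i * Y₂ (w i))
      ∂(forestLaw μ) =
      r₁ * r₂ * ((∑ i ∈ Finset.range n, a i) * ∑ i ∈ Finset.range n, b i) +
        (b₁₂ - r₁ * r₂) * ∑ i ∈ Finset.range n, a i * b i := by
  rw [← sum_mul_sum_coincidence]
  simp only [Finset.sum_mul_sum]
  have hi : ∀ i j, Integrable (fun w => a i * Y₁ (w i) * (b j * Y₂ (w j))) (forestLaw μ) :=
    fun i j => integrable_mul_of_memLp ((memLp_forest_eval hL₁ i).const_mul (a i))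
      ((memLp_forest_eval hL₂ j).const_mul (b j))
  rw [integral_finsetSum _ fun i _ => integrable_finsetSum _ fun j _ => hi i j]
  refine Finset.sum_congr rfl fun i _ => ?_
  rw [integral_finsetSum _ fun j _ => hi i j]
  refine Finset.sum_congr rfl fun j _ => ?_
  rw [← hr₁, ← hr₂, ← hb₁₂, ← integral_forest_mul h₁ h₂, ← integral_const_mul]
  refine integral_congr_ae (ae_of_all _ fun w => ?_)
  ring

theorem integral_forest_sum_mul_mul (hL₁ : MemLp Y₁ 3 (treeLaw μ))
    (hL₂ : MemLp Y₂ 3 (treeLaw μ)) (hL₃ : MemLp Y₃ 3 (treeLaw μ)) (h₁ : Measurable Y₁) (h₂ : Measurable Y₂) (h₃ : Measurable Y₃)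
    (n : ℕ) (a b c : ℕ → ℂ)
    {r₁ r₂ r₃ b₁₂ b₁₃ b₂₃ t : ℂ} (hr₁ : ∫ z, Y₁ z ∂(treeLaw μ) = r₁)
    (hr₂ : ∫ z, Y₂ z ∂(treeLaw μ) = r₂) (hr₃ : ∫ z, Y₃ z ∂(treeLaw μ) = r₃)
    (hb₁₂ : ∫ z, Y₁ z * Y₂ z ∂(treeLaw μ) = b₁₂) (hb₁₃ : ∫ z, Y₁ z * Y₃ z ∂(treeLaw μ) = b₁₃)
    (hb₂₃ : ∫ z, Y₂ z * Y₃ z ∂(treeLaw μ) = b₂₃)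
    (ht : ∫ z, Y₁ z * Y₂ z * Y₃ z ∂(treeLaw μ) = t) :
    ∫ w, (∑ i ∈ Finset.range n, a i * Y₁ (w i)) * (∑ i ∈ Finset.range n, b i * Y₂ (w i)) *
      (∑ i ∈ Finset.range n, c i * Y₃ (w i)) ∂(forestLaw μ) =
      r₁ * r₂ * r₃ * ((∑ i ∈ Finset.range n, a i) * (∑ i ∈ Finset.range n, b i) *
        ∑ i ∈ Finset.range n, c i) +
      (b₁₂ - r₁ * r₂) * r₃ * ((∑ i ∈ Finset.range n, a i * b i) * ∑ i ∈ Finset.range n, c i) +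
      (b₁₃ - r₁ * r₃) * r₂ * ((∑ i ∈ Finset.range n, a i * c i) * ∑ i ∈ Finset.range n, b i) +
      (b₂₃ - r₂ * r₃) * r₁ * ((∑ i ∈ Finset.range n, b i * c i) * ∑ i ∈ Finset.range n, a i) +
      (t - (b₁₂ - r₁ * r₂) * r₃ - (b₁₃ - r₁ * r₃) * r₂ - (b₂₃ - r₂ * r₃) * r₁ - r₁ * r₂ * r₃) *
        ∑ i ∈ Finset.range n, a i * b i * c i := by
  rw [← sum_mul_sum_mul_sum_coincidence]
  have hi : ∀ i j k, Integrable (fun w => a i * Y₁ (w i) * (b j * Y₂ (w j)) *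
      (c k * Y₃ (w k))) (forestLaw μ) := fun i j k =>
    integrable_mul_mul_of_memLp ((memLp_forest_eval hL₁ i).const_mul (a i))
      ((memLp_forest_eval hL₂ j).const_mul (b j)) ((memLp_forest_eval hL₃ k).const_mul (c k))
  have hexp : ∀ w : ℕ → FamilyTree, (∑ i ∈ Finset.range n, a i * Y₁ (w i)) *
      (∑ i ∈ Finset.range n, b i * Y₂ (w i)) * (∑ i ∈ Finset.range n, c i * Y₃ (w i)) =
      ∑ i ∈ Finset.range n, ∑ j ∈ Finset.range n, ∑ k ∈ Finset.range n,
        a i * Y₁ (w i) * (b j * Y₂ (w j)) * (c k * Y₃ (w k)) := fun w => by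
    rw [Finset.sum_mul_sum, Finset.sum_mul]
    exact Finset.sum_congr rfl fun i _ => Finset.sum_mul_sum _ _ _ _
  simp only [hexp]
  rw [integral_finsetSum _ fun i _ => integrable_finsetSum _ fun j _ =>
    integrable_finsetSum _ fun k _ => hi i j k]
  refine Finset.sum_congr rfl fun i _ => ?_
  rw [integral_finsetSum _ fun j _ => integrable_finsetSum _ fun k _ => hi i j k]
  refine Finset.sum_congr rfl fun j _ => ?_
  rw [integral_finsetSum _ fun k _ => hi i j k]
  refine Finset.sum_congr rfl fun k _ => ?_
  rw [← integral_forest_mul_mul h₁ h₂ h₃ hr₁ hr₂ hr₃ hb₁₂ hb₁₃ hb₂₃ ht, ← integral_const_mul]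
  refine integral_congr_ae (ae_of_all _ fun w => ?_)
  ring

end Forest

/-- The function `f` is integrable with integral `c`. -/
def HasMean {α : Type*} [MeasurableSpace α] (ρ : Measure α) (f : α → ℂ) (c : ℂ) : Prop :=
  Integrable f ρ ∧ ∫ a, f a ∂ρ = c

namespace HasMean

variable {α : Type*} [MeasurableSpace α] {ρ : Measure α} {f g : α → ℂ} {c d : ℂ}

theorem add (hf : HasMean ρ f c) (hg : HasMean ρ g d) :
    HasMean ρ (fun a => f a + g a) (c + d) :=
  ⟨hf.1.add hg.1, by rw [integral_add hf.1 hg.1, hf.2, hg.2]⟩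

theorem const_mul (b : ℂ) (hf : HasMean ρ f c) : HasMean ρ (fun a => b * f a) (b * c) :=
  ⟨hf.1.const_mul b, by rw [integral_const_mul, hf.2]⟩

theorem one [IsProbabilityMeasure ρ] : HasMean ρ (fun _ => (1 : ℂ)) 1 :=
  ⟨integrable_const _, by simp⟩

theorem congr (hf : HasMean ρ f c) (h : ∀ a, f a = g a) : HasMean ρ g c := by
  obtain rfl : f = g := funext h
  exact hf

theorem one_add_mul [IsProbabilityMeasure ρ] {X Y : α → ℂ} {a b ab : ℂ} (hX : HasMean ρ X a)
    (hY : HasMean ρ Y b) (hXY : HasMean ρ (fun x => X x * Y x) ab) :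
    HasMean ρ (fun x => (1 + X x) * (1 + Y x)) (1 + a + b + ab) :=
  (((one.add hX).add hY).add hXY).congr fun x => by ring

theorem one_add_mul_mul [IsProbabilityMeasure ρ] {X Y Z : α → ℂ} {a b c ab ac bc abc : ℂ}
    (hX : HasMean ρ X a) (hY : HasMean ρ Y b) (hZ : HasMean ρ Z c)
    (hXY : HasMean ρ (fun x => X x * Y x) ab) (hXZ : HasMean ρ (fun x => X x * Z x) ac)
    (hYZ : HasMean ρ (fun x => Y x * Z x) bc) (hXYZ : HasMean ρ (fun x => X x * Y x * Z x) abc) :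
    HasMean ρ (fun x => (1 + X x) * (1 + Y x) * (1 + Z x))
      (1 + a + b + c + ab + ac + bc + abc) :=
  (((((((one.add hX).add hY).add hZ).add hXY).add hXZ).add hYZ).add hXYZ).congr fun x => by ring

end HasMean

namespace IsPoissonProcess

variable {Ω : Type*} [MeasurableSpace Ω] {P : Measure Ω} {ξ : Ω → Measure ℝ} {Λ : Measure ℝ}
  [IsFiniteMeasure Λ] {f g h : ℝ → ℂ}

theorem memLp_integral [IsFiniteMeasure P] (hξ : IsPoissonProcess P ξ Λ) (hm : Measurable ξ)
    (hf : Measurable f) (hfb : ∀ x, ‖f x‖ ≤ 1) : MemLp (fun ω => ∫ x, f x ∂(ξ ω)) 3 P := by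
  have h3 : MemLp (fun ω => (ξ ω).real Set.univ) 3 P := by
    have := (integrable_norm_rpow_iff (p := 3) (μ := P)
      (measurable_real hm .univ).aestronglyMeasurable (by norm_num) (by norm_num)).1 ?_
    · exact this
    · simpa [abs_of_nonneg] using hξ.integrable_real_pow hm .univ (measure_ne_top _ _) 3
  refine h3.mono' (hξ.aestronglyMeasurable_integral_of_bounded hm hf hfb) ?_
  filter_upwards [hξ.ae_isFiniteMeasure hm] with ω hω
  simpa using norm_integral_le_mul_real (ξ ω) hfb

variable [IsFiniteMeasure P]

theorem hasMean_integral (hξ : IsPoissonProcess P ξ Λ) (hm : Measurable ξ)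
    (hf : Measurable f) (hfb : ∀ x, ‖f x‖ ≤ 1) :
    HasMean P (fun ω => ∫ x, f x ∂(ξ ω)) (∫ x, f x ∂Λ) :=
  ⟨integrable_of_memLp (hξ.memLp_integral hm hf hfb), hξ.integral_integral hm hf hfb⟩

theorem hasMean_integral_mul (hξ : IsPoissonProcess P ξ Λ) (hm : Measurable ξ)
    (hf : Measurable f) (hfb : ∀ x, ‖f x‖ ≤ 1) (hg : Measurable g) (hgb : ∀ x, ‖g x‖ ≤ 1) :
    HasMean P (fun ω => (∫ x, f x ∂(ξ ω)) * (∫ x, g x ∂(ξ ω)))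
      ((∫ x, f x ∂Λ) * (∫ x, g x ∂Λ) + ∫ x, f x * g x ∂Λ) :=
  ⟨integrable_mul_of_memLp (hξ.memLp_integral hm hf hfb) (hξ.memLp_integral hm hg hgb),
    hξ.integral_integral_mul hm hf hfb hg hgb⟩

theorem hasMean_integral_mul_mul (hξ : IsPoissonProcess P ξ Λ) (hm : Measurable ξ)
    (hf : Measurable f) (hfb : ∀ x, ‖f x‖ ≤ 1) (hg : Measurable g) (hgb : ∀ x, ‖g x‖ ≤ 1)
    (hh : Measurable h) (hhb : ∀ x, ‖h x‖ ≤ 1) :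
    HasMean P (fun ω => (∫ x, f x ∂(ξ ω)) * (∫ x, g x ∂(ξ ω)) * (∫ x, h x ∂(ξ ω)))
      ((∫ x, f x ∂Λ) * (∫ x, g x ∂Λ) * (∫ x, h x ∂Λ) +
      (∫ x, f x * g x ∂Λ) * (∫ x, h x ∂Λ) + (∫ x, f x * h x ∂Λ) * (∫ x, g x ∂Λ) +
      (∫ x, g x * h x ∂Λ) * (∫ x, f x ∂Λ) + ∫ x, f x * g x * h x ∂Λ) :=
  ⟨integrable_mul_mul_of_memLp (hξ.memLp_integral hm hf hfb) (hξ.memLp_integral hm hg hgb)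
    (hξ.memLp_integral hm hh hhb), hξ.integral_integral_mul_mul hm hf hfb hg hgb hh hhb⟩

end IsPoissonProcess

theorem integral_offspringMeasure (o : Offspring) (f : ℝ → ℂ) :
    ∫ x, f x ∂(offspringMeasure o) = ∑ i ∈ Finset.range o.1, f (o.2 i) := by
  rw [offspringMeasure, integral_finsetSum_measure fun i _ => integrable_dirac (by simp)]
  simp

/-! ### Moment recursions for branching functionals. -/

section TreeMoments

variable {μ : Measure Offspring} [IsProbabilityMeasure μ] {Λ : Measure ℝ} [IsFiniteMeasure Λ]

/-- Conditioning on the offspring of the root: by `treeLaw_map` the offspring and the subtrees have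
a product law, and Fubini applies. -/
theorem integral_tree {F : FamilyTree → ℂ} {H : Offspring × (ℕ → FamilyTree) → ℂ}
    (hH : Measurable H) (hF : Integrable F (treeLaw μ))
    (hFH : ∀ᵐ z ∂(treeLaw μ), F z = H (z [], child z)) :
    ∫ z, F z ∂(treeLaw μ) = ∫ o, ∫ w, H (o, w) ∂(forestLaw μ) ∂μ := by
  have hi : Integrable H (μ.prod (forestLaw μ)) := by
    rw [← treeLaw_map, integrable_map_measure hH.aestronglyMeasurable
      measurable_root_child.aemeasurable]
    exact hF.congr hFH
  rw [← integral_prod _ hi, ← treeLaw_map, integral_map measurable_root_child.aemeasurable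
    hH.aestronglyMeasurable]
  exact integral_congr_ae hFH

/-- `Y` is an additive functional of the tree in which the displacement `x` of a child of the root
acts on the contribution of its descendants by the factor `f x`. -/
structure IsBranchingFunctional (μ : Measure Offspring) [IsProbabilityMeasure μ]
    (f : ℝ → ℂ) (Y : FamilyTree → ℂ) : Prop where
  measurable_factor : Measurable f
  norm_factor_le : ∀ x, ‖f x‖ ≤ 1
  measurable : Measurable Y
  memLp : MemLp Y 3 (treeLaw μ)
  branching : ∀ᵐ z ∂(treeLaw μ),
    Y z = 1 + ∑ i ∈ Finset.range (z []).1, f ((z []).2 i) * Y (child z i)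

namespace IsBranchingFunctional

variable {f f₁ f₂ f₃ : ℝ → ℂ} {Y Y₁ Y₂ Y₃ : FamilyTree → ℂ}

theorem measurable_sum (hY : IsBranchingFunctional μ f Y) :
    Measurable fun p : Offspring × (ℕ → FamilyTree) =>
      1 + ∑ i ∈ Finset.range p.1.1, f (p.1.2 i) * Y (p.2 i) := by
  have h : Measurable fun q : ℕ × ((ℕ → ℝ) × (ℕ → FamilyTree)) =>
      ∑ i ∈ Finset.range q.1, f (q.2.1 i) * Y (q.2.2 i) :=
    measurable_sum_range (f := fun i (q : (ℕ → ℝ) × (ℕ → FamilyTree)) => f (q.1 i) * Y (q.2 i))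
      fun i => (hY.measurable_factor.comp ((measurable_pi_apply i).comp measurable_fst)).mul
        (hY.measurable.comp ((measurable_pi_apply i).comp measurable_snd))
  exact measurable_const.add (h.comp (measurable_fst.fst.prodMk
    (measurable_fst.snd.prodMk measurable_snd)))

theorem memLp_sum (hY : IsBranchingFunctional μ f Y) (o : Offspring) :
    MemLp (fun w : ℕ → FamilyTree => ∑ i ∈ Finset.range o.1, f (o.2 i) * Y (w i)) 3
      (forestLaw μ) :=
  memLp_forest_sum hY.memLp o.1 fun i => f (o.2 i)

theorem hasMean_sum (hY : IsBranchingFunctional μ f Y) (o : Offspring) :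
    HasMean (forestLaw μ) (fun w => ∑ i ∈ Finset.range o.1, f (o.2 i) * Y (w i))
      ((∫ z, Y z ∂(treeLaw μ)) * ∫ x, f x ∂(offspringMeasure o)) :=
  ⟨integrable_of_memLp (hY.memLp_sum o), by
    rw [integral_forest_sum hY.memLp hY.measurable, integral_offspringMeasure]⟩

theorem hasMean_sum_mul (h₁ : IsBranchingFunctional μ f₁ Y₁) (h₂ : IsBranchingFunctional μ f₂ Y₂)
    {r₁ r₂ b₁₂ : ℂ} (hr₁ : ∫ z, Y₁ z ∂(treeLaw μ) = r₁) (hr₂ : ∫ z, Y₂ z ∂(treeLaw μ) = r₂)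
    (hb₁₂ : ∫ z, Y₁ z * Y₂ z ∂(treeLaw μ) = b₁₂) (o : Offspring) :
    HasMean (forestLaw μ) (fun w => (∑ i ∈ Finset.range o.1, f₁ (o.2 i) * Y₁ (w i)) *
        (∑ i ∈ Finset.range o.1, f₂ (o.2 i) * Y₂ (w i)))
      (r₁ * r₂ * ((∫ x, f₁ x ∂(offspringMeasure o)) * ∫ x, f₂ x ∂(offspringMeasure o)) +
        (b₁₂ - r₁ * r₂) * ∫ x, f₁ x * f₂ x ∂(offspringMeasure o)) :=
  ⟨integrable_mul_of_memLp (h₁.memLp_sum o) (h₂.memLp_sum o), by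
    rw [integral_forest_sum_mul h₁.memLp h₂.memLp h₁.measurable h₂.measurable _ _ _ hr₁ hr₂ hb₁₂]
    simp only [integral_offspringMeasure]⟩

theorem hasMean_sum_mul_mul (h₁ : IsBranchingFunctional μ f₁ Y₁)
    (h₂ : IsBranchingFunctional μ f₂ Y₂) (h₃ : IsBranchingFunctional μ f₃ Y₃)
    {r₁ r₂ r₃ b₁₂ b₁₃ b₂₃ t : ℂ} (hr₁ : ∫ z, Y₁ z ∂(treeLaw μ) = r₁)
    (hr₂ : ∫ z, Y₂ z ∂(treeLaw μ) = r₂) (hr₃ : ∫ z, Y₃ z ∂(treeLaw μ) = r₃)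
    (hb₁₂ : ∫ z, Y₁ z * Y₂ z ∂(treeLaw μ) = b₁₂) (hb₁₃ : ∫ z, Y₁ z * Y₃ z ∂(treeLaw μ) = b₁₃)
    (hb₂₃ : ∫ z, Y₂ z * Y₃ z ∂(treeLaw μ) = b₂₃)
    (ht : ∫ z, Y₁ z * Y₂ z * Y₃ z ∂(treeLaw μ) = t) (o : Offspring) :
    HasMean (forestLaw μ) (fun w => (∑ i ∈ Finset.range o.1, f₁ (o.2 i) * Y₁ (w i)) *
        (∑ i ∈ Finset.range o.1, f₂ (o.2 i) * Y₂ (w i)) *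
        (∑ i ∈ Finset.range o.1, f₃ (o.2 i) * Y₃ (w i)))
      (r₁ * r₂ * r₃ * ((∫ x, f₁ x ∂(offspringMeasure o)) * (∫ x, f₂ x ∂(offspringMeasure o)) *
        ∫ x, f₃ x ∂(offspringMeasure o)) +
      (b₁₂ - r₁ * r₂) * r₃ *
        ((∫ x, f₁ x * f₂ x ∂(offspringMeasure o)) * ∫ x, f₃ x ∂(offspringMeasure o)) +
      (b₁₃ - r₁ * r₃) * r₂ *
        ((∫ x, f₁ x * f₃ x ∂(offspringMeasure o)) * ∫ x, f₂ x ∂(offspringMeasure o)) +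
      (b₂₃ - r₂ * r₃) * r₁ *
        ((∫ x, f₂ x * f₃ x ∂(offspringMeasure o)) * ∫ x, f₁ x ∂(offspringMeasure o)) +
      (t - (b₁₂ - r₁ * r₂) * r₃ - (b₁₃ - r₁ * r₃) * r₂ - (b₂₃ - r₂ * r₃) * r₁ - r₁ * r₂ * r₃) *
        ∫ x, f₁ x * f₂ x * f₃ x ∂(offspringMeasure o)) :=
  ⟨integrable_mul_mul_of_memLp (h₁.memLp_sum o) (h₂.memLp_sum o) (h₃.memLp_sum o), by
    rw [integral_forest_sum_mul_mul h₁.memLp h₂.memLp h₃.memLp h₁.measurable h₂.measurable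
      h₃.measurable _ _ _ _ hr₁ hr₂ hr₃ hb₁₂ hb₁₃ hb₂₃ ht]
    simp only [integral_offspringMeasure]⟩

/-- Given the displacements, every subtree contributes the same mean `r₁`; the mean of the sum of
the factors is the integral against the intensity. -/
theorem first_moment (hμ : IsPoissonProcess μ offspringMeasure Λ)
    (h₁ : IsBranchingFunctional μ f₁ Y₁) {r₁ l₁ : ℂ} (hr₁ : ∫ z, Y₁ z ∂(treeLaw μ) = r₁)
    (hl₁ : ∫ x, f₁ x ∂Λ = l₁) : r₁ = 1 + r₁ * l₁ := by
  have hm := measurable_offspringMeasure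
  have hinner := fun o => (HasMean.one.add (h₁.hasMean_sum o)).2
  have houter := HasMean.one.add ((hμ.hasMean_integral hm h₁.measurable_factor
    h₁.norm_factor_le).const_mul r₁)
  rw [hl₁] at houter
  rw [← houter.2]
  nth_rewrite 1 [← hr₁]
  rw [integral_tree h₁.measurable_sum (integrable_of_memLp h₁.memLp) h₁.branching]
  simp only [hinner, hr₁]

/-- The term `r₁ r₂ l₁₂` arising from coinciding points of the Poisson process cancels the
correction `- r₁ r₂` for using the same subtree twice. The covariance left is `b₁₂ l₁₂`, as for a
compound Poisson sum. -/
theorem second_moment (hμ : IsPoissonProcess μ offspringMeasure Λ)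
    (h₁ : IsBranchingFunctional μ f₁ Y₁) (h₂ : IsBranchingFunctional μ f₂ Y₂)
    {r₁ r₂ b₁₂ l₁ l₂ l₁₂ : ℂ} (hr₁ : ∫ z, Y₁ z ∂(treeLaw μ) = r₁)
    (hr₂ : ∫ z, Y₂ z ∂(treeLaw μ) = r₂) (hb₁₂ : ∫ z, Y₁ z * Y₂ z ∂(treeLaw μ) = b₁₂)
    (hl₁ : ∫ x, f₁ x ∂Λ = l₁) (hl₂ : ∫ x, f₂ x ∂Λ = l₂) (hl₁₂ : ∫ x, f₁ x * f₂ x ∂Λ = l₁₂) :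
    b₁₂ = (1 + r₁ * l₁) * (1 + r₂ * l₂) + b₁₂ * l₁₂ := by
  have hm := measurable_offspringMeasure
  have hinner := fun o : Offspring => ((h₁.hasMean_sum o).one_add_mul (h₂.hasMean_sum o)
    (h₁.hasMean_sum_mul h₂ hr₁ hr₂ hb₁₂ o)).2
  have hA₁ := hμ.hasMean_integral hm h₁.measurable_factor h₁.norm_factor_le
  have hA₂ := hμ.hasMean_integral hm h₂.measurable_factor h₂.norm_factor_le
  have hA₁₂ := hμ.hasMean_integral hm (f := fun x => f₁ x * f₂ x)
    (h₁.measurable_factor.mul h₂.measurable_factor)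
    fun x => IsPoissonProcess.norm_mul_le_one (h₁.norm_factor_le x) (h₂.norm_factor_le x)
  have hA₁A₂ := hμ.hasMean_integral_mul hm h₁.measurable_factor h₁.norm_factor_le
    h₂.measurable_factor h₂.norm_factor_le
  have houter := (((HasMean.one.add (hA₁.const_mul r₁)).add (hA₂.const_mul r₂)).add
    ((hA₁A₂.const_mul (r₁ * r₂)).add (hA₁₂.const_mul (b₁₂ - r₁ * r₂)))).2
  have htree := integral_tree (F := fun z => Y₁ z * Y₂ z)
    (H := fun p => (1 + ∑ i ∈ Finset.range p.1.1, f₁ (p.1.2 i) * Y₁ (p.2 i)) *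
      (1 + ∑ i ∈ Finset.range p.1.1, f₂ (p.1.2 i) * Y₂ (p.2 i)))
    (h₁.measurable_sum.mul h₂.measurable_sum) (integrable_mul_of_memLp h₁.memLp h₂.memLp)
    (by filter_upwards [h₁.branching, h₂.branching] with z hz₁ hz₂
        rw [hz₁, hz₂])
  simp only [hinner, hr₁, hr₂] at htree
  rw [hb₁₂, houter, hl₁, hl₂, hl₁₂] at htree
  linear_combination htree

/-- The sums over the children are compound Poisson, with joint cumulants `rᵢ lᵢ`, `bᵢⱼ lᵢⱼ` and `t
l₁₂₃`; the root adds `1` to the first-order ones only. The right-hand side expresses the third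
moment through these cumulants. -/
theorem third_moment (hμ : IsPoissonProcess μ offspringMeasure Λ)
    (h₁ : IsBranchingFunctional μ f₁ Y₁) (h₂ : IsBranchingFunctional μ f₂ Y₂)
    (h₃ : IsBranchingFunctional μ f₃ Y₃)
    {r₁ r₂ r₃ b₁₂ b₁₃ b₂₃ t l₁ l₂ l₃ l₁₂ l₁₃ l₂₃ l₁₂₃ : ℂ} (hr₁ : ∫ z, Y₁ z ∂(treeLaw μ) = r₁)
    (hr₂ : ∫ z, Y₂ z ∂(treeLaw μ) = r₂) (hr₃ : ∫ z, Y₃ z ∂(treeLaw μ) = r₃)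
    (hb₁₂ : ∫ z, Y₁ z * Y₂ z ∂(treeLaw μ) = b₁₂) (hb₁₃ : ∫ z, Y₁ z * Y₃ z ∂(treeLaw μ) = b₁₃)
    (hb₂₃ : ∫ z, Y₂ z * Y₃ z ∂(treeLaw μ) = b₂₃)
    (ht : ∫ z, Y₁ z * Y₂ z * Y₃ z ∂(treeLaw μ) = t)
    (hl₁ : ∫ x, f₁ x ∂Λ = l₁) (hl₂ : ∫ x, f₂ x ∂Λ = l₂) (hl₃ : ∫ x, f₃ x ∂Λ = l₃)
    (hl₁₂ : ∫ x, f₁ x * f₂ x ∂Λ = l₁₂) (hl₁₃ : ∫ x, f₁ x * f₃ x ∂Λ = l₁₃)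
    (hl₂₃ : ∫ x, f₂ x * f₃ x ∂Λ = l₂₃) (hl₁₂₃ : ∫ x, f₁ x * f₂ x * f₃ x ∂Λ = l₁₂₃) :
    t = (1 + r₁ * l₁) * (1 + r₂ * l₂) * (1 + r₃ * l₃) + b₁₂ * l₁₂ * (1 + r₃ * l₃) +
      b₁₃ * l₁₃ * (1 + r₂ * l₂) + b₂₃ * l₂₃ * (1 + r₁ * l₁) + t * l₁₂₃ := by
  have hm := measurable_offspringMeasure
  have hinner := fun o : Offspring => ((h₁.hasMean_sum o).one_add_mul_mul (h₂.hasMean_sum o)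
    (h₃.hasMean_sum o) (h₁.hasMean_sum_mul h₂ hr₁ hr₂ hb₁₂ o)
    (h₁.hasMean_sum_mul h₃ hr₁ hr₃ hb₁₃ o) (h₂.hasMean_sum_mul h₃ hr₂ hr₃ hb₂₃ o)
    (h₁.hasMean_sum_mul_mul h₂ h₃ hr₁ hr₂ hr₃ hb₁₂ hb₁₃ hb₂₃ ht o)).2
  have m₁ := h₁.measurable_factor
  have m₂ := h₂.measurable_factor
  have m₃ := h₃.measurable_factor
  have n₁ := h₁.norm_factor_le
  have n₂ := h₂.norm_factor_le
  have n₃ := h₃.norm_factor_le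
  have m₁₂ : Measurable fun x => f₁ x * f₂ x := m₁.mul m₂
  have m₁₃ : Measurable fun x => f₁ x * f₃ x := m₁.mul m₃
  have m₂₃ : Measurable fun x => f₂ x * f₃ x := m₂.mul m₃
  have n₁₂ := fun x => IsPoissonProcess.norm_mul_le_one (n₁ x) (n₂ x)
  have n₁₃ := fun x => IsPoissonProcess.norm_mul_le_one (n₁ x) (n₃ x)
  have n₂₃ := fun x => IsPoissonProcess.norm_mul_le_one (n₂ x) (n₃ x)
  have hA₁ := hμ.hasMean_integral hm m₁ n₁
  have hA₂ := hμ.hasMean_integral hm m₂ n₂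
  have hA₃ := hμ.hasMean_integral hm m₃ n₃
  have hA₁₂ := hμ.hasMean_integral hm m₁₂ n₁₂
  have hA₁₃ := hμ.hasMean_integral hm m₁₃ n₁₃
  have hA₂₃ := hμ.hasMean_integral hm m₂₃ n₂₃
  have hA₁₂₃ := hμ.hasMean_integral hm (f := fun x => f₁ x * f₂ x * f₃ x) (m₁₂.mul m₃) fun x =>
    IsPoissonProcess.norm_mul_le_one (n₁₂ x) (n₃ x)
  have hA₁A₂ := hμ.hasMean_integral_mul hm m₁ n₁ m₂ n₂
  have hA₁A₃ := hμ.hasMean_integral_mul hm m₁ n₁ m₃ n₃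
  have hA₂A₃ := hμ.hasMean_integral_mul hm m₂ n₂ m₃ n₃
  have hA₁₂A₃ := hμ.hasMean_integral_mul hm m₁₂ n₁₂ m₃ n₃
  have hA₁₃A₂ := hμ.hasMean_integral_mul hm m₁₃ n₁₃ m₂ n₂
  have hA₂₃A₁ := hμ.hasMean_integral_mul hm m₂₃ n₂₃ m₁ n₁
  have hA₁A₂A₃ := hμ.hasMean_integral_mul_mul hm m₁ n₁ m₂ n₂ m₃ n₃
  have e₁₃₂ : ∫ x, f₁ x * f₃ x * f₂ x ∂Λ = l₁₂₃ := by
    rw [← hl₁₂₃]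
    exact integral_congr_ae (ae_of_all _ fun x => by ring)
  have e₂₃₁ : ∫ x, f₂ x * f₃ x * f₁ x ∂Λ = l₁₂₃ := by
    rw [← hl₁₂₃]
    exact integral_congr_ae (ae_of_all _ fun x => by ring)
  have houter := (((((((HasMean.one.add (hA₁.const_mul r₁)).add (hA₂.const_mul r₂)).add
    (hA₃.const_mul r₃)).add
    ((hA₁A₂.const_mul (r₁ * r₂)).add (hA₁₂.const_mul (b₁₂ - r₁ * r₂)))).add
    ((hA₁A₃.const_mul (r₁ * r₃)).add (hA₁₃.const_mul (b₁₃ - r₁ * r₃)))).add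
    ((hA₂A₃.const_mul (r₂ * r₃)).add (hA₂₃.const_mul (b₂₃ - r₂ * r₃)))).add
    (((((hA₁A₂A₃.const_mul (r₁ * r₂ * r₃)).add
      (hA₁₂A₃.const_mul ((b₁₂ - r₁ * r₂) * r₃))).add
      (hA₁₃A₂.const_mul ((b₁₃ - r₁ * r₃) * r₂))).add
      (hA₂₃A₁.const_mul ((b₂₃ - r₂ * r₃) * r₁))).add (hA₁₂₃.const_mul
      (t - (b₁₂ - r₁ * r₂) * r₃ - (b₁₃ - r₁ * r₃) * r₂ - (b₂₃ - r₂ * r₃) * r₁ -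
        r₁ * r₂ * r₃)))).2
  have htree := integral_tree (F := fun z => Y₁ z * Y₂ z * Y₃ z)
    (H := fun p => (1 + ∑ i ∈ Finset.range p.1.1, f₁ (p.1.2 i) * Y₁ (p.2 i)) *
      (1 + ∑ i ∈ Finset.range p.1.1, f₂ (p.1.2 i) * Y₂ (p.2 i)) *
      (1 + ∑ i ∈ Finset.range p.1.1, f₃ (p.1.2 i) * Y₃ (p.2 i)))
    ((h₁.measurable_sum.mul h₂.measurable_sum).mul h₃.measurable_sum)
    (integrable_mul_mul_of_memLp h₁.memLp h₂.memLp h₃.memLp)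
    (by filter_upwards [h₁.branching, h₂.branching, h₃.branching] with z hz₁ hz₂ hz₃
        rw [hz₁, hz₂, hz₃])
  simp only [hinner, hr₁, hr₂, hr₃] at htree
  rw [ht, houter, hl₁, hl₂, hl₃, hl₁₂, hl₁₃, hl₂₃, hl₁₂₃, e₁₃₂, e₂₃₁] at htree
  linear_combination htree

end IsBranchingFunctional
end TreeMoments

/-! ### The Fourier transform of the cluster and its third moment. -/

/-- The character `x ↦ exp (-i ω x)`. -/
noncomputable def expChar (ω x : ℝ) : ℂ := Complex.exp (-Complex.I * ((ω * x : ℝ) : ℂ))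

theorem norm_expChar (ω x : ℝ) : ‖expChar ω x‖ = 1 := by
  rw [expChar, Complex.norm_exp]
  simp

theorem continuous_expChar (ω : ℝ) : Continuous (expChar ω) := by
  unfold expChar
  fun_prop

theorem measurable_expChar (ω : ℝ) : Measurable (expChar ω) := (continuous_expChar ω).measurable

theorem expChar_add (ω x y : ℝ) : expChar ω (x + y) = expChar ω x * expChar ω y := by
  simp only [expChar, ← Complex.exp_add]
  push_cast
  ring_nf

theorem expChar_mul (ω₁ ω₂ x : ℝ) : expChar ω₁ x * expChar ω₂ x = expChar (ω₁ + ω₂) x := by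
  simp only [expChar, ← Complex.exp_add]
  push_cast
  ring_nf

theorem expChar_zero (ω : ℝ) : expChar ω 0 = 1 := by simp [expChar]

theorem integrable_expChar (ω : ℝ) (μ : Measure ℝ) [IsFiniteMeasure μ] :
    Integrable (expChar ω) μ :=
  Integrable.of_bound (measurable_expChar ω).aestronglyMeasurable 1
    (Eventually.of_forall fun x => (norm_expChar ω x).le)

/-- The Fourier transform of the cluster. -/
noncomputable def clusterHat (ω : ℝ) (z : FamilyTree) : ℂ := ∫ x, expChar ω x ∂(cluster z)

theorem measurable_clusterHat (ω : ℝ) : Measurable (clusterHat ω) := by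
  have := StronglyMeasurable.integral_kernel (κ := clusterKernel)
    (measurable_expChar ω).stronglyMeasurable
  simp only [clusterKernel_apply] at this
  exact this.measurable

theorem measurable_cluster_real : Measurable fun z : FamilyTree => (cluster z).real Set.univ :=
  ((Measure.measurable_coe .univ).comp measurable_cluster).ennreal_toReal

theorem norm_clusterHat_le (ω : ℝ) (z : FamilyTree) :
    ‖clusterHat ω z‖ ≤ (cluster z).real Set.univ := by
  refine (norm_integral_le_integral_norm _).trans ?_
  simp [norm_expChar]

theorem isFiniteMeasure_cluster_child {z : FamilyTree} (hz : IsFiniteMeasure (cluster z)) {i : ℕ}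
    (hi : i < (z []).1) : IsFiniteMeasure (cluster (child z i)) := by
  have h := hz.measure_univ_lt_top
  rw [cluster_eq, Measure.add_apply, Measure.finsetSum_apply] at h
  have h2 := ENNReal.sum_lt_top.1 (ENNReal.add_lt_top.1 h).2 i (Finset.mem_range.2 hi)
  rw [Measure.map_apply (by fun_prop) .univ, Set.preimage_univ] at h2
  exact ⟨h2⟩

/-- The transform of the branching property, using multiplicativity of the character. Finiteness of
the cluster passes to the subclusters and makes every term integrable. -/
theorem clusterHat_eq (ω : ℝ) {z : FamilyTree} (hz : IsFiniteMeasure (cluster z)) :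
    clusterHat ω z = 1 + ∑ i ∈ Finset.range (z []).1,
      expChar ω ((z []).2 i) * clusterHat ω (child z i) := by
  have hi : ∀ i ∈ Finset.range (z []).1, Integrable (expChar ω)
      ((cluster (child z i)).map (fun x => (z []).2 i + x)) := fun i hi => by
    have := isFiniteMeasure_cluster_child hz (Finset.mem_range.1 hi)
    exact integrable_expChar ω _
  rw [clusterHat, cluster_eq, integral_add_measure (integrable_expChar ω _)
    (integrable_finsetSum_measure.2 hi), integral_dirac, expChar_zero,
    integral_finsetSum_measure hi]
  congr 1
  refine Finset.sum_congr rfl fun i _ => ?_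
  rw [integral_map (by fun_prop) (measurable_expChar ω).aestronglyMeasurable, clusterHat,
    ← integral_const_mul]
  simp only [expChar_add]

section ClusterMoments

variable {μ : Measure Offspring} [IsProbabilityMeasure μ] {Λ : Measure ℝ} [IsFiniteMeasure Λ]

theorem memLp_cluster_real {θ : ℝ} (hθ : 0 < θ)
    (he : Integrable (fun z => Real.exp (θ * (cluster z).real Set.univ)) (treeLaw μ)) :
    MemLp (fun z => (cluster z).real Set.univ) 3 (treeLaw μ) := by
  refine (integrable_norm_rpow_iff (p := 3) measurable_cluster_real.aestronglyMeasurable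
    (by norm_num) (by norm_num)).1 ?_
  refine (he.const_mul (6 / θ ^ 3)).mono'
    (measurable_cluster_real.norm.pow_const _).aestronglyMeasurable (Eventually.of_forall fun z => ?_)
  have h0 : 0 ≤ (cluster z).real Set.univ := measureReal_nonneg
  have h1 := Real.pow_div_factorial_le_exp (θ * (cluster z).real Set.univ) (by positivity) 3
  have h2 : ‖‖(cluster z).real Set.univ‖ ^ (3 : ℝ≥0∞).toReal‖ = (cluster z).real Set.univ ^ 3 := by
    have : (3 : ℝ≥0∞).toReal = (3 : ℕ) := by norm_num
    rw [this, Real.rpow_natCast, Real.norm_of_nonneg (by positivity), Real.norm_of_nonneg h0]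
  rw [h2, div_mul_eq_mul_div, le_div_iff₀ (by positivity)]
  have : ((3 : ℕ).factorial : ℝ) = 6 := by norm_num [Nat.factorial]
  rw [this, div_le_iff₀ (by norm_num)] at h1
  nlinarith [h1]

theorem isBranchingFunctional_clusterHat {θ : ℝ} (hθ : 0 < θ)
    (hf : ∀ᵐ z ∂(treeLaw μ), IsFiniteMeasure (cluster z))
    (he : Integrable (fun z => Real.exp (θ * (cluster z).real Set.univ)) (treeLaw μ)) (ω : ℝ) :
    IsBranchingFunctional μ (expChar ω) (clusterHat ω) where
  measurable_factor := measurable_expChar ω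
  norm_factor_le x := (norm_expChar ω x).le
  measurable := measurable_clusterHat ω
  memLp := (memLp_cluster_real hθ he).mono' (measurable_clusterHat ω).aestronglyMeasurable
    (Eventually.of_forall fun z => norm_clusterHat_le ω z)
  branching := hf.mono fun _ hz => clusterHat_eq ω hz

end ClusterMoments

section OffspringIntensity

variable {m : ℝ} {h : ℝ → ℝ}

/-- The intensity measure of the offspring displacements. -/
noncomputable def offspringIntensity (m : ℝ) (h : ℝ → ℝ) : Measure ℝ :=
  (volume : Measure ℝ).withDensity fun x => ENNReal.ofReal (m * h x)

theorem integrable_of_integral_eq_one (h_int : ∫ x, h x = 1) : Integrable h := by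
  by_contra hc
  rw [integral_undef hc] at h_int
  norm_num at h_int

theorem offspringIntensity_univ (hm0 : 0 < m) (h_nonneg : ∀ x, 0 ≤ h x) (h_int : ∫ x, h x = 1) :
    offspringIntensity m h Set.univ = ENNReal.ofReal m := by
  rw [offspringIntensity, withDensity_apply _ .univ, Measure.restrict_univ,
    ← ofReal_integral_eq_lintegral_ofReal ((integrable_of_integral_eq_one h_int).const_mul m)
      (Eventually.of_forall fun x => mul_nonneg hm0.le (h_nonneg x)), integral_const_mul, h_int,
    mul_one]

theorem integral_expChar_offspringIntensity (hm0 : 0 < m) (h_meas : Measurable h)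
    (h_nonneg : ∀ x, 0 ≤ h x) (ω : ℝ) :
    ∫ x, expChar ω x ∂(offspringIntensity m h) = m * fourierHat h ω := by
  rw [offspringIntensity, integral_withDensity_eq_integral_toReal_smul (by fun_prop) (by simp),
    fourierHat, ← integral_const_mul]
  refine integral_congr_ae (Eventually.of_forall fun x => ?_)
  simp only [ENNReal.toReal_ofReal (mul_nonneg hm0.le (h_nonneg x)), expChar, Complex.real_smul]
  push_cast
  ring

theorem norm_fourierHat_le (h_nonneg : ∀ x, 0 ≤ h x) (h_int : ∫ x, h x = 1) (ω : ℝ) :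
    ‖fourierHat h ω‖ ≤ 1 := by
  rw [← h_int]
  refine (norm_integral_le_integral_norm _).trans_eq ?_
  refine integral_congr_ae (Eventually.of_forall fun x => ?_)
  have := norm_expChar ω x
  rw [expChar] at this
  simp only [norm_mul, this, one_mul, Complex.norm_real, Real.norm_of_nonneg (h_nonneg x)]

theorem one_sub_fourierHat_ne_zero (hm0 : 0 < m) (hm1 : m < 1) (h_nonneg : ∀ x, 0 ≤ h x)
    (h_int : ∫ x, h x = 1) (ω : ℝ) : 1 - (m : ℂ) * fourierHat h ω ≠ 0 := by
  intro hc
  have h1 := congrArg norm (sub_eq_zero.1 hc)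
  rw [norm_one, norm_mul, Complex.norm_real, Real.norm_of_nonneg hm0.le] at h1
  nlinarith [norm_fourierHat_le h_nonneg h_int ω]

theorem fourierHat_zero (h_int : ∫ x, h x = 1) : fourierHat h 0 = 1 := by
  simp only [fourierHat, zero_mul, Complex.ofReal_zero, mul_zero, Complex.exp_zero, one_mul]
  rw [integral_complex_ofReal, h_int, Complex.ofReal_one]

theorem fourierHat_neg (h : ℝ → ℝ) (ω : ℝ) :
    fourierHat h (-ω) = (starRingEnd ℂ) (fourierHat h ω) := by
  rw [fourierHat, fourierHat, ← integral_conj]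
  refine integral_congr_ae (Eventually.of_forall fun x => ?_)
  simp only [map_mul, ← Complex.exp_conj, map_neg, Complex.conj_I, Complex.conj_ofReal]
  push_cast
  ring_nf

end OffspringIntensity

section ClusterCumulant

variable {μ : Measure Offspring} [IsProbabilityMeasure μ] {m : ℝ} {h : ℝ → ℝ}

/-- Solves the three moment equations in turn. As the frequencies sum to zero, the coefficient of
the unknown in the third is `m ĥ(0) = m`, which accounts for the factor `(1 - m)⁻¹`, and each pair
sum is minus the remaining frequency. -/
theorem integral_clusterHat_mul_mul (hm0 : 0 < m) (hm1 : m < 1) (h_meas : Measurable h)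
    (h_nonneg : ∀ x, 0 ≤ h x) (h_int : ∫ x, h x = 1)
    (hμ : IsPoissonProcess μ offspringMeasure (offspringIntensity m h)) {θ : ℝ} (hθ : 0 < θ)
    (hf : ∀ᵐ z ∂(treeLaw μ), IsFiniteMeasure (cluster z))
    (he : Integrable (fun z => Real.exp (θ * (cluster z).real Set.univ)) (treeLaw μ))
    {ω₁ ω₂ ω₃ : ℝ} (h0 : ω₁ + ω₂ + ω₃ = 0) :
    ∫ z, clusterHat ω₁ z * clusterHat ω₂ z * clusterHat ω₃ z ∂(treeLaw μ) =
      (1 - (m : ℂ))⁻¹ * (R m h ω₁ * R m h ω₂ * R m h ω₃ *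
        (R m h (-ω₁) + R m h (-ω₂) + R m h (-ω₃) - 2)) := by
  have hΛ : IsFiniteMeasure (offspringIntensity m h) :=
    ⟨by rw [offspringIntensity_univ hm0 h_nonneg h_int]; exact ENNReal.ofReal_lt_top⟩
  have hB := isBranchingFunctional_clusterHat (μ := μ) hθ hf he
  have hl := integral_expChar_offspringIntensity hm0 h_meas h_nonneg
  have hne := one_sub_fourierHat_ne_zero hm0 hm1 h_nonneg h_int
  have hr : ∀ ω, ∫ z, clusterHat ω z ∂(treeLaw μ) = R m h ω := fun ω => by
    have := (hB ω).first_moment hμ rfl (hl ω)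
    rw [R, eq_div_iff (hne ω)]
    linear_combination this
  -- The identity `R m ĥ = R - 1`. Used at the three frequencies `-ωⱼ`, it turns the constant `1`
  -- into `1 - 3 = -2`.
  have h1r : ∀ ω, 1 + R m h ω * (m * fourierHat h ω) = R m h ω := fun ω => by
    rw [R]
    field_simp [hne ω]
    ring
  have hb : ∀ ω ω', ∫ z, clusterHat ω z * clusterHat ω' z ∂(treeLaw μ) =
      R m h ω * R m h ω' * R m h (ω + ω') := fun ω ω' => by
    have := (hB ω).second_moment hμ (hB ω') (hr ω) (hr ω') rfl (hl ω) (hl ω')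
      (by simp only [expChar_mul]; exact hl (ω + ω'))
    rw [h1r, h1r] at this
    rw [R.eq_1 m h (ω + ω'), mul_one_div, eq_div_iff (hne _)]
    linear_combination this
  have ht := (hB ω₁).third_moment hμ (hB ω₂) (hB ω₃) (hr ω₁) (hr ω₂) (hr ω₃) (hb ω₁ ω₂) (hb ω₁ ω₃)
    (hb ω₂ ω₃) rfl (hl ω₁) (hl ω₂) (hl ω₃) (by simp only [expChar_mul]; exact hl (ω₁ + ω₂))
    (by simp only [expChar_mul]; exact hl (ω₁ + ω₃))
    (by simp only [expChar_mul]; exact hl (ω₂ + ω₃))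
    (by simp only [expChar_mul]; exact hl (ω₁ + ω₂ + ω₃))
  rw [h0, fourierHat_zero h_int, h1r, h1r, h1r, show ω₁ + ω₂ = -ω₃ by linarith,
    show ω₁ + ω₃ = -ω₂ by linarith, show ω₂ + ω₃ = -ω₁ by linarith] at ht
  have e1 := h1r (-ω₁)
  have e2 := h1r (-ω₂)
  have e3 := h1r (-ω₃)
  have hm : (1 - (m : ℂ)) ≠ 0 := by
    rw [sub_ne_zero]
    exact_mod_cast hm1.ne'
  rw [eq_inv_mul_iff_mul_eq₀ hm]
  linear_combination ht + R m h ω₁ * R m h ω₂ * R m h ω₃ * (e1 + e2 + e3)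

end ClusterCumulant

/-! ### Differentiating exponential integrals in three parameters. -/

section ExponentialIntegral

variable {α : Type*} [MeasurableSpace α] {M : Measure α} {X : Fin 3 → α → ℝ} {r : ℝ}
  {w v : α → ℝ}

/-- The weight `w` has exponential moments of every order less than `r` with respect to `X`. -/
def HasExpMoments (M : Measure α) (X : Fin 3 → α → ℝ) (r : ℝ) (w : α → ℝ) : Prop :=
  ∀ r' < r, Integrable (fun a => w a * Real.exp (r' * ∑ j, |X j a|)) M

/-- The coordinate functionals on `ℝ³`. -/
noncomputable def coord (j : Fin 3) : (Fin 3 → ℝ) →L[ℝ] ℝ :=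
  ContinuousLinearMap.proj (R := ℝ) (φ := fun _ : Fin 3 => ℝ) j

theorem coord_apply (j : Fin 3) (s : Fin 3 → ℝ) : coord j s = s j := rfl

theorem norm_coord_le (j : Fin 3) : ‖coord j‖ ≤ 1 :=
  ContinuousLinearMap.opNorm_le_bound _ zero_le_one fun x => by
    simpa [coord_apply] using norm_le_pi_norm x j

theorem abs_le_sum_abs (X : Fin 3 → α → ℝ) (j : Fin 3) (a : α) : |X j a| ≤ ∑ j, |X j a| :=
  Finset.single_le_sum (f := fun j => |X j a|) (fun _ _ => abs_nonneg _) (Finset.mem_univ j)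

theorem abs_sum_mul_le (X : Fin 3 → α → ℝ) (s : Fin 3 → ℝ) (a : α) :
    |∑ j, s j * X j a| ≤ ‖s‖ * ∑ j, |X j a| := by
  rw [Finset.mul_sum]
  refine (Finset.abs_sum_le_sum_abs _ _).trans (Finset.sum_le_sum fun j _ => ?_)
  rw [abs_mul]
  exact mul_le_mul_of_nonneg_right (norm_le_pi_norm s j) (abs_nonneg _)

theorem measurable_exp_sum_mul (hX : ∀ j, Measurable (X j)) (s : Fin 3 → ℝ) :
    Measurable fun a => Real.exp (∑ j, s j * X j a) :=
  Real.measurable_exp.comp (Finset.measurable_sum _ fun j _ => (hX j).const_mul (s j))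

/-- A factor `X j` is absorbed by a slightly larger exponent `q < r`, since `S ≤ exp ((q - r') S) /
(q - r')`. The class of weights is thus stable under the differentiations below. -/
theorem HasExpMoments.mul (hX : ∀ j, Measurable (X j)) (hw : Measurable w)
    (h : HasExpMoments M X r w) (j : Fin 3) : HasExpMoments M X r fun a => w a * X j a := by
  intro r' hr'
  obtain ⟨q, hq, hqr⟩ := exists_between hr'
  have hS : Measurable fun a => ∑ j, |X j a| :=
    Finset.measurable_sum _ fun j _ => measurable_abs.comp (hX j)
  refine ((h q hqr).norm.const_mul (1 / (q - r'))).mono'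
    ((hw.mul (hX j)).mul (Real.measurable_exp.comp (hS.const_mul r'))).aestronglyMeasurable
    (Eventually.of_forall fun a => ?_)
  have h1 := abs_le_sum_abs X j a
  generalize ∑ j, |X j a| = S at h1 ⊢
  have h2 : (q - r') * S ≤ Real.exp ((q - r') * S) := by
    linarith [Real.add_one_le_exp ((q - r') * S)]
  have hpos : 0 < q - r' := sub_pos.2 hq
  have h3 : |X j a| ≤ 1 / (q - r') * Real.exp ((q - r') * S) := by
    refine h1.trans ?_
    rw [one_div, le_inv_mul_iff₀ hpos]
    exact h2
  have h4 : Real.exp (q * S) = Real.exp ((q - r') * S) * Real.exp (r' * S) := by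
    rw [← Real.exp_add]; ring_nf
  simp only [norm_mul, Real.norm_eq_abs, Real.abs_exp]
  rw [h4]
  calc |w a| * |X j a| * Real.exp (r' * S)
      ≤ |w a| * (1 / (q - r') * Real.exp ((q - r') * S)) * Real.exp (r' * S) := by gcongr
    _ = _ := by ring

theorem HasExpMoments.integrable (hX : ∀ j, Measurable (X j)) (hw : Measurable w)
    (h : HasExpMoments M X r w) {s : Fin 3 → ℝ} (hs : ‖s‖ < r) :
    Integrable (fun a => w a * Real.exp (∑ j, s j * X j a)) M := by
  refine (h ‖s‖ hs).norm.mono' (hw.mul (measurable_exp_sum_mul hX s)).aestronglyMeasurable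
    (Eventually.of_forall fun a => ?_)
  simp only [norm_mul, Real.norm_eq_abs, Real.abs_exp]
  gcongr
  exact (le_abs_self _).trans (abs_sum_mul_le X s a)

theorem hasFDerivAt_exp_sum_mul (X : Fin 3 → α → ℝ) (w v : α → ℝ) (a : α) (s : Fin 3 → ℝ) :
    HasFDerivAt (fun s : Fin 3 → ℝ => w a * Real.exp (∑ j, s j * X j a) - v a)
      (∑ j, (w a * X j a * Real.exp (∑ j, s j * X j a)) •
        coord j) s := by
  have h1 : HasFDerivAt (fun s : Fin 3 → ℝ => ∑ j, s j * X j a)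
      (∑ j, X j a • coord j) s :=
    HasFDerivAt.fun_sum fun j _ => (hasFDerivAt_apply j s).mul_const (X j a)
  have e : ∑ j, (w a * X j a * Real.exp (∑ j, s j * X j a)) • coord j =
      w a • Real.exp (∑ j, s j * X j a) • ∑ j, X j a • coord j := by
    rw [Finset.smul_sum, Finset.smul_sum]
    refine Finset.sum_congr rfl fun j _ => ?_
    rw [smul_smul, smul_smul]
    congr 1
    ring
  rw [e]
  exact (h1.exp.const_mul (w a)).sub_const (v a)

/-- The measure may be infinite, and then the bare exponential is not integrable. Subtracting `v`
covers both uses: `w = v = 1` for the generating functional and `v = 0` for its derivatives. -/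
theorem hasFDerivAt_integral_exp (hX : ∀ j, Measurable (X j)) (hw : Measurable w)
    (hv : Measurable v) (h : ∀ j, HasExpMoments M X r fun a => w a * X j a)
    (hi : ∀ s : Fin 3 → ℝ, ‖s‖ < r →
      Integrable (fun a => w a * Real.exp (∑ j, s j * X j a) - v a) M)
    {s : Fin 3 → ℝ} (hs : ‖s‖ < r) :
    HasFDerivAt (fun s : Fin 3 → ℝ => ∫ a, (w a * Real.exp (∑ j, s j * X j a) - v a) ∂M)
      (∑ j, (∫ a, w a * X j a * Real.exp (∑ j, s j * X j a) ∂M) •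
        coord j) s := by
  obtain ⟨q, hq, hqr⟩ := exists_between hs
  have hinteg : ∀ j, Integrable (fun a => (w a * X j a * Real.exp (∑ j, s j * X j a)) •
      coord j) M := fun j =>
    ((h j).integrable hX (hw.mul (hX j)) hs).smul_const _
  have hball : Metric.ball (0 : Fin 3 → ℝ) q ∈ 𝓝 s :=
    Metric.isOpen_ball.mem_nhds (by simpa using hq)
  have hbound : ∀ a, ∀ t ∈ Metric.ball (0 : Fin 3 → ℝ) q,
      ‖∑ j, (w a * X j a * Real.exp (∑ j, t j * X j a)) • coord j‖ ≤
        ∑ j, ‖w a * X j a * Real.exp (q * ∑ j, |X j a|)‖ := fun a t ht => by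
    refine (norm_sum_le _ _).trans (Finset.sum_le_sum fun j _ => ?_)
    have ht' : ‖t‖ ≤ q := by simpa using (Metric.mem_ball.1 ht).le
    have h0 : 0 ≤ ∑ j, |X j a| := Finset.sum_nonneg fun j _ => abs_nonneg _
    have h1 : ∑ j, t j * X j a ≤ q * ∑ j, |X j a| :=
      (le_abs_self _).trans ((abs_sum_mul_le X t a).trans (mul_le_mul_of_nonneg_right ht' h0))
    rw [norm_smul]
    refine (mul_le_of_le_one_right (norm_nonneg _) (norm_coord_le j)).trans ?_
    rw [norm_mul, norm_mul (w a * X j a), Real.norm_of_nonneg (Real.exp_pos _).le,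
      Real.norm_of_nonneg (Real.exp_pos _).le]
    exact mul_le_mul_of_nonneg_left (Real.exp_le_exp.2 h1) (norm_nonneg _)
  have hmeas : ∀ t : Fin 3 → ℝ, AEStronglyMeasurable
      (fun a => w a * Real.exp (∑ j, t j * X j a) - v a) M := fun t =>
    ((hw.mul (measurable_exp_sum_mul hX t)).sub hv).aestronglyMeasurable
  have hmeas' : AEStronglyMeasurable
      (fun a => ∑ j, (w a * X j a * Real.exp (∑ j, s j * X j a)) • coord j) M :=
    Finset.aestronglyMeasurable_fun_sum Finset.univ
      (f := fun j a => (w a * X j a * Real.exp (∑ j, s j * X j a)) • coord j)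
      fun j _ => (hinteg j).aestronglyMeasurable
  have hbi : Integrable (fun a => ∑ j, ‖w a * X j a * Real.exp (q * ∑ j, |X j a|)‖) M :=
    integrable_finsetSum Finset.univ
      (f := fun j a => ‖w a * X j a * Real.exp (q * ∑ j, |X j a|)‖) fun j _ => (h j q hqr).norm
  have key := hasFDerivAt_integral_of_dominated_of_fderiv_le (μ := M) (x₀ := s)
    (F := fun (s : Fin 3 → ℝ) a => w a * Real.exp (∑ j, s j * X j a) - v a)
    (F' := fun s a => ∑ j, (w a * X j a * Real.exp (∑ j, s j * X j a)) • coord j) hball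
    (Eventually.of_forall hmeas) (hi s hs) hmeas'
    (Eventually.of_forall hbound) hbi
    (Eventually.of_forall fun a t _ => hasFDerivAt_exp_sum_mul X w v a t)
  have e : ∫ a, ∑ j, (w a * X j a * Real.exp (∑ j, s j * X j a)) • coord j ∂M =
      ∑ j, (∫ a, w a * X j a * Real.exp (∑ j, s j * X j a) ∂M) • coord j := by
    rw [integral_finsetSum Finset.univ
      (f := fun j a => (w a * X j a * Real.exp (∑ j, s j * X j a)) • coord j) fun j _ => hinteg j]
    exact Finset.sum_congr rfl fun j _ => integral_smul_const _ _
  rw [e] at key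
  exact key

theorem HasExpMoments.hasFDerivAt (hX : ∀ j, Measurable (X j)) (hw : Measurable w)
    (h : HasExpMoments M X r w) {s : Fin 3 → ℝ} (hs : ‖s‖ < r) :
    HasFDerivAt (fun s : Fin 3 → ℝ => ∫ a, w a * Real.exp (∑ j, s j * X j a) ∂M)
      (∑ j, (∫ a, w a * X j a * Real.exp (∑ j, s j * X j a) ∂M) •
        coord j) s := by
  simpa using hasFDerivAt_integral_exp (v := 0) hX hw measurable_zero (fun j => h.mul hX hw j)
    (fun s hs => by simpa using h.integrable hX hw hs) hs

theorem contDiffOn_succ_of_hasFDerivAt {F : (Fin 3 → ℝ) → ℝ} {G : Fin 3 → (Fin 3 → ℝ) → ℝ} (n : ℕ)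
    (hF : ∀ s, ‖s‖ < r → HasFDerivAt F (∑ j, G j s •
      coord j) s)
    (hG : ∀ j, ContDiffOn ℝ n (G j) (Metric.ball 0 r)) :
    ContDiffOn ℝ (n + 1 : ℕ) F (Metric.ball 0 r) := by
  push_cast
  refine (contDiffOn_succ_iff_fderiv_of_isOpen Metric.isOpen_ball).2 ⟨fun s hs =>
    (hF s (by simpa using hs)).differentiableAt.differentiableWithinAt, by simp, ?_⟩
  have : ContDiffOn ℝ n (fun s => ∑ j, G j s •
      coord j) (Metric.ball 0 r) :=
    ContDiffOn.sum fun j _ => (hG j).smul contDiffOn_const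
  exact this.congr fun s hs => (hF s (by simpa using hs)).fderiv

/-- Each partial derivative is an integral of the same kind with weight `w * X j`, so smoothness
follows by induction over all weights. -/
theorem HasExpMoments.contDiffOn (hX : ∀ j, Measurable (X j)) (n : ℕ) :
    ∀ {w : α → ℝ}, Measurable w → HasExpMoments M X r w →
    ContDiffOn ℝ n (fun s : Fin 3 → ℝ => ∫ a, w a * Real.exp (∑ j, s j * X j a) ∂M)
      (Metric.ball 0 r) := by
  induction n with
  | zero =>
    intro w hw h
    exact contDiffOn_zero.2 fun s hs =>
      (h.hasFDerivAt hX hw (by simpa using hs)).continuousAt.continuousWithinAt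
  | succ n ih =>
    intro w hw h
    exact contDiffOn_succ_of_hasFDerivAt n (fun s hs => h.hasFDerivAt hX hw hs)
      fun j => ih (hw.mul (hX j)) (h.mul hX hw j)

/-- Uses `|exp y - 1| ≤ |y| exp |y|`, so that a factor `X j` is always present and moments weighted
by `X j` suffice. -/
theorem integrable_exp_sum_mul_sub_one (hX : ∀ j, Measurable (X j))
    (h : ∀ j, HasExpMoments M X r (X j)) {s : Fin 3 → ℝ} (hs : ‖s‖ < r) :
    Integrable (fun a => Real.exp (∑ j, s j * X j a) - 1) M := by
  have hi : Integrable (fun a => ∑ j, ‖s‖ * ‖X j a * Real.exp (‖s‖ * ∑ j, |X j a|)‖) M :=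
    integrable_finsetSum _ fun j _ => ((h j _ hs).norm.const_mul _)
  refine hi.mono' ((measurable_exp_sum_mul hX s).sub_const 1).aestronglyMeasurable
    (Eventually.of_forall fun a => ?_)
  have h1 := abs_sum_mul_le X s a
  simp only [norm_mul, Real.norm_eq_abs, Real.abs_exp]
  rw [← Finset.mul_sum, ← Finset.sum_mul, ← mul_assoc]
  generalize ∑ j, s j * X j a = y at h1 ⊢
  refine (?_ : _ ≤ |y| * Real.exp |y|).trans (mul_le_mul h1 (Real.exp_le_exp.2 h1)
    (Real.exp_pos _).le ((abs_nonneg _).trans h1))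
  have e1 : Real.exp (-|y|) * Real.exp |y| = 1 := by rw [← Real.exp_add]; simp
  have e2 := Real.add_one_le_exp (-|y|)
  have e3 := Real.exp_pos |y|
  have e4 : Real.exp |y| - 1 ≤ |y| * Real.exp |y| := by nlinarith
  have e5 := Real.exp_le_exp.2 (le_abs_self y)
  have e6 := Real.add_one_le_exp y
  have e7 := neg_abs_le y
  have e8 : |y| ≤ |y| * Real.exp |y| :=
    le_mul_of_one_le_right (abs_nonneg _) (Real.one_le_exp (abs_nonneg _))
  exact abs_le.2 ⟨by linarith, by linarith⟩

theorem hasFDerivAt_integral_exp_sub_one (hX : ∀ j, Measurable (X j))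
    (h : ∀ j, HasExpMoments M X r (X j)) {s : Fin 3 → ℝ} (hs : ‖s‖ < r) :
    HasFDerivAt (fun s : Fin 3 → ℝ => ∫ a, (Real.exp (∑ j, s j * X j a) - 1) ∂M)
      (∑ j, (∫ a, X j a * Real.exp (∑ j, s j * X j a) ∂M) •
        coord j) s := by
  simpa using hasFDerivAt_integral_exp (w := 1) (v := 1) hX measurable_one measurable_one
    (fun j => by simpa using h j)
    (fun s hs => by simpa using integrable_exp_sum_mul_sub_one hX h hs) hs

theorem contDiffAt_integral_exp_sub_one (hX : ∀ j, Measurable (X j)) (hr : 0 < r)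
    (h : ∀ j, HasExpMoments M X r (X j)) (n : ℕ) :
    ContDiffAt ℝ n (fun s : Fin 3 → ℝ => ∫ a, (Real.exp (∑ j, s j * X j a) - 1) ∂M) 0 :=
  ((contDiffOn_succ_of_hasFDerivAt n (fun _ hs => hasFDerivAt_integral_exp_sub_one hX h hs)
    fun j => (h j).contDiffOn hX n (hX j)).contDiffAt (Metric.ball_mem_nhds _ hr)).of_le
      (by exact_mod_cast n.le_succ)

theorem hasDerivAt_comp_of_hasFDerivAt_sum {F : (Fin 3 → ℝ) → ℝ} {g : Fin 3 → ℝ} {c : ℝ → Fin 3 → ℝ}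
    {t : ℝ} {j : Fin 3} (hF : HasFDerivAt F (∑ j, g j •
      coord j) (c t))
    (hc : HasDerivAt c (Pi.single j 1) t) : HasDerivAt (fun t => F (c t)) (g j) t := by
  have := hF.comp_hasDerivAt t hc
  have e : (∑ j, g j • coord j) (Pi.single j 1) = g j := by
    simp [coord_apply, Pi.single_apply]
  rw [e] at this
  exact this

theorem hasDerivAt_vec_zero (y z t : ℝ) :
    HasDerivAt (fun x : ℝ => ![x, y, z]) (Pi.single 0 1) t := by
  rw [hasDerivAt_pi]
  intro i
  fin_cases i <;> simp [hasDerivAt_id', hasDerivAt_const]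

theorem hasDerivAt_vec_one (x z t : ℝ) :
    HasDerivAt (fun y : ℝ => ![x, y, z]) (Pi.single 1 1) t := by
  rw [hasDerivAt_pi]
  intro i
  fin_cases i <;> simp [hasDerivAt_id', hasDerivAt_const]

theorem hasDerivAt_vec_two (x y t : ℝ) :
    HasDerivAt (fun z : ℝ => ![x, y, z]) (Pi.single 2 1) t := by
  rw [hasDerivAt_pi]
  intro i
  fin_cases i <;> simp [hasDerivAt_id', hasDerivAt_const]

theorem norm_vec_lt (hr : 0 < r) {x y z : ℝ} (hx : |x| < r) (hy : |y| < r) (hz : |z| < r) :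
    ‖![x, y, z]‖ < r := by
  rw [pi_norm_lt_iff hr]
  intro i
  fin_cases i <;> simpa

theorem eventually_abs_lt_of_pos (hr : 0 < r) : ∀ᶠ t : ℝ in 𝓝 0, |t| < r := by
  filter_upwards [Metric.ball_mem_nhds (0 : ℝ) hr] with t ht
  simpa using ht

/-- Each differentiation brings down one factor. The innermost formulas must hold for all nearby
values of the outer parameters, whence the statements on the ball of radius `r`. -/
theorem deriv_deriv_deriv_eq (hX : ∀ j, Measurable (X j)) (hr : 0 < r)
    (h : ∀ j, HasExpMoments M X r (X j)) {G : (Fin 3 → ℝ) → ℝ}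
    (hG : ∀ s : Fin 3 → ℝ, ‖s‖ < r → G s = ∫ a, (Real.exp (∑ j, s j * X j a) - 1) ∂M) :
    deriv (fun s₀ => deriv (fun s₁ => deriv (fun s₂ => G ![s₀, s₁, s₂]) 0) 0) 0 =
      ∫ a, X 0 a * X 1 a * X 2 a ∂M := by
  have h0 : |(0 : ℝ)| < r := by simpa
  have hev := eventually_abs_lt_of_pos hr
  have d2 : ∀ x y : ℝ, |x| < r → |y| < r → deriv (fun s₂ => G ![x, y, s₂]) 0 =
      ∫ a, X 2 a * Real.exp (∑ j, ![x, y, 0] j * X j a) ∂M := fun x y hx hy => by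
    have he : (fun s₂ => G ![x, y, s₂]) =ᶠ[𝓝 0]
        fun z => ∫ a, (Real.exp (∑ j, ![x, y, z] j * X j a) - 1) ∂M :=
      hev.mono fun z hz => hG _ (norm_vec_lt hr hx hy hz)
    rw [he.deriv_eq]
    exact (hasDerivAt_comp_of_hasFDerivAt_sum
      (F := fun s => ∫ a, (Real.exp (∑ j, s j * X j a) - 1) ∂M)
      (g := fun i => ∫ a, X i a * Real.exp (∑ j, ![x, y, 0] j * X j a) ∂M)
      (c := fun z => ![x, y, z]) (hasFDerivAt_integral_exp_sub_one hX h
      (norm_vec_lt hr hx hy h0)) (hasDerivAt_vec_two x y 0)).deriv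
  have d1 : ∀ x : ℝ, |x| < r → deriv (fun s₁ => deriv (fun s₂ => G ![x, s₁, s₂]) 0) 0 =
      ∫ a, X 2 a * X 1 a * Real.exp (∑ j, ![x, 0, 0] j * X j a) ∂M := fun x hx => by
    have he : (fun s₁ => deriv (fun s₂ => G ![x, s₁, s₂]) 0) =ᶠ[𝓝 0]
        fun y => ∫ a, X 2 a * Real.exp (∑ j, ![x, y, 0] j * X j a) ∂M :=
      hev.mono fun y hy => d2 x y hx hy
    rw [he.deriv_eq]
    exact (hasDerivAt_comp_of_hasFDerivAt_sum
      (F := fun s => ∫ a, X 2 a * Real.exp (∑ j, s j * X j a) ∂M)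
      (g := fun i => ∫ a, X 2 a * X i a * Real.exp (∑ j, ![x, 0, 0] j * X j a) ∂M)
      (c := fun y => ![x, y, 0]) ((h 2).hasFDerivAt hX (hX 2)
      (norm_vec_lt hr hx h0 h0)) (hasDerivAt_vec_one x 0 0)).deriv
  have he : (fun s₀ => deriv (fun s₁ => deriv (fun s₂ => G ![s₀, s₁, s₂]) 0) 0) =ᶠ[𝓝 0]
      fun x => ∫ a, X 2 a * X 1 a * Real.exp (∑ j, ![x, 0, 0] j * X j a) ∂M :=
    hev.mono fun x hx => d1 x hx
  rw [he.deriv_eq, (hasDerivAt_comp_of_hasFDerivAt_sum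
      (F := fun s => ∫ a, X 2 a * X 1 a * Real.exp (∑ j, s j * X j a) ∂M)
      (g := fun i => ∫ a, X 2 a * X 1 a * X i a * Real.exp (∑ j, ![(0 : ℝ), 0, 0] j * X j a) ∂M)
      (c := fun x => ![x, 0, 0]) (((h 2).mul hX (hX 2) 1).hasFDerivAt hX
      (w := fun a => X 2 a * X 1 a) ((hX 2).mul (hX 1)) (norm_vec_lt hr h0 h0 h0))
      (hasDerivAt_vec_zero 0 0 0)).deriv]
  refine integral_congr_ae (Eventually.of_forall fun a => ?_)
  simp [Fin.sum_univ_three]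
  ring

end ExponentialIntegral

/-! ### Transfer to the canonical space of points and forests. -/

/-- The defining conditions involve only the joint law of the counts, which is unchanged by passing
to the image measure. -/
theorem IsPoissonProcess.map_measure {Ω Ω' : Type*} [MeasurableSpace Ω] [MeasurableSpace Ω']
    {P : Measure Ω} [IsProbabilityMeasure P] {T : Ω → Ω'} (hT : Measurable T)
    {ξ : Ω' → Measure ℝ} (hm : Measurable ξ) {Λ : Measure ℝ}
    (hξ : IsPoissonProcess P (fun ω => ξ (T ω)) Λ) : IsPoissonProcess (P.map T) ξ Λ := by
  have hmA : ∀ A : Set ℝ, MeasurableSet A → Measurable fun ω => ξ ω A := fun A hA =>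
    (Measure.measurable_coe hA).comp hm
  have := Measure.isProbabilityMeasure_map (μ := P) hT.aemeasurable
  refine ⟨fun A hA hΛ => ?_, fun n A hA hd => ?_⟩
  · rw [Measure.map_map (hmA A hA) hT]
    exact hξ.count_law A hA hΛ
  · have h := (iIndepFun_iff_map_fun_eq_pi_map
      (fun i => ((hmA _ (hA i)).comp hT).aemeasurable)).1 (hξ.count_indep n A hA hd)
    rw [iIndepFun_iff_map_fun_eq_pi_map fun i => (hmA _ (hA i)).aemeasurable,
      Measure.map_map (measurable_pi_lambda _ fun i => hmA _ (hA i)) hT]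
    simp only [Measure.map_map (hmA _ (hA _)) hT]
    exact h

/-- The point process with points `u j`. -/
noncomputable def points (u : ℕ → ℝ) : Measure ℝ := Measure.sum fun j => Measure.dirac (u j)

theorem measurable_points : Measurable points := by
  refine Measure.measurable_of_measurable_coe _ fun A hA => ?_
  simp only [points, Measure.sum_apply _ hA]
  exact Measurable.tsum fun j =>
    (Measure.measurable_coe hA).comp (Measure.measurable_dirac.comp (measurable_pi_apply j))

theorem map_forest {Ω : Type*} [MeasurableSpace Ω] {P : Measure Ω} [IsProbabilityMeasure P]
    {Z : ℕ → List ℕ → Ω → Offspring} (hZ : ∀ j v, Measurable (Z j v))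
    (hid : ∀ j v, IdentDistrib (Z j v) (Z 0 []) P P)
    (hind : iIndepFun (fun (p : ℕ × List ℕ) ω => Z p.1 p.2 ω) P)
    [IsProbabilityMeasure (P.map (Z 0 []))] :
    P.map (fun ω j v => Z j v ω) = forestLaw (P.map (Z 0 [])) := by
  have h1 := hind.map_fun_eq_infinitePi_map fun p : ℕ × List ℕ => hZ p.1 p.2
  have h2 : (fun p : ℕ × List ℕ => P.map (fun ω => Z p.1 p.2 ω)) = fun _ => P.map (Z 0 []) :=
    funext fun p => (hid p.1 p.2).map_eq
  rw [h2] at h1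
  have h3 : forestLaw (P.map (Z 0 [])) = (Measure.infinitePi fun _ : ℕ × List ℕ =>
      P.map (Z 0 [])).map (MeasurableEquiv.curry ℕ (List ℕ) Offspring) :=
    (Measure.infinitePi_map_curry fun _ _ => P.map (Z 0 [])).symm
  have h4 : Measurable fun ω (p : ℕ × List ℕ) => Z p.1 p.2 ω :=
    measurable_pi_lambda _ fun p => hZ p.1 p.2
  rw [h3, ← h1, Measure.map_map (by fun_prop) h4]
  rfl

/-- The sum of `f` over the cluster with family tree `z` translated by `u`, as a function of
`(u, z)`. -/
noncomputable def shiftSum (f : ℝ → ℝ) (p : ℝ × FamilyTree) : ℝ :=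
  ∫ x, f (x + p.1) ∂(cluster p.2)

/-! ### Sums over a translated cluster. -/

section ShiftSum

variable {f g : ℝ → ℝ}

theorem measurable_shiftSum (hf : Measurable f) : Measurable (shiftSum f) := by
  have h := StronglyMeasurable.integral_kernel_prod_right'
    (κ := Kernel.prodMkLeft ℝ clusterKernel)
    (f := fun q : (ℝ × FamilyTree) × ℝ => f (q.2 + q.1.1))
    (hf.comp (by fun_prop)).stronglyMeasurable
  simp only [Kernel.prodMkLeft_apply, clusterKernel_apply] at h
  exact h.measurable

theorem shiftSum_abs_nonneg (f : ℝ → ℝ) (p : ℝ × FamilyTree) : 0 ≤ shiftSum (fun x => |f x|) p :=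
  integral_nonneg fun _ => abs_nonneg _

theorem abs_shiftSum_le (f : ℝ → ℝ) (p : ℝ × FamilyTree) :
    |shiftSum f p| ≤ shiftSum (fun x => |f x|) p :=
  norm_integral_le_integral_norm (μ := cluster p.2) fun x => f (x + p.1)

theorem integrable_shift (hf : Measurable f) {c : ℝ} (hc : ∀ x, |f x| ≤ c) {z : FamilyTree}
    (hz : IsFiniteMeasure (cluster z)) (u : ℝ) : Integrable (fun x => f (x + u)) (cluster z) :=
  Integrable.of_bound (hf.comp (by fun_prop)).aestronglyMeasurable c
    (Eventually.of_forall fun _ => hc _)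

theorem shiftSum_abs_le (hf : Measurable f) {c : ℝ} (hc : ∀ x, |f x| ≤ c) {p : ℝ × FamilyTree}
    (hz : IsFiniteMeasure (cluster p.2)) :
    shiftSum (fun x => |f x|) p ≤ c * (cluster p.2).real Set.univ := by
  have h := integral_mono (integrable_shift hf hc hz p.1).abs (integrable_const c)
    (fun x => hc (x + p.1))
  rw [integral_const, smul_eq_mul, mul_comm] at h
  exact h

theorem shiftSum_sum_mul {f : Fin 3 → ℝ → ℝ} (hf : ∀ j, Measurable (f j))
    (hc : ∀ j, ∃ c : ℝ, ∀ x, |f j x| ≤ c) (s : Fin 3 → ℝ) {p : ℝ × FamilyTree}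
    (hz : IsFiniteMeasure (cluster p.2)) :
    shiftSum (fun x => ∑ j, s j * f j x) p = ∑ j, s j * shiftSum (f j) p := by
  simp only [shiftSum]
  rw [integral_finsetSum]
  · simp only [integral_const_mul]
  · intro j _
    obtain ⟨c, hc⟩ := hc j
    exact (integrable_shift (hf j) hc hz p.1).const_mul _

theorem ofReal_shiftSum_abs_eq (hf : Measurable f) {c : ℝ} (hc : ∀ x, |f x| ≤ c)
    {p : ℝ × FamilyTree} (hz : IsFiniteMeasure (cluster p.2)) :
    ENNReal.ofReal (shiftSum (fun x => |f x|) p) = ∫⁻ x, ‖f (x + p.1)‖ₑ ∂(cluster p.2) := by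
  rw [shiftSum, ofReal_integral_eq_lintegral_ofReal (integrable_shift hf hc hz p.1).abs
    (Eventually.of_forall fun x => abs_nonneg _)]
  refine lintegral_congr fun x => ?_
  rw [← Real.norm_eq_abs, ofReal_norm]

variable {μ : Measure Offspring} [IsProbabilityMeasure μ]

theorem ae_prod_isFiniteMeasure (hfin : ∀ᵐ z ∂(treeLaw μ), IsFiniteMeasure (cluster z)) :
    ∀ᵐ p ∂((volume : Measure ℝ).prod (treeLaw μ)), IsFiniteMeasure (cluster p.2) :=
  Measure.quasiMeasurePreserving_snd.ae hfin

/-- By translation invariance every individual contributes the same amount `∫ |f|`, whatever its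
position. -/
theorem lintegral_enorm_shift (hf : Measurable f) (z : FamilyTree) :
    ∫⁻ u, ∫⁻ x, ‖f (x + u)‖ₑ ∂(cluster z) = cluster z Set.univ * ∫⁻ x, ‖f x‖ₑ := by
  have : SFinite (cluster z) := by
    rw [← clusterKernel_apply]
    infer_instance
  rw [lintegral_lintegral_swap (hf.comp (by fun_prop)).enorm.aemeasurable]
  simp only [lintegral_add_left_eq_self (μ := (volume : Measure ℝ)) (fun y => ‖f y‖ₑ),
    lintegral_const, mul_comm]

/-- Integrating over the translation first leaves the cluster size times `η` times `∫ |f|`.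
Integrability over an infinite translation-invariant measure thus reduces to a moment of the cluster
size. -/
theorem integrable_shiftSum_abs_mul (hf : Measurable f) {c : ℝ} (hc : ∀ x, |f x| ≤ c)
    (hi : Integrable f) (hfin : ∀ᵐ z ∂(treeLaw μ), IsFiniteMeasure (cluster z))
    {η : FamilyTree → ℝ} (hη : Measurable η)
    (hκ : Integrable (fun z => (cluster z).real Set.univ * η z) (treeLaw μ)) :
    Integrable (fun p => shiftSum (fun x => |f x|) p * η p.2)
      ((volume : Measure ℝ).prod (treeLaw μ)) := by
  have hm : Measurable fun p => shiftSum (fun x => |f x|) p * η p.2 :=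
    (measurable_shiftSum hf.abs).mul (hη.comp measurable_snd)
  refine ⟨hm.aestronglyMeasurable, ?_⟩
  rw [hasFiniteIntegral_iff_enorm, lintegral_prod_symm _ hm.enorm.aemeasurable]
  have h1 : ∀ᵐ z ∂(treeLaw μ), ∫⁻ u, ‖shiftSum (fun x => |f x|) (u, z) * η z‖ₑ =
      ‖(cluster z).real Set.univ * η z‖ₑ * ∫⁻ x, ‖f x‖ₑ := by
    filter_upwards [hfin] with z hz
    have e : ∀ u, ‖shiftSum (fun x => |f x|) (u, z) * η z‖ₑ =
        (∫⁻ x, ‖f (x + u)‖ₑ ∂(cluster z)) * ‖η z‖ₑ := fun u => by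
      rw [enorm_mul, ← ofReal_shiftSum_abs_eq hf hc (p := (u, z)) hz,
        Real.enorm_of_nonneg (shiftSum_abs_nonneg f _)]
    simp only [e]
    rw [lintegral_mul_const' _ _ (by simp), lintegral_enorm_shift hf, enorm_mul,
      Real.enorm_of_nonneg measureReal_nonneg, Measure.real, ENNReal.ofReal_toReal
      (measure_ne_top _ _)]
    ring
  rw [lintegral_congr_ae h1, lintegral_mul_const' _ _ hi.2.ne]
  exact ENNReal.mul_lt_top hκ.2 hi.2

theorem integrable_cluster_mul_exp {θ q : ℝ} (hq : q < θ)
    (he : Integrable (fun z => Real.exp (θ * (cluster z).real Set.univ)) (treeLaw μ)) :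
    Integrable (fun z => (cluster z).real Set.univ * Real.exp (q * (cluster z).real Set.univ))
      (treeLaw μ) := by
  have hm := measurable_cluster_real
  refine (he.const_mul (1 / (θ - q))).mono' (by fun_prop) (Eventually.of_forall fun z => ?_)
  have h0 : 0 ≤ (cluster z).real Set.univ := measureReal_nonneg
  generalize (cluster z).real Set.univ = k at h0 ⊢
  have hpos : 0 < θ - q := sub_pos.2 hq
  have h1 := Real.add_one_le_exp ((θ - q) * k)
  have h2 : Real.exp (θ * k) = Real.exp ((θ - q) * k) * Real.exp (q * k) := by
    rw [← Real.exp_add]; ring_nf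
  rw [Real.norm_of_nonneg (by positivity), h2, ← mul_assoc]
  refine mul_le_mul_of_nonneg_right ?_ (Real.exp_pos _).le
  rw [one_div, le_inv_mul_iff₀ hpos]
  linarith

/-- Sums of bounded integrable functions over a translated cluster have exponential moments with
respect to the translation-invariant measure. -/
theorem hasExpMoments_shiftSum {f : Fin 3 → ℝ → ℝ} (hf : ∀ j, Measurable (f j)) {c : Fin 3 → ℝ}
    (hc : ∀ j x, |f j x| ≤ c j) (hi : ∀ j, Integrable (f j))
    (hfin : ∀ᵐ z ∂(treeLaw μ), IsFiniteMeasure (cluster z)) {θ r : ℝ} (hθ : 0 < θ)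
    (hr : r * ∑ j, c j ≤ θ) (hc0 : 0 < ∑ j, c j)
    (he : Integrable (fun z => Real.exp (θ * (cluster z).real Set.univ)) (treeLaw μ)) (j : Fin 3) :
    HasExpMoments ((volume : Measure ℝ).prod (treeLaw μ)) (fun j => shiftSum (f j)) r
      (shiftSum (f j)) := by
  intro r' hr'
  -- The definition of `HasExpMoments` allows negative `r'`; replacing it by `max r' 0` gives an
  -- upper bound in every case.
  have hq : max r' 0 * ∑ j, c j < θ := by
    rcases le_total r' 0 with h | h
    · rw [max_eq_right h, zero_mul]
      exact hθ
    · rw [max_eq_left h]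
      exact (mul_lt_mul_of_pos_right hr' hc0).trans_le hr
  have hm := measurable_cluster_real
  refine (integrable_shiftSum_abs_mul (hf j) (hc j) (hi j) hfin
    (η := fun z => Real.exp ((max r' 0 * ∑ j, c j) * (cluster z).real Set.univ)) (by fun_prop)
    (integrable_cluster_mul_exp hq he)).mono' ?_ ?_
  · exact ((measurable_shiftSum (hf j)).mul (Real.measurable_exp.comp
      ((Finset.measurable_sum _ fun i _ => (measurable_shiftSum (hf i)).abs).const_mul
        r'))).aestronglyMeasurable
  · filter_upwards [ae_prod_isFiniteMeasure hfin] with p hp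
    rw [norm_mul, Real.norm_of_nonneg (Real.exp_pos _).le]
    refine mul_le_mul (abs_shiftSum_le _ _) (Real.exp_le_exp.2 ?_) (Real.exp_pos _).le
      (shiftSum_abs_nonneg _ _)
    have h0 : 0 ≤ ∑ i, |shiftSum (f i) p| := Finset.sum_nonneg fun _ _ => abs_nonneg _
    refine (mul_le_mul_of_nonneg_right (le_max_left r' 0) h0).trans ?_
    rw [mul_assoc]
    refine mul_le_mul_of_nonneg_left ?_ (le_max_right _ _)
    rw [Finset.sum_mul]
    exact Finset.sum_le_sum fun i _ =>
      (abs_shiftSum_le _ _).trans (shiftSum_abs_le (hf i) (hc i) hp)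

end ShiftSum

/-- The mean of `exp` of the sum of `f` over a cluster translated by `u`. -/
noncomputable def clusterMGF (μ : Measure Offspring) [IsProbabilityMeasure μ] (f : ℝ → ℝ)
    (u : ℝ) : ℝ :=
  ∫ z, Real.exp (shiftSum f (u, z)) ∂(treeLaw μ)

/-! ### Bounds for the logarithm of the cluster moment generating function. -/

section ClusterMGF

variable {μ : Measure Offspring} [IsProbabilityMeasure μ] {f : ℝ → ℝ} {c θ : ℝ}

theorem measurable_clusterMGF (hf : Measurable f) : Measurable (clusterMGF μ f) :=
  (StronglyMeasurable.integral_prod_right'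
    (Real.measurable_exp.comp (measurable_shiftSum hf)).stronglyMeasurable).measurable

theorem measurable_exp_shiftSum (hf : Measurable f) (u : ℝ) :
    Measurable fun z : FamilyTree => Real.exp (shiftSum f (u, z)) :=
  Real.measurable_exp.comp ((measurable_shiftSum hf).comp (by fun_prop))

theorem integrable_exp_shiftSum (hf : Measurable f) (hc : ∀ x, |f x| ≤ c) (hcθ : c ≤ θ)
    (hfin : ∀ᵐ z ∂(treeLaw μ), IsFiniteMeasure (cluster z))
    (he : Integrable (fun z => Real.exp (θ * (cluster z).real Set.univ)) (treeLaw μ)) (u : ℝ) :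
    Integrable (fun z => Real.exp (shiftSum f (u, z))) (treeLaw μ) := by
  refine he.mono' (measurable_exp_shiftSum hf u).aestronglyMeasurable ?_
  filter_upwards [hfin] with z hz
  rw [Real.norm_of_nonneg (Real.exp_pos _).le]
  refine Real.exp_le_exp.2 ((le_abs_self _).trans ((abs_shiftSum_le _ _).trans
    ((shiftSum_abs_le hf hc (p := (u, z)) hz).trans ?_)))
  exact mul_le_mul_of_nonneg_right hcθ measureReal_nonneg

theorem clusterMGF_pos (hf : Measurable f) (hc : ∀ x, |f x| ≤ c) (hcθ : c ≤ θ)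
    (hfin : ∀ᵐ z ∂(treeLaw μ), IsFiniteMeasure (cluster z))
    (he : Integrable (fun z => Real.exp (θ * (cluster z).real Set.univ)) (treeLaw μ)) (u : ℝ) :
    0 < clusterMGF μ f u :=
  integral_exp_pos (integrable_exp_shiftSum hf hc hcθ hfin he u)

theorem clusterMGF_le (hf : Measurable f) (hc : ∀ x, |f x| ≤ c) (hcθ : c ≤ θ)
    (hfin : ∀ᵐ z ∂(treeLaw μ), IsFiniteMeasure (cluster z))
    (he : Integrable (fun z => Real.exp (θ * (cluster z).real Set.univ)) (treeLaw μ)) (u : ℝ) :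
    clusterMGF μ f u ≤ ∫ z, Real.exp (θ * (cluster z).real Set.univ) ∂(treeLaw μ) := by
  refine integral_mono_ae (integrable_exp_shiftSum hf hc hcθ hfin he u) he ?_
  filter_upwards [hfin] with z hz
  refine Real.exp_le_exp.2 ((le_abs_self _).trans ((abs_shiftSum_le _ _).trans
    ((shiftSum_abs_le hf hc (p := (u, z)) hz).trans ?_)))
  exact mul_le_mul_of_nonneg_right hcθ measureReal_nonneg

theorem clusterMGF_le_abs (hf : Measurable f) (hc : ∀ x, |f x| ≤ c) (hcθ : c ≤ θ)
    (hfin : ∀ᵐ z ∂(treeLaw μ), IsFiniteMeasure (cluster z))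
    (he : Integrable (fun z => Real.exp (θ * (cluster z).real Set.univ)) (treeLaw μ)) (u : ℝ) :
    clusterMGF μ f u ≤ clusterMGF μ (fun x => |f x|) u :=
  integral_mono (integrable_exp_shiftSum hf hc hcθ hfin he u)
    (integrable_exp_shiftSum hf.abs (fun x => by simpa using hc x) hcθ hfin he u)
    fun z => Real.exp_le_exp.2 ((le_abs_self _).trans (abs_shiftSum_le _ _))

/-- A consequence of the convexity of the inverse. -/
theorem inv_integral_exp_neg_le {α : Type*} [MeasurableSpace α] {ρ : Measure α}
    [IsProbabilityMeasure ρ] {X : α → ℝ} (h : Integrable (fun a => Real.exp (X a)) ρ)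
    (h' : Integrable (fun a => Real.exp (-X a)) ρ) :
    (∫ a, Real.exp (-X a) ∂ρ)⁻¹ ≤ ∫ a, Real.exp (X a) ∂ρ := by
  have hpos := integral_exp_pos h'
  set A := ∫ a, Real.exp (-X a) ∂ρ
  -- The integrand on the left is the tangent to the convex function `1 / x` at `x = A`, evaluated
  -- at `x = exp (-X)`; its mean is `A⁻¹`.
  have h1 : ∫ a, (2 * A⁻¹ - A⁻¹ ^ 2 * Real.exp (-X a)) ∂ρ ≤ ∫ a, Real.exp (X a) ∂ρ := by
    refine integral_mono ((integrable_const _).sub (h'.const_mul _)) h fun a => ?_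
    have e : Real.exp (X a) * Real.exp (-X a) = 1 := by rw [← Real.exp_add]; simp
    have e1 := Real.exp_pos (-X a)
    have e2 := Real.exp_pos (X a)
    have e3 : 0 ≤ Real.exp (-X a) * (Real.exp (X a) - A⁻¹) ^ 2 := by positivity
    have e4 : Real.exp (-X a) * (Real.exp (X a) - A⁻¹) ^ 2 =
        (Real.exp (X a) * Real.exp (-X a)) * Real.exp (X a) -
          2 * A⁻¹ * (Real.exp (X a) * Real.exp (-X a)) + A⁻¹ ^ 2 * Real.exp (-X a) := by ring
    rw [e4, e] at e3
    linarith
  rw [integral_sub (integrable_const _) (h'.const_mul _)] at h1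
  have h2 : ∫ a, A⁻¹ ^ 2 * Real.exp (-X a) ∂ρ = A⁻¹ := by
    rw [integral_const_mul]
    change A⁻¹ ^ 2 * A = A⁻¹
    field_simp
  simp only [h2, integral_const, probReal_univ, smul_eq_mul, one_mul] at h1
  linarith

theorem shiftSum_neg (f : ℝ → ℝ) (p : ℝ × FamilyTree) :
    shiftSum (fun x => -f x) p = -shiftSum f p := integral_neg _

/-- The upper bound is monotonicity. The lower one is `log E exp X ≥ -log E exp (-X) ≥ -log E exp
|X|`. -/
theorem abs_log_clusterMGF_le (hf : Measurable f) (hc : ∀ x, |f x| ≤ c) (hcθ : c ≤ θ)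
    (hfin : ∀ᵐ z ∂(treeLaw μ), IsFiniteMeasure (cluster z))
    (he : Integrable (fun z => Real.exp (θ * (cluster z).real Set.univ)) (treeLaw μ)) (u : ℝ) :
    |Real.log (clusterMGF μ f u)| ≤ Real.log (clusterMGF μ (fun x => |f x|) u) := by
  have hc' : ∀ x, |-f x| ≤ c := fun x => by simpa using hc x
  have hpos := clusterMGF_pos hf hc hcθ hfin he u
  have hf' : Measurable fun x => -f x := hf.neg
  have hneg := clusterMGF_pos hf' hc' hcθ hfin he u
  have h1 := clusterMGF_le_abs hf hc hcθ hfin he u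
  have h2 := clusterMGF_le_abs hf' hc' hcθ hfin he u
  simp only [abs_neg] at h2
  have hi := integrable_exp_shiftSum hf' hc' hcθ hfin he u
  have h3 := inv_integral_exp_neg_le (integrable_exp_shiftSum hf hc hcθ hfin he u)
    (by simpa only [← shiftSum_neg] using hi)
  simp only [← shiftSum_neg] at h3
  change (clusterMGF μ (fun x => -f x) u)⁻¹ ≤ clusterMGF μ f u at h3
  refine abs_le.2 ⟨?_, Real.log_le_log hpos h1⟩
  have h4 := Real.log_le_log (inv_pos.2 hneg) h3
  rw [Real.log_inv] at h4
  have h5 := Real.log_le_log hneg h2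
  linarith

theorem integrable_exp_shiftSum_abs_sub_one (hf : Measurable f) (hc : ∀ x, |f x| ≤ c)
    (hcθ : c < θ) (hi : Integrable f) (hfin : ∀ᵐ z ∂(treeLaw μ), IsFiniteMeasure (cluster z))
    (he : Integrable (fun z => Real.exp (θ * (cluster z).real Set.univ)) (treeLaw μ)) :
    Integrable (fun p => Real.exp (shiftSum (fun x => |f x|) p) - 1)
      ((volume : Measure ℝ).prod (treeLaw μ)) := by
  have hm := measurable_cluster_real
  refine (integrable_shiftSum_abs_mul hf hc hi hfin
    (η := fun z => Real.exp (c * (cluster z).real Set.univ)) (by fun_prop)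
    (integrable_cluster_mul_exp hcθ he)).mono' ?_ ?_
  · exact ((Real.measurable_exp.comp (measurable_shiftSum hf.abs)).sub_const 1).aestronglyMeasurable
  · filter_upwards [ae_prod_isFiniteMeasure hfin] with p hp
    have h1 := shiftSum_abs_le hf hc hp
    have h0 := shiftSum_abs_nonneg f p
    generalize shiftSum (fun x => |f x|) p = y at h0 h1 ⊢
    have e1 : Real.exp (-y) * Real.exp y = 1 := by rw [← Real.exp_add]; simp
    have e2 := Real.add_one_le_exp (-y)
    have e3 := Real.exp_pos y
    rw [Real.norm_of_nonneg (by linarith [Real.one_le_exp h0])]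
    refine (?_ : _ ≤ y * Real.exp y).trans
      (mul_le_mul_of_nonneg_left (Real.exp_le_exp.2 h1) h0)
    nlinarith

/-- With `log x ≤ x - 1` the preceding bound is dominated by `E exp C_u(|f|) - 1`, which is
integrable in `u`. -/
theorem integrable_log_clusterMGF (hf : Measurable f) (hc : ∀ x, |f x| ≤ c)
    (hcθ : c < θ) (hi : Integrable f) (hfin : ∀ᵐ z ∂(treeLaw μ), IsFiniteMeasure (cluster z))
    (he : Integrable (fun z => Real.exp (θ * (cluster z).real Set.univ)) (treeLaw μ)) :
    Integrable fun u => Real.log (clusterMGF μ f u) := by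
  have hc' : ∀ x, |(|f x|)| ≤ c := fun x => by simpa using hc x
  refine (integrable_exp_shiftSum_abs_sub_one hf hc hcθ hi hfin he).integral_prod_left.mono'
    (Real.measurable_log.comp (measurable_clusterMGF hf)).aestronglyMeasurable
    (Eventually.of_forall fun u => ?_)
  rw [integral_sub (integrable_exp_shiftSum hf.abs hc' hcθ.le hfin he u) (integrable_const _)]
  simp only [integral_const, probReal_univ, smul_eq_mul, one_mul]
  exact (abs_log_clusterMGF_le hf hc hcθ.le hfin he u).trans
    (Real.log_le_sub_one_of_pos (clusterMGF_pos hf.abs hc' hcθ.le hfin he u))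

theorem abs_log_clusterMGF_le_const (hf : Measurable f) (hc : ∀ x, |f x| ≤ c) (hcθ : c ≤ θ)
    (hfin : ∀ᵐ z ∂(treeLaw μ), IsFiniteMeasure (cluster z))
    (he : Integrable (fun z => Real.exp (θ * (cluster z).real Set.univ)) (treeLaw μ)) (u : ℝ) :
    ‖Real.log (clusterMGF μ f u)‖ ≤
      Real.log (∫ z, Real.exp (θ * (cluster z).real Set.univ) ∂(treeLaw μ)) := by
  have hc' : ∀ x, |(|f x|)| ≤ c := fun x => by simpa using hc x
  exact (abs_log_clusterMGF_le hf hc hcθ hfin he u).trans (Real.log_le_log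
    (clusterMGF_pos hf.abs hc' hcθ hfin he u) (clusterMGF_le hf.abs hc' hcθ hfin he u))

end ClusterMGF

theorem isLocallyFiniteMeasure_ofReal_smul (ν : ℝ) :
    IsLocallyFiniteMeasure (ENNReal.ofReal ν • (volume : Measure ℝ)) :=
  inferInstanceAs (IsLocallyFiniteMeasure (ν.toNNReal • (volume : Measure ℝ)))

/-! ### The Laplace functional of the superposition. -/

section LaplaceFunctional

variable {μ : Measure Offspring} [IsProbabilityMeasure μ] {f : ℝ → ℝ} {c θ : ℝ}
  {ρ : Measure (ℕ → ℝ)} [IsProbabilityMeasure ρ]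

theorem measurable_shiftSum_eval (hf : Measurable f) (j : ℕ) :
    Measurable fun p : (ℕ → ℝ) × (ℕ → FamilyTree) => shiftSum f (p.1 j, p.2 j) :=
  (measurable_shiftSum hf).comp (((measurable_pi_apply j).comp measurable_fst).prodMk
    ((measurable_pi_apply j).comp measurable_snd))

/-- Given the immigrants the clusters are independent, so the product of conditional means appears.
Writing each mean as the exponential of its logarithm makes the result an exponential of a sum over
the immigrants. -/
theorem lintegral_exp_sum_shiftSum (hf : Measurable f) (hc : ∀ x, |f x| ≤ c) (hcθ : c ≤ θ)
    (hfin : ∀ᵐ z ∂(treeLaw μ), IsFiniteMeasure (cluster z))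
    (he : Integrable (fun z => Real.exp (θ * (cluster z).real Set.univ)) (treeLaw μ)) (n : ℕ) :
    ∫⁻ p, ENNReal.ofReal (Real.exp (∑ j ∈ Finset.range n, shiftSum f (p.1 j, p.2 j)))
        ∂(ρ.prod (forestLaw μ)) =
      ∫⁻ u, ENNReal.ofReal (Real.exp (∑ j ∈ Finset.range n, Real.log (clusterMGF μ f (u j)))) ∂ρ := by
  have hm : Measurable fun p : (ℕ → ℝ) × (ℕ → FamilyTree) =>
      ENNReal.ofReal (Real.exp (∑ j ∈ Finset.range n, shiftSum f (p.1 j, p.2 j))) :=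
    (Real.measurable_exp.comp (Finset.measurable_sum _ fun j _ =>
      measurable_shiftSum_eval hf j)).ennreal_ofReal
  rw [lintegral_prod _ hm.aemeasurable]
  refine lintegral_congr fun u => ?_
  simp only [Real.exp_sum, ENNReal.ofReal_prod_of_nonneg fun _ _ => (Real.exp_pos _).le]
  rw [lintegral_forest_prod (Finset.range n)
    (φ := fun j z => ENNReal.ofReal (Real.exp (shiftSum f (u j, z))))
    fun j => (measurable_exp_shiftSum hf (u j)).ennreal_ofReal]
  refine Finset.prod_congr rfl fun j _ => ?_
  rw [Real.exp_log (clusterMGF_pos hf hc hcθ hfin he _), clusterMGF,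
    ofReal_integral_eq_lintegral_ofReal (integrable_exp_shiftSum hf hc hcθ hfin he _)
      (Eventually.of_forall fun _ => (Real.exp_pos _).le)]

theorem sum_range_le_integral_points {g : ℝ → ℝ} (hg : ∀ x, 0 ≤ g x) {u : ℕ → ℝ}
    (hi : Integrable g (points u)) (n : ℕ) :
    ∑ j ∈ Finset.range n, g (u j) ≤ ∫ x, g x ∂(points u) := by
  have h := hasSum_integral_measure hi
  simp only [integral_dirac] at h
  exact sum_le_hasSum _ (fun j _ => hg _) h

theorem hasSum_integral_points {g : ℝ → ℝ} {u : ℕ → ℝ} (hi : Integrable g (points u)) :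
    HasSum (fun j => g (u j)) (∫ x, g x ∂(points u)) := by
  have h := hasSum_integral_measure hi
  simp only [integral_dirac] at h
  exact h

variable {ν : ℝ}

/-- The partial products of the exponentials of the absolute sums over the clusters have an
integrable supremum. -/
theorem lintegral_iSup_exp_shiftSum_abs_lt_top
    (hρ : IsPoissonProcess ρ points (ENNReal.ofReal ν • (volume : Measure ℝ)))
    (hf : Measurable f) (hc : ∀ x, |f x| ≤ c) (hcθ : c < θ) (hi : Integrable f)
    (hfin : ∀ᵐ z ∂(treeLaw μ), IsFiniteMeasure (cluster z))
    (he : Integrable (fun z => Real.exp (θ * (cluster z).real Set.univ)) (treeLaw μ)) :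
    ∫⁻ p, ⨆ n : ℕ, ENNReal.ofReal (Real.exp (∑ j ∈ Finset.range n,
      shiftSum (fun x => |f x|) (p.1 j, p.2 j))) ∂(ρ.prod (forestLaw μ)) < ⊤ := by
  have hc' : ∀ x, |(|f x|)| ≤ c := fun x => by simpa using hc x
  have : IsLocallyFiniteMeasure (ENNReal.ofReal ν • (volume : Measure ℝ)) :=
    isLocallyFiniteMeasure_ofReal_smul ν
  have hgm : Measurable fun u => Real.log (clusterMGF μ (fun x => |f x|) u) :=
    Real.measurable_log.comp (measurable_clusterMGF hf.abs)
  have hgi : Integrable (fun u => Real.log (clusterMGF μ (fun x => |f x|) u))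
      (ENNReal.ofReal ν • (volume : Measure ℝ)) :=
    (integrable_log_clusterMGF hf.abs hc' hcθ hi.abs hfin he).smul_measure ENNReal.ofReal_ne_top
  have hD := hρ.integrable_exp_abs measurable_points hgm
    (fun u => abs_log_clusterMGF_le_const hf.abs hc' hcθ.le hfin he u) hgi
  have hae := hρ.ae_integrable measurable_points hgm hgi
  have hm : ∀ n : ℕ, Measurable fun p : (ℕ → ℝ) × (ℕ → FamilyTree) =>
      ENNReal.ofReal (Real.exp (∑ j ∈ Finset.range n,
        shiftSum (fun x => |f x|) (p.1 j, p.2 j))) := fun n =>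
    (Real.measurable_exp.comp (Finset.measurable_sum _ fun j _ =>
      measurable_shiftSum_eval hf.abs j)).ennreal_ofReal
  -- The partial sums increase in `n`, so monotone convergence applies; each partial mean is at most
  -- the mean of `exp` of the integral of `|log clusterMGF|` over the immigrants.
  rw [lintegral_iSup hm fun a b hab p => ?_]
  · refine (iSup_le fun n => ?_).trans_lt hD.lintegral_lt_top
    rw [lintegral_exp_sum_shiftSum hf.abs hc' hcθ.le hfin he]
    refine lintegral_mono_ae ?_
    filter_upwards [hae] with u hu
    refine ENNReal.ofReal_le_ofReal (Real.exp_le_exp.2 ?_)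
    refine (Finset.sum_le_sum fun j _ => le_abs_self _).trans ?_
    exact sum_range_le_integral_points
      (g := fun u => ‖Real.log (clusterMGF μ (fun x => |f x|) u)‖) (fun _ => norm_nonneg _)
      hu.norm n
  · refine ENNReal.ofReal_le_ofReal (Real.exp_le_exp.2 ?_)
    exact Finset.sum_le_sum_of_subset_of_nonneg (Finset.range_mono hab)
      fun _ _ _ => shiftSum_abs_nonneg _ _

/-- The partial sums are bounded by their exponentials, whose supremum is almost surely finite. -/
theorem ae_summable_shiftSum_abs
    (hρ : IsPoissonProcess ρ points (ENNReal.ofReal ν • (volume : Measure ℝ)))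
    (hf : Measurable f) (hc : ∀ x, |f x| ≤ c) (hcθ : c < θ) (hi : Integrable f)
    (hfin : ∀ᵐ z ∂(treeLaw μ), IsFiniteMeasure (cluster z))
    (he : Integrable (fun z => Real.exp (θ * (cluster z).real Set.univ)) (treeLaw μ)) :
    ∀ᵐ p ∂(ρ.prod (forestLaw μ)), Summable fun j => shiftSum (fun x => |f x|) (p.1 j, p.2 j) := by
  have hm : Measurable fun p : (ℕ → ℝ) × (ℕ → FamilyTree) =>
      ⨆ n : ℕ, ENNReal.ofReal (Real.exp (∑ j ∈ Finset.range n,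
        shiftSum (fun x => |f x|) (p.1 j, p.2 j))) :=
    Measurable.iSup fun n => (Real.measurable_exp.comp (Finset.measurable_sum _ fun j _ =>
      measurable_shiftSum_eval hf.abs j)).ennreal_ofReal
  filter_upwards [ae_lt_top hm (lintegral_iSup_exp_shiftSum_abs_lt_top hρ hf hc hcθ hi hfin he).ne]
    with p hp
  refine summable_of_sum_range_le (c := (⨆ n : ℕ, ENNReal.ofReal (Real.exp (∑ j ∈ Finset.range n,
    shiftSum (fun x => |f x|) (p.1 j, p.2 j)))).toReal) (fun j => shiftSum_abs_nonneg _ _)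
    fun n => ?_
  have h1 := ENNReal.toReal_mono hp.ne (le_iSup (fun n : ℕ => ENNReal.ofReal
    (Real.exp (∑ j ∈ Finset.range n, shiftSum (fun x => |f x|) (p.1 j, p.2 j)))) n)
  rw [ENNReal.toReal_ofReal (Real.exp_pos _).le] at h1
  exact (by linarith [Real.add_one_le_exp (∑ j ∈ Finset.range n,
    shiftSum (fun x => |f x|) (p.1 j, p.2 j))] : _ ≤ _).trans h1

/-- The Laplace functional of the superposition of the translated clusters. -/
theorem integral_exp_tsum_shiftSum
    (hρ : IsPoissonProcess ρ points (ENNReal.ofReal ν • (volume : Measure ℝ)))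
    (hf : Measurable f) (hc : ∀ x, |f x| ≤ c) (hcθ : c < θ) (hi : Integrable f)
    (hfin : ∀ᵐ z ∂(treeLaw μ), IsFiniteMeasure (cluster z))
    (he : Integrable (fun z => Real.exp (θ * (cluster z).real Set.univ)) (treeLaw μ)) :
    Integrable (fun p : (ℕ → ℝ) × (ℕ → FamilyTree) =>
        Real.exp (∑' j, shiftSum f (p.1 j, p.2 j))) (ρ.prod (forestLaw μ)) ∧
      ∫ p, Real.exp (∑' j, shiftSum f (p.1 j, p.2 j)) ∂(ρ.prod (forestLaw μ)) =
        Real.exp (∫ u, (clusterMGF μ f u - 1) ∂(ENNReal.ofReal ν • (volume : Measure ℝ))) := by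
  have hc' : ∀ x, |(|f x|)| ≤ c := fun x => by simpa using hc x
  have : IsLocallyFiniteMeasure (ENNReal.ofReal ν • (volume : Measure ℝ)) :=
    isLocallyFiniteMeasure_ofReal_smul ν
  have hsum := ae_summable_shiftSum_abs (μ := μ) hρ hf hc hcθ hi hfin he
  have hlt := lintegral_iSup_exp_shiftSum_abs_lt_top (μ := μ) hρ hf hc hcθ hi hfin he
  set D : (ℕ → ℝ) × (ℕ → FamilyTree) → ℝ≥0∞ := fun p =>
    ⨆ n : ℕ, ENNReal.ofReal (Real.exp (∑ j ∈ Finset.range n,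
      shiftSum (fun x => |f x|) (p.1 j, p.2 j))) with hDdef
  have hDm : Measurable D := Measurable.iSup fun n => (Real.measurable_exp.comp
    (Finset.measurable_sum _ fun j _ => measurable_shiftSum_eval hf.abs j)).ennreal_ofReal
  have hDi : Integrable (fun p => (D p).toReal) (ρ.prod (forestLaw μ)) :=
    integrable_toReal_of_lintegral_ne_top hDm.aemeasurable hlt.ne
  have hmeas : ∀ n, Measurable fun p : (ℕ → ℝ) × (ℕ → FamilyTree) =>
      Real.exp (∑ j ∈ Finset.range n, shiftSum f (p.1 j, p.2 j)) := fun n =>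
    Real.measurable_exp.comp (Finset.measurable_sum _ fun j _ => measurable_shiftSum_eval hf j)
  have hbound : ∀ n, ∀ᵐ p ∂(ρ.prod (forestLaw μ)),
      ‖Real.exp (∑ j ∈ Finset.range n, shiftSum f (p.1 j, p.2 j))‖ ≤ (D p).toReal := fun n => by
    filter_upwards [ae_lt_top hDm hlt.ne] with p hp
    rw [Real.norm_of_nonneg (Real.exp_pos _).le,
      ← ENNReal.toReal_ofReal (Real.exp_pos (∑ j ∈ Finset.range n, shiftSum f (p.1 j, p.2 j))).le]
    refine ENNReal.toReal_mono hp.ne ((ENNReal.ofReal_le_ofReal (Real.exp_le_exp.2 ?_)).trans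
      (le_iSup (fun n : ℕ => ENNReal.ofReal (Real.exp (∑ j ∈ Finset.range n,
        shiftSum (fun x => |f x|) (p.1 j, p.2 j)))) n))
    exact Finset.sum_le_sum fun j _ => (le_abs_self _).trans (abs_shiftSum_le _ _)
  have hlim : ∀ᵐ p ∂(ρ.prod (forestLaw μ)), Tendsto (fun n : ℕ =>
      Real.exp (∑ j ∈ Finset.range n, shiftSum f (p.1 j, p.2 j))) atTop
      (𝓝 (Real.exp (∑' j, shiftSum f (p.1 j, p.2 j)))) := by
    filter_upwards [hsum] with p hp
    have hs : Summable fun j => shiftSum f (p.1 j, p.2 j) :=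
      Summable.of_norm_bounded hp fun j => abs_shiftSum_le _ _
    exact (Real.continuous_exp.tendsto _).comp hs.hasSum.tendsto_sum_nat
  have hinteg : Integrable (fun p : (ℕ → ℝ) × (ℕ → FamilyTree) =>
      Real.exp (∑' j, shiftSum f (p.1 j, p.2 j))) (ρ.prod (forestLaw μ)) := by
    refine hDi.mono' (aestronglyMeasurable_of_tendsto_ae atTop
      (fun n => (hmeas n).aestronglyMeasurable) hlim) ?_
    filter_upwards [hlim, ae_all_iff.2 hbound] with p hp hb
    exact le_of_tendsto hp.norm (Eventually.of_forall hb)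
  refine ⟨hinteg, ?_⟩
  have hleft := tendsto_integral_of_dominated_convergence _
    (fun n => (hmeas n).aestronglyMeasurable) hDi hbound hlim
  have hgm : Measurable fun u => Real.log (clusterMGF μ f u) :=
    Real.measurable_log.comp (measurable_clusterMGF hf)
  have hgi : Integrable (fun u => Real.log (clusterMGF μ f u))
      (ENNReal.ofReal ν • (volume : Measure ℝ)) :=
    (integrable_log_clusterMGF hf hc hcθ hi hfin he).smul_measure ENNReal.ofReal_ne_top
  have hgb := fun u => abs_log_clusterMGF_le_const (μ := μ) hf hc hcθ.le hfin he u
  have hae := hρ.ae_integrable measurable_points hgm hgi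
  have hmeas' : ∀ n, Measurable fun u : ℕ → ℝ =>
      Real.exp (∑ j ∈ Finset.range n, Real.log (clusterMGF μ f (u j))) := fun n =>
    Real.measurable_exp.comp (Finset.measurable_sum _ fun j _ => hgm.comp (measurable_pi_apply j))
  have hright : Tendsto (fun n : ℕ => ∫ u : ℕ → ℝ,
      Real.exp (∑ j ∈ Finset.range n, Real.log (clusterMGF μ f (u j))) ∂ρ) atTop
      (𝓝 (∫ u : ℕ → ℝ, Real.exp (∫ x, Real.log (clusterMGF μ f x) ∂(points u)) ∂ρ)) := by
    refine tendsto_integral_of_dominated_convergence _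
      (fun n => (hmeas' n).aestronglyMeasurable)
      (hρ.integrable_exp_abs measurable_points hgm hgb hgi) (fun n => ?_) ?_
    · filter_upwards [hae] with u hu
      rw [Real.norm_of_nonneg (Real.exp_pos _).le]
      refine Real.exp_le_exp.2 ((Finset.sum_le_sum fun j _ => le_abs_self _).trans ?_)
      exact sum_range_le_integral_points (g := fun u => ‖Real.log (clusterMGF μ f u)‖)
        (fun _ => norm_nonneg _) hu.norm n
    · filter_upwards [hae] with u hu
      exact (Real.continuous_exp.tendsto _).comp (hasSum_integral_points hu).tendsto_sum_nat
  have heq : ∀ n : ℕ, ∫ p, Real.exp (∑ j ∈ Finset.range n, shiftSum f (p.1 j, p.2 j))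
      ∂(ρ.prod (forestLaw μ)) =
      ∫ u : ℕ → ℝ, Real.exp (∑ j ∈ Finset.range n, Real.log (clusterMGF μ f (u j))) ∂ρ := fun n => by
    rw [integral_eq_lintegral_of_nonneg_ae (Eventually.of_forall fun _ => (Real.exp_pos _).le)
      (hmeas n).aestronglyMeasurable, integral_eq_lintegral_of_nonneg_ae
      (Eventually.of_forall fun _ => (Real.exp_pos _).le) (hmeas' n).aestronglyMeasurable,
      lintegral_exp_sum_shiftSum hf hc hcθ.le hfin he]
  simp only [heq] at hleft
  -- The exponential formula is applied to the immigrants with the function `log clusterMGF`, whose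
  -- exponential is `clusterMGF`.
  rw [tendsto_nhds_unique hleft hright, hρ.integral_exp measurable_points hgm hgb hgi]
  simp only [Real.exp_log (clusterMGF_pos hf hc hcθ.le hfin he _)]

end LaplaceFunctional

theorem IsTestFunction.integrable {E : Type*} [TopologicalSpace E] [R1Space E] [MeasurableSpace E]
    [BorelSpace E] {f : E → ℝ} (hf : IsTestFunction f) (ρ : Measure E)
    [IsFiniteMeasureOnCompacts ρ] : Integrable f ρ := by
  obtain ⟨c, hc⟩ := hf.bounded
  have hK : IsCompact (tsupport f) := hf.compactSupport
  refine (integrableOn_iff_integrable_of_support_subset (subset_tsupport f)).1 ?_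
  exact Measure.integrableOn_of_bounded hK.measure_lt_top.ne hf.measurable.aestronglyMeasurable
    (M := c) (Eventually.of_forall hc)

/-- The superposition of the clusters with family trees `p.2 j` translated by `p.1 j`. -/
noncomputable def superposition (p : (ℕ → ℝ) × (ℕ → FamilyTree)) : Measure ℝ :=
  Measure.sum fun j : ℕ => (cluster (p.2 j)).map (fun x => x + p.1 j)

theorem integral_superposition {f : ℝ → ℝ} (hf : Measurable f) {c : ℝ} (hc : ∀ x, |f x| ≤ c)
    {p : (ℕ → ℝ) × (ℕ → FamilyTree)} (hfin : ∀ j, IsFiniteMeasure (cluster (p.2 j)))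
    (hs : Summable fun j => shiftSum (fun x => |f x|) (p.1 j, p.2 j)) :
    ∫ x, f x ∂(superposition p) = ∑' j, shiftSum f (p.1 j, p.2 j) := by
  have hi : Integrable f (superposition p) := by
    refine ⟨hf.aestronglyMeasurable, ?_⟩
    rw [hasFiniteIntegral_iff_enorm, superposition, lintegral_sum_measure]
    have e : ∀ j, ∫⁻ x, ‖f x‖ₑ ∂((cluster (p.2 j)).map fun x => x + p.1 j) =
        ENNReal.ofReal (shiftSum (fun x => |f x|) (p.1 j, p.2 j)) := fun j => by
      rw [lintegral_map hf.enorm (by fun_prop), ofReal_shiftSum_abs_eq hf hc (p := (p.1 j, p.2 j)) (hfin j)]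
    simp only [e]
    exact hs.tsum_ofReal_lt_top
  rw [superposition, integral_sum_measure hi]
  refine tsum_congr fun j => ?_
  rw [integral_map (by fun_prop) hf.aestronglyMeasurable, shiftSum]

/-! ### The cumulant generating functional of the process. -/

section GeneratingFunctional

variable {Ω : Type*} [MeasurableSpace Ω] {P : Measure Ω} [IsProbabilityMeasure P] {ν m : ℝ}
  {h : ℝ → ℝ} {N : Ω → Measure ℝ}

/-- Independence of immigrants and offspring makes the joint law a product; from here on only this
law matters. -/
theorem IsPoissonBranchingClusterProcess.exists_law
    (hN : IsPoissonBranchingClusterProcess P ν m h N) :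
    ∃ (μ : Measure Offspring) (_ : IsProbabilityMeasure μ) (ρ : Measure (ℕ → ℝ))
      (_ : IsProbabilityMeasure ρ) (T : Ω → (ℕ → ℝ) × (ℕ → FamilyTree)),
      IsPoissonProcess μ offspringMeasure (offspringIntensity m h) ∧
      IsPoissonProcess ρ points (ENNReal.ofReal ν • (volume : Measure ℝ)) ∧ Measurable T ∧
      P.map T = ρ.prod (forestLaw μ) ∧ ∀ᵐ ω ∂P, N ω = superposition (T ω) := by
  obtain ⟨U, Z, hU, hZ, hUP, hZP, hid, hind, hUZ, hN⟩ := hN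
  have hVm : Measurable fun ω j => U j ω := measurable_pi_lambda _ hU
  have hZ' : Measurable fun ω (p : ℕ × List ℕ) => Z p.1 p.2 ω :=
    measurable_pi_lambda _ fun p => hZ p.1 p.2
  have hWm : Measurable fun ω j v => Z j v ω :=
    measurable_pi_lambda _ fun j => measurable_pi_lambda _ fun v => hZ j v
  have hμ := Measure.isProbabilityMeasure_map (μ := P) (hZ 0 []).aemeasurable
  have hρ := Measure.isProbabilityMeasure_map (μ := P) hVm.aemeasurable
  refine ⟨P.map (Z 0 []), hμ, P.map fun ω j => U j ω, hρ,
    fun ω => (fun j => U j ω, fun j v => Z j v ω), (hZP 0 []).map_measure (hZ 0 []) measurable_offspringMeasure,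
    IsPoissonProcess.map_measure hVm measurable_points hUP, hVm.prodMk hWm, ?_, hN⟩
  have hUW : IndepFun (fun ω j => U j ω) (fun ω j v => Z j v ω) P :=
    hUZ.comp measurable_id (MeasurableEquiv.curry ℕ (List ℕ) Offspring).measurable
  rw [hUW.map_prod_eq_prod_map_map hVm.aemeasurable hWm.aemeasurable, map_forest hZ hid hind]

variable {μ : Measure Offspring} [IsProbabilityMeasure μ] {ρ : Measure (ℕ → ℝ)}
  [IsProbabilityMeasure ρ] {T : Ω → (ℕ → ℝ) × (ℕ → FamilyTree)} {θ : ℝ}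

/-- The generating functional of the cluster process. -/
theorem completeCGF_eq_integral_clusterMGF
    (hρ : IsPoissonProcess ρ points (ENNReal.ofReal ν • (volume : Measure ℝ))) (hT : Measurable T)
    (hmap : P.map T = ρ.prod (forestLaw μ)) (hN : ∀ᵐ ω ∂P, N ω = superposition (T ω))
    (hfin : ∀ᵐ z ∂(treeLaw μ), IsFiniteMeasure (cluster z))
    (he : Integrable (fun z => Real.exp (θ * (cluster z).real Set.univ)) (treeLaw μ))
    {f : ℝ → ℝ} (hf : Measurable f) {c : ℝ} (hc : ∀ x, |f x| ≤ c) (hcθ : c < θ)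
    (hi : Integrable f) :
    Integrable (fun ω => Real.exp (∫ x, f x ∂(N ω))) P ∧
      completeCGF P N f =
        ∫ u, (clusterMGF μ f u - 1) ∂(ENNReal.ofReal ν • (volume : Measure ℝ)) := by
  have hQ := integral_exp_tsum_shiftSum (μ := μ) hρ hf hc hcθ hi hfin he
  have hall : ∀ᵐ w ∂(forestLaw μ), ∀ j, IsFiniteMeasure (cluster (w j)) :=
    ae_all_iff.2 fun j => (measurePreserving_forest_eval j).quasiMeasurePreserving.ae hfin
  have hall' : ∀ᵐ p ∂(ρ.prod (forestLaw μ)), ∀ j, IsFiniteMeasure (cluster (p.2 j)) :=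
    Measure.quasiMeasurePreserving_snd.ae hall
  have hev : ∀ᵐ p ∂(ρ.prod (forestLaw μ)),
      ∫ x, f x ∂(superposition p) = ∑' j, shiftSum f (p.1 j, p.2 j) := by
    filter_upwards [hall', ae_summable_shiftSum_abs (μ := μ) hρ hf hc hcθ hi hfin he] with p h1 h2
    exact integral_superposition hf hc h1 h2
  rw [← hmap] at hev hQ
  have hae : ∀ᵐ ω ∂P, Real.exp (∑' j, shiftSum f ((T ω).1 j, (T ω).2 j)) =
      Real.exp (∫ x, f x ∂(N ω)) := by
    filter_upwards [ae_of_ae_map hT.aemeasurable hev, hN] with ω h1 h2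
    rw [h2, h1]
  refine ⟨(hQ.1.comp_measurable hT).congr hae, ?_⟩
  have hval := hQ.2
  rw [integral_map hT.aemeasurable hQ.1.aestronglyMeasurable] at hval
  rw [completeCGF, ← integral_congr_ae hae, hval, Real.log_exp]

/-- Puts the generating functional in the form `∫ (exp (∑ sⱼ Xⱼ) - 1)` over immigrant position and
tree, to which the differentiation lemmas apply. -/
theorem exists_completeCGF_eq
    (hρ : IsPoissonProcess ρ points (ENNReal.ofReal ν • (volume : Measure ℝ))) (hT : Measurable T)
    (hmap : P.map T = ρ.prod (forestLaw μ)) (hN : ∀ᵐ ω ∂P, N ω = superposition (T ω))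
    (hfin : ∀ᵐ z ∂(treeLaw μ), IsFiniteMeasure (cluster z)) (hθ : 0 < θ)
    (he : Integrable (fun z => Real.exp (θ * (cluster z).real Set.univ)) (treeLaw μ))
    {f : Fin 3 → ℝ → ℝ} (hf : ∀ j, IsTestFunction (f j)) :
    ∃ r > 0, (∀ j, HasExpMoments (ENNReal.ofReal ν • (volume : Measure ℝ).prod (treeLaw μ))
        (fun j => shiftSum (f j)) r (shiftSum (f j))) ∧
      ∀ s : Fin 3 → ℝ, ‖s‖ < r →
        Integrable (fun ω => Real.exp (∫ x, (∑ j, s j * f j x) ∂(N ω))) P ∧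
        completeCGF P N (fun x => ∑ j, s j * f j x) =
          ∫ p, (Real.exp (∑ j, s j * shiftSum (f j) p) - 1)
            ∂(ENNReal.ofReal ν • (volume : Measure ℝ).prod (treeLaw μ)) := by
  choose b hb using fun j => (hf j).bounded
  have hfm := fun j => (hf j).measurable
  have hfi := fun j => (hf j).integrable (volume : Measure ℝ)
  have hc : ∀ j x, |f j x| ≤ |b j| + 1 := fun j x =>
    (hb j x).trans ((le_abs_self _).trans (by linarith))
  have hc0 : 0 < ∑ j, (|b j| + 1) := Finset.sum_pos (fun j _ => by positivity) ⟨0, by simp⟩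
  -- Adding one to each bound keeps `C` positive even when all test functions vanish; for `‖s‖ < θ /
  -- C` the combination is bounded by `‖s‖ C < θ`.
  set C := ∑ j, (|b j| + 1)
  have hexp := hasExpMoments_shiftSum (μ := μ) hfm hc hfi hfin hθ (r := θ / C)
    (div_mul_cancel₀ θ hc0.ne').le hc0 he
  refine ⟨θ / C, by positivity, fun j r' hr' =>
    (hexp j r' hr').smul_measure ENNReal.ofReal_ne_top, fun s hs => ?_⟩
  have hsm : Measurable fun x => ∑ j, s j * f j x :=
    Finset.measurable_sum _ fun j _ => (hfm j).const_mul _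
  have hsb : ∀ x, |∑ j, s j * f j x| ≤ ‖s‖ * C := fun x =>
    (abs_sum_mul_le f s x).trans
      (mul_le_mul_of_nonneg_left (Finset.sum_le_sum fun j _ => hc j x) (norm_nonneg _))
  have hsi : Integrable fun x => ∑ j, s j * f j x :=
    integrable_finsetSum _ fun j _ => (hfi j).const_mul _
  obtain ⟨h1, h2⟩ := completeCGF_eq_integral_clusterMGF (μ := μ) hρ hT hmap hN hfin he hsm hsb
    ((lt_div_iff₀ hc0).1 hs) hsi
  refine ⟨h1, ?_⟩
  have hinteg := integrable_exp_sum_mul_sub_one (fun j => measurable_shiftSum (hfm j)) hexp hs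
  rw [h2, integral_smul_measure, integral_smul_measure, integral_prod _ hinteg]
  congr 1
  refine integral_congr_ae (Eventually.of_forall fun u => ?_)
  have hiu := integrable_exp_shiftSum (μ := μ) hsm hsb ((lt_div_iff₀ hc0).1 hs).le hfin he u
  have e : ∫ z, (Real.exp (∑ j, s j * shiftSum (f j) (u, z)) - 1) ∂(treeLaw μ) =
      ∫ z, (Real.exp (shiftSum (fun x => ∑ j, s j * f j x) (u, z)) - 1) ∂(treeLaw μ) := by
    refine integral_congr_ae ?_
    filter_upwards [hfin] with z hz
    rw [shiftSum_sum_mul hfm (fun j => ⟨_, hc j⟩) s (p := (u, z)) hz]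
  simp only [e]
  rw [integral_sub hiu (integrable_const _)]
  simp [clusterMGF]

end GeneratingFunctional

/-! ### Translation-invariant measures on `ℝ³` and uniqueness of the reduction. -/

/-- The translation-invariant measure on `ℝ³` whose reduced measure is `α`. -/
noncomputable def unreduce (α : Measure (ℝ × ℝ)) : Measure (ℝ × ℝ × ℝ) :=
  (α.prod (volume : Measure ℝ)).map fun p => (p.2, p.2 + p.1.1, p.2 + p.1.2)

theorem measurable_unreduceMap :
    Measurable fun p : (ℝ × ℝ) × ℝ => (p.2, p.2 + p.1.1, p.2 + p.1.2) := by fun_prop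

section Unreduce

variable {α β : Measure (ℝ × ℝ)} [IsFiniteMeasure α] [IsFiniteMeasure β]

instance isLocallyFiniteMeasure_unreduce : IsLocallyFiniteMeasure (unreduce α) := by
  refine ⟨fun x => ⟨Prod.fst ⁻¹' Metric.ball x.1 1,
    continuous_fst.continuousAt.preimage_mem_nhds (Metric.ball_mem_nhds _ one_pos), ?_⟩⟩
  rw [unreduce, Measure.map_apply measurable_unreduceMap
    (measurable_fst Metric.isOpen_ball.measurableSet)]
  have e : (fun p : (ℝ × ℝ) × ℝ => (p.2, p.2 + p.1.1, p.2 + p.1.2)) ⁻¹'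
      (Prod.fst ⁻¹' Metric.ball x.1 1) = Set.univ ×ˢ Metric.ball x.1 1 := by
    ext p
    simp
  rw [e, Measure.prod_prod]
  exact ENNReal.mul_lt_top (measure_lt_top _ _) measure_ball_lt_top

theorem integrable_unreduceMap {F : ℝ × ℝ × ℝ → ℝ} (hF : IsTestFunction F) :
    Integrable (fun p : (ℝ × ℝ) × ℝ => F (p.2, p.2 + p.1.1, p.2 + p.1.2))
      (α.prod (volume : Measure ℝ)) :=
  (hF.integrable (unreduce α)).comp_measurable measurable_unreduceMap

theorem integrable_integral_unreduce {F : ℝ × ℝ × ℝ → ℝ} (hF : IsTestFunction F) :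
    Integrable fun t : ℝ => ∫ τ, F (t, t + τ.1, t + τ.2) ∂α :=
  (integrable_unreduceMap hF).integral_prod_right

theorem integral_unreduce {F : ℝ × ℝ × ℝ → ℝ} (hF : IsTestFunction F) :
    ∫ t, F t ∂(unreduce α) = ∫ t : ℝ, ∫ τ, F (t, t + τ.1, t + τ.2) ∂α := by
  rw [unreduce, integral_map measurable_unreduceMap.aemeasurable
    hF.measurable.aestronglyMeasurable, integral_prod_symm _ (integrable_unreduceMap hF)]

/-- Subtracting the first coordinate recovers the product of the reduced measure with Lebesgue
measure; evaluating on `s × [0, 1]` recovers the reduced measure. -/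
theorem unreduce_injective (h : unreduce α = unreduce β) : α = β := by
  have hinv : Measurable fun t : ℝ × ℝ × ℝ => ((t.2.1 - t.1, t.2.2 - t.1), t.1) := by fun_prop
  have hcomp : (fun t : ℝ × ℝ × ℝ => ((t.2.1 - t.1, t.2.2 - t.1), t.1)) ∘
      (fun p : (ℝ × ℝ) × ℝ => (p.2, p.2 + p.1.1, p.2 + p.1.2)) = id := by
    ext p <;> simp
  have h1 := congrArg (Measure.map fun t : ℝ × ℝ × ℝ => ((t.2.1 - t.1, t.2.2 - t.1), t.1)) h
  rw [unreduce, unreduce, Measure.map_map hinv measurable_unreduceMap,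
    Measure.map_map hinv measurable_unreduceMap, hcomp, Measure.map_id, Measure.map_id] at h1
  ext s _
  have h2 := congrArg (fun M : Measure ((ℝ × ℝ) × ℝ) => M (s ×ˢ Set.Icc 0 1)) h1
  simpa [Measure.prod_prod] using h2

theorem isTestFunction_mul_mul {f : Fin 3 → ℝ → ℝ} (hf : ∀ j, IsTestFunction (f j)) :
    IsTestFunction fun t : ℝ × ℝ × ℝ => f 0 t.1 * f 1 t.2.1 * f 2 t.2.2 where
  measurable := by
    have h0 := (hf 0).measurable
    have h1 := (hf 1).measurable
    have h2 := (hf 2).measurable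
    fun_prop
  bounded := by
    choose c hc using fun j => (hf j).bounded
    refine ⟨c 0 * c 1 * c 2, fun t => ?_⟩
    rw [abs_mul, abs_mul]
    have h0 := (abs_nonneg _).trans (hc 0 t.1)
    have h1 := (abs_nonneg _).trans (hc 1 t.2.1)
    exact mul_le_mul (mul_le_mul (hc 0 _) (hc 1 _) (abs_nonneg _) h0) (hc 2 _) (abs_nonneg _)
      (mul_nonneg h0 h1)
  compactSupport := by
    have hK : IsCompact (tsupport (f 0) ×ˢ tsupport (f 1) ×ˢ tsupport (f 2)) :=
      (hf 0).compactSupport.isCompact.prod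
        ((hf 1).compactSupport.isCompact.prod (hf 2).compactSupport.isCompact)
    refine HasCompactSupport.intro hK fun t ht => ?_
    by_contra hne
    refine ht ⟨subset_tsupport _ ?_, subset_tsupport _ ?_, subset_tsupport _ ?_⟩ <;>
    · rw [Function.mem_support]
      rintro h0
      exact hne (by simp [h0])

theorem isTestFunction_indicator {A : Set ℝ} (hA : MeasurableSet A) (n : ℕ) :
    IsTestFunction ((A ∩ Set.Icc (-n : ℝ) n).indicator fun _ => (1 : ℝ)) where
  measurable := measurable_const.indicator (hA.inter measurableSet_Icc)
  bounded := ⟨1, fun x => by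
    by_cases hx : x ∈ A ∩ Set.Icc (-n : ℝ) n <;> simp [hx]⟩
  compactSupport := HasCompactSupport.intro (isCompact_Icc (a := (-n : ℝ)) (b := n)) fun x hx =>
    Set.indicator_of_notMem (fun h => hx h.2) _

/-- Indicators of bounded Borel sets are test functions, and finite measures on a cube are
determined by their values on boxes. -/
theorem unreduce_ext (h : ∀ f : Fin 3 → ℝ → ℝ, (∀ j, IsTestFunction (f j)) →
    ∫ t, f 0 t.1 * f 1 t.2.1 * f 2 t.2.2 ∂(unreduce α) =
      ∫ t, f 0 t.1 * f 1 t.2.1 * f 2 t.2.2 ∂(unreduce β)) : α = β := by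
  refine unreduce_injective (Measure.ext_of_iUnion_eq_univ
    (s := fun n : ℕ => Set.Icc (-n : ℝ) n ×ˢ Set.Icc (-n : ℝ) n ×ˢ Set.Icc (-n : ℝ) n) ?_
    fun n => ?_)
  · refine Set.eq_univ_of_forall fun t => Set.mem_iUnion.2 ?_
    obtain ⟨n, hn⟩ := exists_nat_ge (max |t.1| (max |t.2.1| |t.2.2|))
    simp only [max_le_iff, abs_le] at hn
    exact ⟨n, hn.1, hn.2.1, hn.2.2⟩
  have hc : IsCompact (Set.Icc (-n : ℝ) n ×ˢ Set.Icc (-n : ℝ) n ×ˢ Set.Icc (-n : ℝ) n) :=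
    isCompact_Icc.prod (isCompact_Icc.prod isCompact_Icc)
  have hfin : IsFiniteMeasure ((unreduce α).restrict
      (Set.Icc (-n : ℝ) n ×ˢ Set.Icc (-n : ℝ) n ×ˢ Set.Icc (-n : ℝ) n)) :=
    isFiniteMeasure_restrict.2 hc.measure_lt_top.ne
  refine Measure.ext_prod₃ fun {A B C} hA hB hC => ?_
  have hbox := hA.prod (hB.prod hC)
  rw [Measure.restrict_apply hbox, Measure.restrict_apply hbox, Set.prod_inter_prod,
    Set.prod_inter_prod]
  have hm : MeasurableSet ((A ∩ Set.Icc (-n : ℝ) n) ×ˢ (B ∩ Set.Icc (-n : ℝ) n) ×ˢ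
      (C ∩ Set.Icc (-n : ℝ) n)) := (hA.inter measurableSet_Icc).prod
    ((hB.inter measurableSet_Icc).prod (hC.inter measurableSet_Icc))
  have hsub : (A ∩ Set.Icc (-n : ℝ) n) ×ˢ (B ∩ Set.Icc (-n : ℝ) n) ×ˢ (C ∩ Set.Icc (-n : ℝ) n) ⊆
      Set.Icc (-n : ℝ) n ×ˢ Set.Icc (-n : ℝ) n ×ˢ Set.Icc (-n : ℝ) n :=
    Set.prod_mono Set.inter_subset_right (Set.prod_mono Set.inter_subset_right
      Set.inter_subset_right)
  have key := h ![(A ∩ Set.Icc (-n : ℝ) n).indicator fun _ => 1,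
    (B ∩ Set.Icc (-n : ℝ) n).indicator fun _ => 1, (C ∩ Set.Icc (-n : ℝ) n).indicator fun _ => 1]
    (fun j => by
      fin_cases j
      · exact isTestFunction_indicator hA n
      · exact isTestFunction_indicator hB n
      · exact isTestFunction_indicator hC n)
  have e : (fun t : ℝ × ℝ × ℝ => (A ∩ Set.Icc (-n : ℝ) n).indicator (fun _ => (1 : ℝ)) t.1 *
      (B ∩ Set.Icc (-n : ℝ) n).indicator (fun _ => (1 : ℝ)) t.2.1 *
      (C ∩ Set.Icc (-n : ℝ) n).indicator (fun _ => (1 : ℝ)) t.2.2) =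
      ((A ∩ Set.Icc (-n : ℝ) n) ×ˢ (B ∩ Set.Icc (-n : ℝ) n) ×ˢ
        (C ∩ Set.Icc (-n : ℝ) n)).indicator 1 := by
    funext t
    by_cases h0 : t.1 ∈ A ∩ Set.Icc (-n : ℝ) n <;>
    by_cases h1 : t.2.1 ∈ B ∩ Set.Icc (-n : ℝ) n <;>
    by_cases h2 : t.2.2 ∈ C ∩ Set.Icc (-n : ℝ) n <;>
    simp [Set.indicator, Set.mem_prod, -Set.mem_inter_iff, h0, h1, h2]
  change ∫ t : ℝ × ℝ × ℝ, (A ∩ Set.Icc (-n : ℝ) n).indicator (fun _ => (1 : ℝ)) t.1 *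
      (B ∩ Set.Icc (-n : ℝ) n).indicator (fun _ => (1 : ℝ)) t.2.1 *
      (C ∩ Set.Icc (-n : ℝ) n).indicator (fun _ => (1 : ℝ)) t.2.2 ∂(unreduce α) =
    ∫ t : ℝ × ℝ × ℝ, (A ∩ Set.Icc (-n : ℝ) n).indicator (fun _ => (1 : ℝ)) t.1 *
      (B ∩ Set.Icc (-n : ℝ) n).indicator (fun _ => (1 : ℝ)) t.2.1 *
      (C ∩ Set.Icc (-n : ℝ) n).indicator (fun _ => (1 : ℝ)) t.2.2 ∂(unreduce β) at key
  rw [e, integral_indicator_one hm, integral_indicator_one hm] at key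
  exact (measureReal_eq_measureReal_iff ((measure_mono hsub).trans_lt hc.measure_lt_top).ne
    ((measure_mono hsub).trans_lt hc.measure_lt_top).ne).1 key

theorem unreduce_add : unreduce (α + β) = unreduce α + unreduce β := by
  rw [unreduce, unreduce, unreduce, Measure.add_prod, Measure.map_add _ _ measurable_unreduceMap]

theorem integral_toSignedMeasure_sub {X : Type*} [MeasurableSpace X] {ρ₁ ρ₂ : Measure X}
    [IsFiniteMeasure ρ₁] [IsFiniteMeasure ρ₂] {f : X → ℝ} (h₁ : Integrable f ρ₁)
    (h₂ : Integrable f ρ₂) :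
    ∫ᵛ x, f x ∂<•(ρ₁.toSignedMeasure - ρ₂.toSignedMeasure) = (∫ x, f x ∂ρ₁) - ∫ x, f x ∂ρ₂ := by
  rw [VectorMeasure.integral_sub_vectorMeasure (by
    rwa [VectorMeasure.Integrable, Measure.variation_toSignedMeasure]) (by
    rwa [VectorMeasure.Integrable, Measure.variation_toSignedMeasure]),
    VectorMeasure.integral_toSignedMeasure, VectorMeasure.integral_toSignedMeasure]

/-- The Jordan decomposition expresses the signed integral through two positive measures, for which
Fubini and `unreduce_ext` are available. -/
theorem integral_integral_signedMeasure (γ : SignedMeasure (ℝ × ℝ)) {F : ℝ × ℝ × ℝ → ℝ}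
    (hF : IsTestFunction F) :
    ∫ t : ℝ, (∫ᵛ τ, F (t, t + τ.1, t + τ.2) ∂<•γ) =
      (∫ t, F t ∂(unreduce γ.toJordanDecomposition.posPart)) -
        ∫ t, F t ∂(unreduce γ.toJordanDecomposition.negPart) := by
  obtain ⟨c, hc⟩ := hF.bounded
  have hm : ∀ t : ℝ, Measurable fun τ : ℝ × ℝ => F (t, t + τ.1, t + τ.2) := fun t =>
    hF.measurable.comp (by fun_prop)
  have hi : ∀ (ρ : Measure (ℝ × ℝ)) [IsFiniteMeasure ρ] (t : ℝ),
      Integrable (fun τ : ℝ × ℝ => F (t, t + τ.1, t + τ.2)) ρ := fun ρ _ t =>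
    Integrable.of_bound (hm t).aestronglyMeasurable c (Eventually.of_forall fun _ => hc _)
  rw [integral_unreduce hF, integral_unreduce hF,
    ← integral_sub (integrable_integral_unreduce hF) (integrable_integral_unreduce hF)]
  refine integral_congr_ae (Eventually.of_forall fun t => ?_)
  have h := integral_toSignedMeasure_sub (hi γ.toJordanDecomposition.posPart t)
    (hi γ.toJordanDecomposition.negPart t)
  change ∫ᵛ τ, F (t, t + τ.1, t + τ.2) ∂<•γ.toJordanDecomposition.toSignedMeasure = _ at h
  rw [SignedMeasure.toSignedMeasure_toJordanDecomposition] at h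
  exact h

/-- The reduced third complete cumulant measure is unique. -/
theorem IsReducedThirdCompleteCumulant.unique {Ω : Type*} [MeasurableSpace Ω] {P : Measure Ω}
    {N : Ω → Measure ℝ} {γ γ' : SignedMeasure (ℝ × ℝ)}
    (h : IsReducedThirdCompleteCumulant P N γ) (h' : IsReducedThirdCompleteCumulant P N γ') :
    γ = γ' := by
  obtain ⟨γp, γm, hγ, hred⟩ := h
  obtain ⟨γp', γm', hγ', hred'⟩ := h'
  -- Moving the negative parts across turns equality of signed measures into equality of positive
  -- ones. Both reductions represent the same mixed derivative.
  have hkey : γ.toJordanDecomposition.posPart + γ'.toJordanDecomposition.negPart =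
      γ'.toJordanDecomposition.posPart + γ.toJordanDecomposition.negPart := by
    refine unreduce_ext fun f hf => ?_
    have hF := isTestFunction_mul_mul hf
    have e1 := hred _ hF
    have e2 := hred' _ hF
    rw [hγ.mixed_deriv f hf, integral_integral_signedMeasure γ hF] at e1
    rw [hγ'.mixed_deriv f hf, integral_integral_signedMeasure γ' hF] at e2
    rw [unreduce_add, unreduce_add,
      integral_add_measure (hF.integrable _) (hF.integrable _),
      integral_add_measure (hF.integrable _) (hF.integrable _)]
    linarith
  rw [← SignedMeasure.toSignedMeasure_toJordanDecomposition γ,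
    ← SignedMeasure.toSignedMeasure_toJordanDecomposition γ',
    JordanDecomposition.toSignedMeasure, JordanDecomposition.toSignedMeasure, sub_eq_sub_iff_add_eq_add,
    ← Measure.toSignedMeasure_add, ← Measure.toSignedMeasure_add]
  exact Measure.toSignedMeasure_congr hkey

end Unreduce

/-! ### The third moment measure of the cluster and its reduction. -/

section TripleLaw

variable (μ : Measure Offspring) [IsProbabilityMeasure μ]

/-- The mean of the third power of the cluster, a measure on `ℝ³`. -/
noncomputable def tripleLaw : Measure (ℝ × ℝ × ℝ) :=
  (treeLaw μ ⊗ₘ (clusterKernel ×ₖ (clusterKernel ×ₖ clusterKernel))).snd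

variable {μ}

/-- Holds for every tree, even one with an infinite cluster, so products of integrals over the
cluster need no exceptional set. -/
theorem sFinite_cluster (z : FamilyTree) : SFinite (cluster z) := by
  rw [← clusterKernel_apply]
  infer_instance

theorem tripleKernel_apply (z : FamilyTree) :
    (clusterKernel ×ₖ (clusterKernel ×ₖ clusterKernel)) z =
      (cluster z).prod ((cluster z).prod (cluster z)) := by
  rw [Kernel.prod_apply, Kernel.prod_apply, clusterKernel_apply]

theorem integral_tripleLaw {E : Type*} [NormedAddCommGroup E] [NormedSpace ℝ E]
    {F : ℝ × ℝ × ℝ → E} (hF : Integrable F (tripleLaw μ)) :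
    ∫ q, F q ∂(tripleLaw μ) =
      ∫ z, ∫ q, F q ∂((cluster z).prod ((cluster z).prod (cluster z))) ∂(treeLaw μ) := by
  have hi : Integrable (fun p : FamilyTree × ℝ × ℝ × ℝ => F p.2)
      (treeLaw μ ⊗ₘ (clusterKernel ×ₖ (clusterKernel ×ₖ clusterKernel))) :=
    hF.comp_measurable measurable_snd
  rw [tripleLaw, Measure.snd, integral_map measurable_snd.aemeasurable hF.aestronglyMeasurable,
    Measure.integral_compProd hi]
  simp only [tripleKernel_apply]

/-- The total mass is the third moment of the cluster size. -/
theorem isFiniteMeasure_tripleLaw {θ : ℝ} (hθ : 0 < θ)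
    (hfin : ∀ᵐ z ∂(treeLaw μ), IsFiniteMeasure (cluster z))
    (he : Integrable (fun z => Real.exp (θ * (cluster z).real Set.univ)) (treeLaw μ)) :
    IsFiniteMeasure (tripleLaw μ) := by
  refine ⟨?_⟩
  rw [tripleLaw, Measure.snd_univ, Measure.compProd_apply .univ]
  have h3 := (memLp_cluster_real hθ he).integrable_norm_pow (p := 3) (by norm_num)
  refine lt_of_le_of_lt (lintegral_mono_ae ?_) h3.2
  filter_upwards [hfin] with z hz
  have := sFinite_cluster z
  rw [Set.preimage_univ, tripleKernel_apply, ← Set.univ_prod_univ, Measure.prod_prod,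
    ← Set.univ_prod_univ, Measure.prod_prod, enorm_pow, enorm_norm,
    Real.enorm_of_nonneg measureReal_nonneg, Measure.real,
    ENNReal.ofReal_toReal (measure_ne_top _ _)]
  exact (by ring : _ = _).le

end TripleLaw

theorem measurable_diff : Measurable fun q : ℝ × ℝ × ℝ => (q.2.1 - q.1, q.2.2 - q.1) := by fun_prop

theorem measurable_shift₃ :
    Measurable fun p : (ℝ × ℝ × ℝ) × ℝ => (p.1.1 + p.2, p.1.2.1 + p.2, p.1.2.2 + p.2) := by fun_prop

/-- The shear `(q, u) ↦ (q, q₁ + u)` preserves the product with Lebesgue measure. It exchanges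
translation by the immigrant position for the position of the first point as base point. -/
theorem unreduce_map_diff (T : Measure (ℝ × ℝ × ℝ)) [IsFiniteMeasure T] :
    unreduce (T.map fun q => (q.2.1 - q.1, q.2.2 - q.1)) =
      (T.prod (volume : Measure ℝ)).map fun p => (p.1.1 + p.2, p.1.2.1 + p.2, p.1.2.2 + p.2) := by
  have hmp : MeasurePreserving (fun p : (ℝ × ℝ × ℝ) × ℝ => (p.1, p.1.1 + p.2))
      (T.prod (volume : Measure ℝ)) (T.prod (volume : Measure ℝ)) :=
    (MeasurePreserving.id T).skew_product (g := fun q u => q.1 + u) (by fun_prop)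
      (Eventually.of_forall fun q => map_add_left_eq_self _ _)
  have h1 : (T.map fun q => (q.2.1 - q.1, q.2.2 - q.1)).prod (volume : Measure ℝ) =
      (T.prod (volume : Measure ℝ)).map
        (Prod.map (fun q : ℝ × ℝ × ℝ => (q.2.1 - q.1, q.2.2 - q.1)) id) := by
    rw [← Measure.map_prod_map _ _ measurable_diff measurable_id, Measure.map_id]
  rw [unreduce, h1, ← hmp.map_eq, Measure.map_map (measurable_diff.prodMap measurable_id)
    hmp.measurable, Measure.map_map measurable_unreduceMap (by fun_prop), hmp.map_eq]
  congr 1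
  funext p
  simp only [Function.comp_apply, Prod.map_apply, id_eq]
  ext <;> simp <;> ring

section ReducedMeasure

variable {μ : Measure Offspring} [IsProbabilityMeasure μ] {ν : ℝ}

/-- The reduced third cumulant measure of the cluster process. -/
noncomputable def reducedMeasure (ν : ℝ) (μ : Measure Offspring) [IsProbabilityMeasure μ] :
    Measure (ℝ × ℝ) :=
  (ENNReal.ofReal ν • tripleLaw μ).map fun q => (q.2.1 - q.1, q.2.2 - q.1)

theorem isFiniteMeasure_reducedMeasure [IsFiniteMeasure (tripleLaw μ)] :
    IsFiniteMeasure (reducedMeasure ν μ) := by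
  have : IsFiniteMeasure (ENNReal.ofReal ν • tripleLaw μ) :=
    Measure.smul_finite _ ENNReal.ofReal_ne_top
  unfold reducedMeasure
  infer_instance

/-- After the change of base point, the triple product integral over one translated cluster factors
by Fubini into the three sums. -/
theorem integral_unreduce_reducedMeasure [IsFiniteMeasure (tripleLaw μ)] (hν : 0 < ν)
    {f : Fin 3 → ℝ → ℝ} (hf : ∀ j, IsTestFunction (f j))
    (hi : Integrable (fun p => shiftSum (f 0) p * shiftSum (f 1) p * shiftSum (f 2) p)
      (ENNReal.ofReal ν • (volume : Measure ℝ).prod (treeLaw μ))) :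
    ∫ t, f 0 t.1 * f 1 t.2.1 * f 2 t.2.2 ∂(unreduce (reducedMeasure ν μ)) =
      ∫ p, shiftSum (f 0) p * shiftSum (f 1) p * shiftSum (f 2) p
        ∂(ENNReal.ofReal ν • (volume : Measure ℝ).prod (treeLaw μ)) := by
  have hfin : IsFiniteMeasure (ENNReal.ofReal ν • tripleLaw μ) :=
    Measure.smul_finite _ ENNReal.ofReal_ne_top
  have hF := isTestFunction_mul_mul hf
  obtain ⟨c, hc⟩ := hF.bounded
  have := isFiniteMeasure_reducedMeasure (ν := ν) (μ := μ)
  have hinteg := hF.integrable (unreduce (reducedMeasure ν μ))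
  rw [reducedMeasure, unreduce_map_diff] at hinteg ⊢
  have hinteg' : Integrable (fun p : (ℝ × ℝ × ℝ) × ℝ =>
      f 0 (p.1.1 + p.2) * f 1 (p.1.2.1 + p.2) * f 2 (p.1.2.2 + p.2))
      ((ENNReal.ofReal ν • tripleLaw μ).prod volume) := hinteg.comp_measurable measurable_shift₃
  rw [integral_map measurable_shift₃.aemeasurable hF.measurable.aestronglyMeasurable,
    integral_prod_symm _ hinteg']
  have hi' := (integrable_smul_measure (ENNReal.ofReal_pos.2 hν).ne' ENNReal.ofReal_ne_top).1 hi
  rw [integral_smul_measure, integral_prod _ hi', ← integral_smul]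
  refine integral_congr_ae (Eventually.of_forall fun u => ?_)
  simp only [integral_smul_measure]
  congr 1
  have hmu : Measurable fun q : ℝ × ℝ × ℝ =>
      f 0 (q.1 + u) * f 1 (q.2.1 + u) * f 2 (q.2.2 + u) :=
    hF.measurable.comp (measurable_shift₃.comp (measurable_id.prodMk measurable_const))
  rw [integral_tripleLaw (Integrable.of_bound hmu.aestronglyMeasurable c
    (Eventually.of_forall fun q => hc (q.1 + u, q.2.1 + u, q.2.2 + u)))]
  refine integral_congr_ae (Eventually.of_forall fun z => ?_)
  have := sFinite_cluster z
  simp only [mul_assoc, shiftSum]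
  rw [integral_prod_mul (fun x => f 0 (x + u)) fun q : ℝ × ℝ => f 1 (q.1 + u) * f 2 (q.2 + u),
    integral_prod_mul (fun x => f 1 (x + u)) fun x => f 2 (x + u)]

theorem fourierStieltjes_reducedMeasure [IsFiniteMeasure (tripleLaw μ)]
    [IsFiniteMeasure (reducedMeasure ν μ)] (hν : 0 < ν) (ω₁ ω₂ : ℝ) :
    fourierStieltjes (reducedMeasure ν μ).toSignedMeasure ω₁ ω₂ =
      ν * ∫ z, clusterHat ω₁ z * clusterHat ω₂ z * clusterHat (-ω₁ - ω₂) z ∂(treeLaw μ) := by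
  have hm : Measurable fun τ : ℝ × ℝ =>
      Complex.exp (-Complex.I * ((ω₁ * τ.1 + ω₂ * τ.2 : ℝ) : ℂ)) := by fun_prop
  rw [fourierStieltjes, VectorMeasure.integral_toSignedMeasure, reducedMeasure,
    integral_map measurable_diff.aemeasurable hm.aestronglyMeasurable, integral_smul_measure,
    ENNReal.toReal_ofReal hν.le, Complex.real_smul]
  congr 1
  -- The third frequency `-ω₁ - ω₂` is what the two differences leave on the first point.
  have e : ∀ q : ℝ × ℝ × ℝ,
      Complex.exp (-Complex.I * ((ω₁ * (q.2.1 - q.1) + ω₂ * (q.2.2 - q.1) : ℝ) : ℂ)) =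
        expChar (-ω₁ - ω₂) q.1 * (expChar ω₁ q.2.1 * expChar ω₂ q.2.2) := fun q => by
    simp only [expChar, ← Complex.exp_add]
    push_cast
    ring_nf
  simp only [e]
  have hm' : Measurable fun q : ℝ × ℝ × ℝ =>
      expChar (-ω₁ - ω₂) q.1 * (expChar ω₁ q.2.1 * expChar ω₂ q.2.2) := by
    have h1 := measurable_expChar (-ω₁ - ω₂)
    have h2 := measurable_expChar ω₁
    have h3 := measurable_expChar ω₂
    fun_prop
  rw [integral_tripleLaw (Integrable.of_bound hm'.aestronglyMeasurable 1
    (Eventually.of_forall fun q => by simp [norm_expChar]))]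
  refine integral_congr_ae (Eventually.of_forall fun z => ?_)
  have := sFinite_cluster z
  simp only [clusterHat]
  rw [integral_prod_mul (expChar (-ω₁ - ω₂)) fun q : ℝ × ℝ => expChar ω₁ q.1 * expChar ω₂ q.2,
    integral_prod_mul (expChar ω₁) (expChar ω₂)]
  ring

end ReducedMeasure

/-! ### Existence of the reduced cumulant measure. -/

section Existence

variable {Ω : Type*} [MeasurableSpace Ω] {P : Measure Ω} [IsProbabilityMeasure P] {ν : ℝ}
  {N : Ω → Measure ℝ} {μ : Measure Offspring} [IsProbabilityMeasure μ] {ρ : Measure (ℕ → ℝ)}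
  [IsProbabilityMeasure ρ] {T : Ω → (ℕ → ℝ) × (ℕ → FamilyTree)} {θ : ℝ}

/-- The cumulant is `ν` times a third moment of a positive random measure, hence itself positive:
the subtracted measure is zero. -/
theorem isThirdCompleteCumulant_unreduce [IsFiniteMeasure (tripleLaw μ)] (hν : 0 < ν)
    (hρ : IsPoissonProcess ρ points (ENNReal.ofReal ν • (volume : Measure ℝ))) (hT : Measurable T)
    (hmap : P.map T = ρ.prod (forestLaw μ)) (hN : ∀ᵐ ω ∂P, N ω = superposition (T ω))
    (hfin : ∀ᵐ z ∂(treeLaw μ), IsFiniteMeasure (cluster z)) (hθ : 0 < θ)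
    (he : Integrable (fun z => Real.exp (θ * (cluster z).real Set.univ)) (treeLaw μ)) :
    IsThirdCompleteCumulant P N (unreduce (reducedMeasure ν μ)) 0 := by
  have := isFiniteMeasure_reducedMeasure (ν := ν) (μ := μ)
  have key := fun (f : Fin 3 → ℝ → ℝ) (hf : ∀ j, IsTestFunction (f j)) =>
    exists_completeCGF_eq (μ := μ) hρ hT hmap hN hfin hθ he hf
  have hball : ∀ {r : ℝ}, 0 < r → ∀ᶠ s : Fin 3 → ℝ in 𝓝 0, ‖s‖ < r := fun hr => by
    filter_upwards [Metric.ball_mem_nhds (0 : Fin 3 → ℝ) hr] with s hs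
    simpa using hs
  refine ⟨inferInstance, inferInstance, fun f hf => ?_, fun f hf => ?_, fun f hf => ?_⟩
  · obtain ⟨r, hr, -, hs⟩ := key f hf
    exact (hball hr).mono fun s h => (hs s h).1
  · obtain ⟨r, hr, hX, hs⟩ := key f hf
    exact (contDiffAt_integral_exp_sub_one (fun j => measurable_shiftSum (hf j).measurable) hr hX
      3).congr_of_eventuallyEq ((hball hr).mono fun s h => (hs s h).2)
  · obtain ⟨r, hr, hX, hs⟩ := key f hf
    have hXm := fun j => measurable_shiftSum (hf j).measurable
    have hd := deriv_deriv_deriv_eq hXm hr hX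
      (G := fun s => completeCGF P N fun x => ∑ j, s j * f j x) fun s h => (hs s h).2
    have hmul := ((hX 0).mul hXm (hXm 0) 1).mul hXm ((hXm 0).mul (hXm 1)) 2
    have hi := hmul 0 hr
    simp only [zero_mul, Real.exp_zero, mul_one] at hi
    rw [integral_zero_measure, sub_zero, integral_unreduce_reducedMeasure hν hf hi, ← hd]
    simp [Fin.sum_univ_three]

theorem isReducedThirdCompleteCumulant_reducedMeasure [IsFiniteMeasure (tripleLaw μ)]
    [IsFiniteMeasure (reducedMeasure ν μ)] (hν : 0 < ν)
    (hρ : IsPoissonProcess ρ points (ENNReal.ofReal ν • (volume : Measure ℝ))) (hT : Measurable T)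
    (hmap : P.map T = ρ.prod (forestLaw μ)) (hN : ∀ᵐ ω ∂P, N ω = superposition (T ω))
    (hfin : ∀ᵐ z ∂(treeLaw μ), IsFiniteMeasure (cluster z)) (hθ : 0 < θ)
    (he : Integrable (fun z => Real.exp (θ * (cluster z).real Set.univ)) (treeLaw μ)) :
    IsReducedThirdCompleteCumulant P N (reducedMeasure ν μ).toSignedMeasure := by
  refine ⟨_, _, isThirdCompleteCumulant_unreduce hν hρ hT hmap hN hfin hθ he, fun F hF => ?_⟩
  simp only [integral_zero_measure, sub_zero, VectorMeasure.integral_toSignedMeasure]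
  exact integral_unreduce hF

end Existence

/-! ### The closed form over a real denominator. -/

section Algebra

variable {m : ℝ} {h : ℝ → ℝ}

theorem ofReal_norm_sq_one_sub_fourierHat (ω : ℝ) :
    ((‖1 - (m : ℂ) * fourierHat h ω‖ ^ 2 : ℝ) : ℂ) =
      (1 - m * fourierHat h ω) * (1 - m * fourierHat h (-ω)) := by
  rw [← Complex.normSq_eq_norm_sq, ← Complex.mul_conj, fourierHat_neg]
  simp

theorem denom_pos (hm0 : 0 < m) (hm1 : m < 1) (h_nonneg : ∀ x, 0 ≤ h x) (h_int : ∫ x, h x = 1)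
    (ω₁ ω₂ : ℝ) : 0 < denom m h ω₁ ω₂ := by
  have hne := one_sub_fourierHat_ne_zero hm0 hm1 h_nonneg h_int
  have := fun ω => norm_pos_iff.2 (hne ω)
  exact mul_pos (mul_pos (pow_pos (this _) 2) (pow_pos (this _) 2)) (pow_pos (this _) 2)

/-- Over the common denominator `∏ |1 - m ĥ|²` the numerator is `∑ dᵢ dⱼ - 2 d₁ d₂ d₃`, summed over
pairs, with `dⱼ = 1 - m ĥ(-ωⱼ)`. The terms of first order in `m ĥ` cancel, which leaves `1 - m² Q`.
-/
theorem R_mul_eq_div_denom (hm0 : 0 < m) (hm1 : m < 1) (h_nonneg : ∀ x, 0 ≤ h x)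
    (h_int : ∫ x, h x = 1) (ω₁ ω₂ : ℝ) :
    R m h ω₁ * R m h ω₂ * R m h (-ω₁ - ω₂) *
        (R m h (-ω₁) + R m h (-ω₂) + R m h (-(-ω₁ - ω₂)) - 2) =
      (1 - (m : ℂ) ^ 2 * Q m h ω₁ ω₂) / (denom m h ω₁ ω₂ : ℂ) := by
  have hne := one_sub_fourierHat_ne_zero hm0 hm1 h_nonneg h_int
  have e : -(-ω₁ - ω₂) = ω₁ + ω₂ := by ring
  have h1 := hne ω₁
  have h2 := hne ω₂
  have h3 := hne (-ω₁ - ω₂)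
  have h4 := hne (-ω₁)
  have h5 := hne (-ω₂)
  have h6 := hne (ω₁ + ω₂)
  rw [denom, Complex.ofReal_mul, Complex.ofReal_mul, ofReal_norm_sq_one_sub_fourierHat,
    ofReal_norm_sq_one_sub_fourierHat, ofReal_norm_sq_one_sub_fourierHat, e, Q]
  simp only [R]
  -- The six values are treated as independent unknowns: the identity is rational and needs only
  -- nonvanishing denominators.
  generalize fourierHat h ω₁ = a₁ at *
  generalize fourierHat h ω₂ = a₂ at *
  generalize fourierHat h (-ω₁ - ω₂) = a₃ at *
  generalize fourierHat h (-ω₁) = b₁ at *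
  generalize fourierHat h (-ω₂) = b₂ at *
  generalize fourierHat h (ω₁ + ω₂) = b₃ at *
  field_simp
  ring

end Algebra

end BranchingCluster

/-! ### The main theorem. -/

theorem mainTheorem2 {Ω : Type*} [MeasurableSpace Ω] (P : Measure Ω) [IsProbabilityMeasure P]
    (ν m lam : ℝ) (hν : 0 < ν) (hm0 : 0 < m) (hm1 : m < 1) (hlam : lam = ν / (1 - m))
    (h : ℝ → ℝ) (h_meas : Measurable h) (h_nonneg : ∀ x, 0 ≤ h x) (h_int : ∫ x, h x = 1)
    (N : Ω → Measure ℝ) (hN : IsPoissonBranchingClusterProcess P ν m h N) :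
    ∃ γ : SignedMeasure (ℝ × ℝ),
      IsReducedThirdCompleteCumulant P N γ ∧
      (∀ γ' : SignedMeasure (ℝ × ℝ), IsReducedThirdCompleteCumulant P N γ' → γ' = γ) ∧
      ∀ ω₁ ω₂ ω₃ : ℝ, ω₃ = -ω₁ - ω₂ →
        fourierStieltjes γ ω₁ ω₂ =
          (lam : ℂ) * R m h ω₁ * R m h ω₂ * R m h ω₃ *
            (R m h (-ω₁) + R m h (-ω₂) + R m h (-ω₃) - 2) ∧
        fourierStieltjes γ ω₁ ω₂ =
          (lam : ℂ) * ((1 - (m : ℂ) ^ 2 * Q m h ω₁ ω₂) / (denom m h ω₁ ω₂ : ℂ)) ∧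
        0 < denom m h ω₁ ω₂ ∧
        (fourierStieltjes γ ω₁ ω₂).im =
          -lam * m ^ 2 * ((Q m h ω₁ ω₂).im / denom m h ω₁ ω₂) := by
  obtain ⟨μ, hμ, ρ, hρ, T, hμP, hρP, hT, hmap, hNT⟩ := hN.exists_law
  have hΛ : (offspringIntensity m h) Set.univ = ENNReal.ofReal m :=
    offspringIntensity_univ hm0 h_nonneg h_int
  have hΛr : (offspringIntensity m h).real Set.univ = m := by
    rw [Measure.real, hΛ, ENNReal.toReal_ofReal hm0.le]
  have hΛf : IsFiniteMeasure (offspringIntensity m h) := ⟨by rw [hΛ]; exact ENNReal.ofReal_lt_top⟩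
  obtain ⟨θ, hθ, hfin, he⟩ := exists_exp_moment_cluster hμP (by rwa [hΛr]) (by rwa [hΛr])
  have hTf := isFiniteMeasure_tripleLaw (μ := μ) hθ hfin he
  have hRf := isFiniteMeasure_reducedMeasure (ν := ν) (μ := μ)
  have hred := isReducedThirdCompleteCumulant_reducedMeasure hν hρP hT hmap hNT hfin hθ he
  refine ⟨_, hred, fun γ' hγ' => hγ'.unique hred, fun ω₁ ω₂ ω₃ hω => ?_⟩
  subst hω
  have hF : fourierStieltjes (reducedMeasure ν μ).toSignedMeasure ω₁ ω₂ =
      (lam : ℂ) * (R m h ω₁ * R m h ω₂ * R m h (-ω₁ - ω₂) *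
        (R m h (-ω₁) + R m h (-ω₂) + R m h (-(-ω₁ - ω₂)) - 2)) := by
    rw [fourierStieltjes_reducedMeasure hν, integral_clusterHat_mul_mul hm0 hm1 h_meas h_nonneg
      h_int hμP hθ hfin he (by ring), hlam, ← mul_assoc]
    push_cast
    rw [div_eq_mul_inv]
  have hF' := hF
  rw [R_mul_eq_div_denom hm0 hm1 h_nonneg h_int] at hF'
  refine ⟨by rw [hF]; ring, hF', denom_pos hm0 hm1 h_nonneg h_int ω₁ ω₂, ?_⟩
  -- The denominator, `lam` and the constant `1` are real, so only `Q` contributes to the imaginary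
  -- part.
  rw [hF', Complex.im_ofReal_mul, Complex.div_ofReal_im, Complex.sub_im, Complex.one_im,
    ← Complex.ofReal_pow, Complex.im_ofReal_mul]
  ring
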